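/- A (rooted planar) map is a cellular embedding of a connected planar graph (loops and multiple edges allowed) into the oriented sphere, considered up to orientation-preserving homeomorphism, together with a root: an additional half-edge pointing on a vertex (the root-vertex) from one of its corners, which does not count as an edge. A (plane) tree is a rooted map with a single face. A tree-rooted map $M_T$ is a rooted map $M$ together with a distinguished spanning tree $T$ of $M$, which inherits the root. The size of a map, a tree or a tree-rooted map is its number of edges. The tour of a tree means following its border in counterclockwise direction (with the tree on the left), starting and finishing at the root; it orders the vertices of a tree by their first appearance, and the tour of a spanning tree $T$ of $M$ orders the half-edges of $M$ that are not in $T$. A non-crossing partition of size $m$ is an equivalence relation $\sim$ on $\{1,\dots,m\}$ such that no $a<b<c<d$ satisfy $a\sim c$, $b\sim d$ and $a\not\sim b$. Let $M_T$ be a tree-rooted map of size $n$. Orient its edges as follows: the edges of $T$ are oriented from the root to the leaves, and each edge not in $T$ is oriented so that its head (the half-edge at its end) precedes its tail (the half-edge at its origin) around $T$, i.e. is met first in the tour of $T$. The root is considered as a head. Then replace each vertex $v$ by as many vertices as there are heads incident to $v$, each tail $t$ at $v$ remaining adjacent to exactly one head, namely the first head encountered in counterclockwise direction around $v$ starting from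 $t$; the cyclic orders of half-edges around the new vertices are inherited from those of $M$. Let $\varphi_0$ be the resulting object, with the same root, and let $\varphi_1$ be the equivalence relation on its vertices, numbered $1,2,\dots$ by their order of appearance around $\varphi_0$, for which two vertices are equivalent if they come from the same vertex of $M$. Theorem. Let $n\ge 0$. For every tree-rooted map $M_T$ of size $n$, $\varphi_0$ is a plane tree of size $n$ (hence has $n+1$ vertices) and $\varphi_1$ is a non-crossing partition of size $n+1$. The mapping $\Phi: M_T\mapsto(\varphi_0,\varphi_1)$ is a bijection from the set of tree-rooted maps of size $n$ onto the Cartesian product of the set of plane trees of size $n$ and the set of non-crossing partitions of size $n+1$. Consequently the number of tree-rooted maps of size $n$ is $\mathrm{Cat}(n)\,\mathrm{Cat}(n+1)$, where $\mathrm{Cat}(n)=\frac{1}{n+1}\binom{2n}{n}$. -/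

import Mathlib

/-!
Rooted planar maps, considered up to orientation-preserving homeomorphism, are represented in the
standard way by their rotation systems: a finite set `H` of half-edges, the permutation `rot` that
sends a half-edge to the next one in counterclockwise direction around its vertex, and the
involution `edge` that exchanges the two halves of every edge. The root is an additional half-edge
(an arrow pointing on the root-vertex), which is not a part of an edge: it is the unique fixed
point of `edge`. Vertices are the cycles of `rot`.
-/

theorem firstReturn_exists {H ι : Type*} [Finite H] (f : Equiv.Perm H) (p : H → ι) (x : H) :
    ∃ k : ℕ, 0 < k ∧ p (f^[k] x) = p x := by
  refine ⟨orderOf f, orderOf_pos f, ?_⟩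
  rw [← Equiv.Perm.coe_pow, pow_orderOf_eq_one]
  rfl

open Classical in
/-- The least `k > 0` for which the `k`-th iterate of `f` brings `x` back to its class. -/
noncomputable def firstReturnTime {H ι : Type*} [Finite H] (f : Equiv.Perm H) (p : H → ι)
    (x : H) : ℕ :=
  Nat.find (firstReturn_exists f p x)

open Classical in
theorem firstReturnTime_spec {H ι : Type*} [Finite H] (f : Equiv.Perm H) (p : H → ι) (x : H) :
    0 < firstReturnTime f p x ∧ p (f^[firstReturnTime f p x] x) = p x :=
  Nat.find_spec (firstReturn_exists f p x)

open Classical in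
theorem firstReturnTime_le {H ι : Type*} [Finite H] (f : Equiv.Perm H) (p : H → ι) (x : H)
    {k : ℕ} (hk : 0 < k) (h : p (f^[k] x) = p x) : firstReturnTime f p x ≤ k :=
  Nat.find_min' (firstReturn_exists f p x) ⟨hk, h⟩

theorem firstReturn_aux {H ι : Type*} [Finite H] (f : Equiv.Perm H) (p : H → ι) {x y : H}
    (hle : firstReturnTime f p x ≤ firstReturnTime f p y)
    (h : f^[firstReturnTime f p x] x = f^[firstReturnTime f p y] y) : x = y := by
  obtain ⟨hx0, hx⟩ := firstReturnTime_spec f p x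
  obtain ⟨hy0, hy⟩ := firstReturnTime_spec f p y
  obtain ⟨d, hd⟩ := Nat.exists_eq_add_of_le hle
  have h1 : x = f^[d] y := by
    rw [hd, Function.iterate_add_apply] at h
    exact (f.injective.iterate _) h
  rcases Nat.eq_zero_or_pos d with rfl | hpos
  · simpa using h1
  · have h2 : p (f^[d] y) = p y := by rw [← h1, ← hx, h, hy]
    have := firstReturnTime_le f p y hpos h2
    omega

theorem firstReturn_injective {H ι : Type*} [Finite H] (f : Equiv.Perm H) (p : H → ι) :
    Function.Injective fun x => f^[firstReturnTime f p x] x := by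
  intro x y h
  rcases le_total (firstReturnTime f p x) (firstReturnTime f p y) with hle | hle
  · exact firstReturn_aux f p hle h
  · exact (firstReturn_aux f p hle h.symm).symm

/-- First return of the permutation `f` to the classes `{y | p y = p x}`: the point `x` is sent to
the first of `f x, f (f x), …` in the same class as `x`. In words, every class inherits the cyclic
orders of `f`, the other elements being skipped. -/
noncomputable def firstReturn {H ι : Type*} [Finite H] (f : Equiv.Perm H) (p : H → ι) :
    Equiv.Perm H :=
  Equiv.ofBijective (fun x => f^[firstReturnTime f p x] x)
    (Finite.injective_iff_bijective.mp (firstReturn_injective f p))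

theorem firstReturn_class {H ι : Type*} [Finite H] (f : Equiv.Perm H) (p : H → ι) (x : H) :
    p (firstReturn f p x) = p x :=
  (firstReturnTime_spec f p x).2

/-- The raw data of a rooted map with set of half-edges `H`. -/
structure MapData (H : Type*) where
  /-- the next half-edge in counterclockwise direction around the same vertex -/
  rot : Equiv.Perm H
  /-- the other half of the same edge (the root is fixed) -/
  edge : Equiv.Perm H
  /-- the root -/
  root : H

namespace MapData

variable {H : Type*}

/-- `x` and `y` are incident to the same vertex. -/
def SameVertex (M : MapData H) (x y : H) : Prop := M.rot.SameCycle x y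

/-- The number of vertices. -/
noncomputable def numVertices (M : MapData H) : ℕ :=
  Nat.card (Quotient (Equiv.Perm.SameCycle.setoid M.rot))

/-- The number of edges: the cycles of `edge`, except for the fixed point formed by the root. -/
noncomputable def numEdges (M : MapData H) : ℕ :=
  Nat.card {q : Quotient (Equiv.Perm.SameCycle.setoid M.edge) //
    q ≠ Quotient.mk (Equiv.Perm.SameCycle.setoid M.edge) M.root}

/-- The number of faces. -/
noncomputable def numFaces (M : MapData H) : ℕ :=
  Nat.card (Quotient (Equiv.Perm.SameCycle.setoid (M.rot * M.edge)))

/-- The vertices incident to `x` and `y` are joined by a path whose edges have their half-edges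
in `S`. -/
def Joined (M : MapData H) (S : Set H) : H → H → Prop :=
  Relation.EqvGen fun x y => y = M.rot x ∨ (x ∈ S ∧ y = M.edge x)

/-- Rooted planar maps: connected, and of genus `0` by Euler's formula. -/
structure IsRootedMap (M : MapData H) : Prop where
  edge_edge : ∀ x, M.edge (M.edge x) = x
  edge_eq_self_iff : ∀ x, M.edge x = x ↔ x = M.root
  connected : ∀ x y, M.Joined Set.univ x y
  euler : M.numVertices + M.numFaces = M.numEdges + 2

/-- Planted plane trees: rooted planar maps with a single face. -/
def IsPlaneTree (M : MapData H) : Prop := M.IsRootedMap ∧ M.numFaces = 1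

/-- The submap with set of half-edges `T` (which contains the root and both or none of the halves
of an edge). -/
noncomputable def submap [Finite H] (M : MapData H) (T : Set H) (hroot : M.root ∈ T)
    (hedge : ∀ x, M.edge x ∈ T ↔ x ∈ T) : MapData T where
  rot := (firstReturn M.rot fun x => x ∈ T).subtypePerm
    fun x => iff_of_eq (firstReturn_class M.rot (fun x => x ∈ T) x)
  edge := M.edge.subtypePerm hedge
  root := ⟨M.root, hroot⟩

/-- `T` is the set of half-edges (including the root) of a spanning tree of `M`: a submap that is
a tree and contains every vertex. -/
def IsSpanningTree [Finite H] (M : MapData H) (T : Set H) : Prop :=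
  (∃ (hroot : M.root ∈ T) (hedge : ∀ x, M.edge x ∈ T ↔ x ∈ T),
    (M.submap T hroot hedge).IsPlaneTree) ∧
  ∀ x, ∃ y ∈ T, M.SameVertex x y

open Classical in
/-- One step of the tour of `T`, in counterclockwise direction around `T` (that is, with `T` on the
left): when the half-edge `x` is met, we follow the border of its edge if `x` is in `T`, and cross
`x` otherwise; in both cases we proceed to the next half-edge around the vertex where we are. -/
noncomputable def tourStep (M : MapData H) (T : Set H) (x : H) : H :=
  if x ∈ T then M.rot (M.edge x) else M.rot x

/-- The half-edge met at time `k` of the tour of `T`, which starts at the root. -/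
noncomputable def tour (M : MapData H) (T : Set H) (k : ℕ) : H := (M.tourStep T)^[k] M.root

/-- The half-edge `x` precedes the half-edge `y` around `T`. -/
def Precedes (M : MapData H) (T : Set H) (x y : H) : Prop :=
  ∃ k, M.tour T k = x ∧ ∀ j ≤ k, M.tour T j ≠ y

/-- The orientation of `M` given by the spanning tree `T`, as the set of heads.
* The root is a head.
* The edges in `T` are oriented from the root to the leaves: a half-edge of `T` is a head if it lies
  on the side away from the root when its edge is removed from `T`.
* An edge not in `T` is oriented so that its head precedes its tail around `T`. -/
def treeHeads (M : MapData H) (T : Set H) : Set H :=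
  {x | x = M.root ∨
    (x ∈ T ∧ ¬ M.Joined (T \ {x, M.edge x}) M.root x) ∨
    (x ∉ T ∧ M.Precedes T x (M.edge x))}

open Classical in
/-- The first head encountered in counterclockwise direction around the vertex of `x`, starting
from `x` (a head is sent to itself). Here `O` is the set of heads. -/
noncomputable def firstHead (M : MapData H) (O : Set H) (x : H) : H :=
  if h : ∃ k : ℕ, M.rot^[k] x ∈ O then M.rot^[Nat.find h] x else x

/-- The map produced by the vertex explosion process from the orientation of `M` with set of heads
`O`: every vertex is replaced by as many vertices as incident heads, each tail being kept
adjacent only to the first head encountered in counterclockwise direction. The cyclic order around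
the new vertices is inherited from `M`. -/
noncomputable def explosion [Finite H] (M : MapData H) (O : Set H) : MapData H where
  rot := firstReturn M.rot (M.firstHead O)
  edge := M.edge
  root := M.root

/-- At time `k`, the tour of the tree `M` arrives for the first time at some vertex. -/
def IsDiscoveryTime (M : MapData H) (k : ℕ) : Prop :=
  ∀ j < k, ¬ M.SameVertex (M.tour Set.univ j) (M.tour Set.univ k)

/-- A half-edge incident to the `i`-th vertex of the tree `M` (counting from `0`), in the order of
appearance around `M`. -/
noncomputable def nthVertex (M : MapData H) (i : ℕ) : H :=
  M.tour Set.univ (Nat.nth M.IsDiscoveryTime i)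

/-- The equivalence relation on the vertices of the exploded map, numbered by their order
of appearance around that tree: two of them are equivalent if they come from the same
vertex of `M`. -/
noncomputable def explosionRel [Finite H] (M : MapData H) (O : Set H) (m : ℕ) : Setoid (Fin m) :=
  Setoid.comap (fun i : Fin m => (M.explosion O).nthVertex i)
    (Equiv.Perm.SameCycle.setoid M.rot)

/-- `e` is an isomorphism of rooted maps. -/
structure IsIso {H' : Type*} (M : MapData H) (N : MapData H') (e : H ≃ H') : Prop where
  rot : ∀ x, e (M.rot x) = N.rot (e x)
  edge : ∀ x, e (M.edge x) = N.edge (e x)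
  root : e M.root = N.root

theorem IsIso.refl (M : MapData H) : M.IsIso M (Equiv.refl H) :=
  ⟨fun _ => rfl, fun _ => rfl, rfl⟩

theorem IsIso.symm {H' : Type*} {M : MapData H} {N : MapData H'} {e : H ≃ H'}
    (h : M.IsIso N e) : N.IsIso M e.symm :=
  ⟨fun x => by rw [e.symm_apply_eq, h.rot, e.apply_symm_apply],
    fun x => by rw [e.symm_apply_eq, h.edge, e.apply_symm_apply],
    by rw [e.symm_apply_eq, h.root]⟩

theorem IsIso.trans {H' H'' : Type*} {M : MapData H} {N : MapData H'} {P : MapData H''}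
    {e : H ≃ H'} {e' : H' ≃ H''} (h : M.IsIso N e) (h' : N.IsIso P e') :
    M.IsIso P (e.trans e') :=
  ⟨fun x => by simp [h.rot, h'.rot], fun x => by simp [h.edge, h'.edge],
    by simp [h.root, h'.root]⟩

end MapData

/-- Planted plane trees with `n` edges and labelled half-edges (`2 n` of them, and the root). -/
def LabelledPlaneTree (n : ℕ) : Type :=
  {M : MapData (Fin (2 * n + 1)) // M.IsPlaneTree}

/-- Isomorphism of plane trees. -/
instance LabelledPlaneTree.setoid (n : ℕ) : Setoid (LabelledPlaneTree n) where
  r M N := ∃ e, M.1.IsIso N.1 e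
  iseqv := ⟨fun M => ⟨_, .refl M.1⟩, fun ⟨_, h⟩ => ⟨_, h.symm⟩, fun ⟨_, h⟩ ⟨_, h'⟩ => ⟨_, h.trans h'⟩⟩

/-- Planted plane trees of size `n`. -/
def PlaneTree (n : ℕ) : Type := Quotient (LabelledPlaneTree.setoid n)

/-- Tree-rooted maps with `n` edges and labelled half-edges (`2 n` of them, and the root). -/
structure LabelledTreeRootedMap (n : ℕ) where
  /-- the underlying rooted map -/
  map : MapData (Fin (2 * n + 1))
  isRootedMap : map.IsRootedMap
  /-- the distinguished spanning tree -/
  tree : Set (Fin (2 * n + 1))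
  isSpanningTree : map.IsSpanningTree tree

namespace LabelledTreeRootedMap

variable {n : ℕ}

/-- The tree produced from a tree-rooted map by orienting it and exploding its vertices. -/
noncomputable def phi0 (M : LabelledTreeRootedMap n) : MapData (Fin (2 * n + 1)) :=
  M.map.explosion (M.map.treeHeads M.tree)

/-- The partition produced from a tree-rooted map by orienting it and exploding its vertices. -/
noncomputable def phi1 (M : LabelledTreeRootedMap n) : Setoid (Fin (n + 1)) :=
  M.map.explosionRel (M.map.treeHeads M.tree) (n + 1)

/-- Isomorphism of tree-rooted maps. -/
instance setoid (n : ℕ) : Setoid (LabelledTreeRootedMap n) where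
  r M N := ∃ e, M.map.IsIso N.map e ∧ ∀ x, e x ∈ N.tree ↔ x ∈ M.tree
  iseqv :=
    ⟨fun M => ⟨_, .refl M.map, fun _ => Iff.rfl⟩,
      fun ⟨e, h, ht⟩ => ⟨_, h.symm, fun x => by rw [← ht, e.apply_symm_apply]⟩,
      fun ⟨e, h, ht⟩ ⟨e', h', ht'⟩ => ⟨_, h.trans h', fun x => by
        rw [Equiv.trans_apply, ht', ht]⟩⟩

end LabelledTreeRootedMap

/-- Tree-rooted maps of size `n`. -/
def TreeRootedMap (n : ℕ) : Type := Quotient (LabelledTreeRootedMap.setoid n)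

/-- The equivalence relation `r` on a linearly ordered set is a non-crossing partition. -/
def IsNonCrossing {S : Type*} [LinearOrder S] (r : Setoid S) : Prop :=
  ∀ a b c d : S, a < b → b < c → c < d → r a c → r b d → r a b

/-- Non-crossing partitions of size `m`. -/
def NonCrossingPartition (m : ℕ) : Type := {r : Setoid (Fin m) // IsNonCrossing r}

/-! `Φ` is shown to be well defined and injective by following the tour of `T`. Its surjectivity
comes from cardinalities, without an inverse map. Plane trees inject into Dyck words and
non-crossing partitions obey the Catalan recurrence, so the target has at most `catalan n * catalan
(n + 1)` elements. Shuffles of two Dyck words give at least that many tree-rooted maps.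

Planarity enters through linear algebra mod 2. The tour of `T` is a cyclic permutation `τ` of the
half-edges. Multiplied by the swap of the edges in `T` it gives the rotation, whose cycles are the
vertices; multiplied by the swap of the other edges it gives the face permutation. The product of a
cyclic permutation and an involution with `e` transpositions has at most `e + 1` cycles, and Euler's
formula says that both bounds are attained. By `numCycles_eq_iff_exists_isEdgeCut`, this means that
each edge is cut by a function mod 2 on the cycles. Such a function is the indicator of the interval
of the tour between the two halves of the edge. Hence edges of `T` do not cross each other, and
neither do the other edges. `IsTreeTour` records this, and the analysis of the explosion rests on
it.

The contour of the exploded map is built along the tour of `T` by `Run`, which inserts the half-edge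
being met at a cursor. One stack holds the open edges of `T`, the other the open edges outside `T`;
the absence of crossings makes every closing edge the top of its stack (`run_progress`). At the end
the contour is a single cycle through all half-edges, so there is one face. Each exploded vertex has
exactly one head, so Euler's formula gives a plane tree. Meanwhile the list of heads in discovery
order grows only by a head at a fresh vertex of `M`, or by a head placed next to one at the same
vertex. Neither creates a crossing (`run_discovered`).

For injectivity (`isIso_of_explosion`), the heads around a vertex of `M` follow each other
cyclically in the reverse of their discovery order (`nextHead_spec`, `headRank_lt_iff`). The tree
and the partition therefore determine the rotation of `M`. Then `T` is recovered along the tour: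
apart from the root, a half-edge whose edge is met for the first time lies in `T` exactly when it is
a tail. -/

open Equiv.Perm

/-! ### Cycles of permutations and edge cuts mod 2 -/

section Cycles

variable {H : Type*}

theorem sameCycle_iff_exists_iterate [Finite H] {f : Equiv.Perm H} {x y : H} :
    f.SameCycle x y ↔ ∃ k : ℕ, f^[k] x = y := by
  constructor
  · intro h
    obtain ⟨i, hi⟩ := h.exists_nat_pow_eq
    exact ⟨i, by rw [← Equiv.Perm.coe_pow]; exact hi⟩
  · rintro ⟨k, rfl⟩
    exact ⟨k, by rw [zpow_natCast, Equiv.Perm.coe_pow]⟩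

theorem firstReturn_apply [Finite H] {ι : Type*} (f : Equiv.Perm H) (p : H → ι) (x : H) :
    firstReturn f p x = f^[firstReturnTime f p x] x := rfl

theorem firstReturn_sameCycle [Finite H] {ι : Type*} (f : Equiv.Perm H) (p : H → ι) (x : H) :
    f.SameCycle x (firstReturn f p x) :=
  sameCycle_iff_exists_iterate.2 ⟨_, rfl⟩

theorem firstReturn_eq_iterate [Finite H] {ι : Type*} (f : Equiv.Perm H) (p : H → ι) {x : H} {k : ℕ}
    (hk : 0 < k) (h : p (f^[k] x) = p x) (hlt : ∀ j, 0 < j → j < k → p (f^[j] x) ≠ p x) :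
    firstReturn f p x = f^[k] x := by
  have h1 := firstReturnTime_le f p x hk h
  obtain ⟨h2, h3⟩ := firstReturnTime_spec f p x
  have : firstReturnTime f p x = k := by
    by_contra hne
    exact hlt _ h2 (by omega) h3
  rw [firstReturn_apply, this]

theorem firstReturn_eq_of_apply [Finite H] {ι : Type*} (f : Equiv.Perm H) (p : H → ι) {x : H}
    (h : p (f x) = p x) : firstReturn f p x = f x :=
  firstReturn_eq_iterate f p (k := 1) one_pos h (fun j h1 h2 => by omega)

/-- An `f`-path between two elements of one class is a concatenation of first returns; the strong
induction removes the first of them. -/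
theorem sameCycle_firstReturn_iff [Finite H] {ι : Type*} (f : Equiv.Perm H) (p : H → ι) {x y : H} :
    (firstReturn f p).SameCycle x y ↔ f.SameCycle x y ∧ p x = p y := by
  constructor
  · intro h
    obtain ⟨k, rfl⟩ := sameCycle_iff_exists_iterate.1 h
    clear h
    induction k with
    | zero => exact ⟨.refl _ _, rfl⟩
    | succ k ih =>
      rw [Function.iterate_succ_apply']
      exact ⟨ih.1.trans (firstReturn_sameCycle _ _ _), ih.2.trans (firstReturn_class f p _).symm⟩
  · rintro ⟨h, hp⟩
    obtain ⟨k, rfl⟩ := sameCycle_iff_exists_iterate.1 h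
    clear h
    induction k using Nat.strong_induction_on generalizing x with
    | _ k ih =>
      rcases Nat.eq_zero_or_pos k with rfl | hk
      · exact .refl _ _
      · have h1 := firstReturnTime_le f p x hk hp.symm
        obtain ⟨h2, h3⟩ := firstReturnTime_spec f p x
        have h4 : f^[k] x = f^[k - firstReturnTime f p x] (firstReturn f p x) := by
          rw [firstReturn_apply, ← Function.iterate_add_apply]
          congr 2; omega
        rw [h4] at hp ⊢
        have := ih (k - firstReturnTime f p x) (by omega) (x := firstReturn f p x)
          ((firstReturn_class f p x).trans hp)
        exact (sameCycle_iff_exists_iterate.2 ⟨1, rfl⟩ :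
          (firstReturn f p).SameCycle x (firstReturn f p x)).trans this

/-- The number of cycles (fixed points included) of a permutation. -/
noncomputable def numCycles (f : Equiv.Perm H) : ℕ :=
  Nat.card (Quotient (Equiv.Perm.SameCycle.setoid f))

theorem numCycles_eq_one_iff [Nonempty H] {f : Equiv.Perm H} :
    numCycles f = 1 ↔ ∀ x y, f.SameCycle x y := by
  rw [numCycles, Nat.card_eq_one_iff_unique]
  constructor
  · rintro ⟨h, -⟩ x y
    exact Quotient.exact (s := Equiv.Perm.SameCycle.setoid f) (h.elim _ _)
  · intro h
    refine ⟨⟨fun a b => ?_⟩, ⟨Quotient.mk _ (Classical.arbitrary H)⟩⟩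
    induction a using Quotient.inductionOn
    induction b using Quotient.inductionOn
    exact Quotient.sound (h _ _)

theorem numCycles_subtypePerm {f g : Equiv.Perm H} {p : H → Prop} (hg : ∀ x, p (g x) ↔ p x)
    (hgf : ∀ x y, p x → p y → (g.SameCycle x y ↔ f.SameCycle x y))
    (hp : ∀ x, ∃ y, p y ∧ f.SameCycle x y) : numCycles (g.subtypePerm hg) = numCycles f := by
  let s : Setoid {x // p x} := Equiv.Perm.SameCycle.setoid (g.subtypePerm hg)
  let s' : Setoid H := Equiv.Perm.SameCycle.setoid f
  let φ : Quotient s → Quotient s' := Quotient.map (fun x => x.1) fun a b h =>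
    (hgf _ _ a.2 b.2).1 (sameCycle_subtypePerm.1 h)
  refine Nat.card_congr (Equiv.ofBijective φ ⟨?_, ?_⟩)
  · intro a b
    induction a using Quotient.inductionOn
    induction b using Quotient.inductionOn
    intro h
    exact Quotient.sound (sameCycle_subtypePerm.2 ((hgf _ _ (Subtype.prop _) (Subtype.prop _)).2
      (Quotient.exact h)))
  · intro b
    induction b using Quotient.inductionOn with
    | _ b =>
      obtain ⟨y, hy, hyb⟩ := hp b
      exact ⟨Quotient.mk _ ⟨y, hy⟩, Quotient.sound hyb.symm⟩

theorem two_mul_card_openers [Finite H] {γ : Equiv.Perm H} (hγ : ∀ x, γ (γ x) = x) {pos : H → ℕ}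
    (hpos : Function.Injective pos) :
    2 * Nat.card {x // pos x < pos (γ x)} = Nat.card {x // γ x ≠ x} := by
  have e1 : {x // pos x < pos (γ x)} ≃ {x // pos (γ x) < pos x} :=
    γ.subtypeEquiv fun x => by rw [hγ]
  have e2 : {x // γ x ≠ x} ≃ {x // pos x < pos (γ x)} ⊕ {x // pos (γ x) < pos x} := by
    classical
    refine (Equiv.subtypeEquivRight fun x => ?_).trans (subtypeOrEquiv _ _ ?_)
    · rw [← hpos.ne_iff]; exact ne_comm.trans lt_or_lt_iff_ne.symm
    · rw [Pi.disjoint_iff]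
      intro x
      rw [Prop.disjoint_iff]
      simp only [not_and, not_lt]
      grind
  rw [Nat.card_congr e2, Nat.card_sum, ← Nat.card_congr e1]
  ring

/-- Each 2-cycle has exactly one element met before its partner. Any injective `pos` is allowed, so
that edges can be counted along whichever tour is at hand. -/
theorem card_cycles_ne_eq_card_openers [Finite H] {γ : Equiv.Perm H} (hγ : ∀ x, γ (γ x) = x)
    {r : H} (hr : ∀ x, γ x = x ↔ x = r) {pos : H → ℕ} (hpos : Function.Injective pos) :
    Nat.card {q : Quotient (SameCycle.setoid γ) // q ≠ Quotient.mk (SameCycle.setoid γ) r}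
      = Nat.card {x // pos x < pos (γ x)} := by
  have key : ∀ x y, γ.SameCycle x y → y = x ∨ y = γ x := by
    intro x y h
    obtain ⟨k, rfl⟩ := sameCycle_iff_exists_iterate.1 h
    clear h
    induction k with
    | zero => exact .inl rfl
    | succ k ih =>
      rw [Function.iterate_succ_apply']
      rcases ih with h | h
      · rw [h]; exact .inr rfl
      · rw [h, hγ]; exact .inl rfl
  symm
  refine Nat.card_congr (Equiv.ofBijective
    (fun x => ⟨Quotient.mk (SameCycle.setoid γ) x.1, fun h => ?_⟩) ⟨?_, ?_⟩)
  · have hx := x.2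
    rcases key _ _ (Quotient.exact h) with h1 | h1
    · rw [← h1, (hr r).2 rfl] at hx; exact lt_irrefl _ hx
    · have h2 : x.1 = r := by rw [← hγ x.1, ← h1, (hr r).2 rfl]
      rw [h2, (hr r).2 rfl] at hx; exact lt_irrefl _ hx
  · rintro ⟨x, hx⟩ ⟨y, hy⟩ h
    rcases key _ _ (Quotient.exact (congrArg Subtype.val h)) with h1 | h1
    · exact Subtype.ext h1.symm
    · dsimp only at h1
      rw [h1, hγ] at hy; exact absurd hx hy.asymm
  · rintro ⟨q, hq⟩
    induction q using Quotient.inductionOn with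
    | _ x =>
      have hx : γ x ≠ x := fun h => hq (by rw [(hr x).1 h])
      rcases lt_or_gt_of_ne (hpos.ne hx) with h | h
      · refine ⟨⟨γ x, by rw [hγ]; exact h⟩, Subtype.ext (Quotient.sound ?_)⟩
        exact sameCycle_iff_exists_iterate.2 ⟨1, hγ x⟩
      · exact ⟨⟨x, h⟩, rfl⟩

/-- The differences along the openers of `β` of a function on the cycles of `τ * β`, and its value
at `r`. -/
noncomputable def cycleDiff (τ β : Equiv.Perm H) (pos : H → ℕ) (r : H) :
    (Quotient (SameCycle.setoid (τ * β)) → ZMod 2) →ₗ[ZMod 2]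
      ({x // pos x < pos (β x)} → ZMod 2) × ZMod 2 where
  toFun v := (fun x => v (Quotient.mk _ x.1) + v (Quotient.mk _ (β x.1)), v (Quotient.mk _ r))
  map_add' v w := by ext <;> simp; ring
  map_smul' c v := by ext <;> simp; ring

theorem zmod_two_add_eq_zero {a b : ZMod 2} : a + b = 0 ↔ a = b := by
  revert a b; decide

theorem zmod_two_add_eq_one {a b : ZMod 2} : a + b = 1 ↔ a ≠ b := by
  revert a b; decide

/-- A function in the kernel agrees on the two halves of every edge, so it is invariant under `β` as
well as under `τ * β`, hence under the transitive `τ`. It is constant, with value `0` at `r`. -/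
theorem cycleDiff_injective [Finite H] {τ β : Equiv.Perm H} (hτ : ∀ x y, τ.SameCycle x y)
    (hβ : ∀ x, β (β x) = x) {pos : H → ℕ} (hpos : Function.Injective pos) (r : H) :
    Function.Injective (cycleDiff τ β pos r) := by
  rw [injective_iff_map_eq_zero]
  intro v hv
  have h1 : v (Quotient.mk _ r) = 0 := congrArg Prod.snd hv
  have h2 : ∀ x, v (Quotient.mk _ (β x)) = v (Quotient.mk _ x) := by
    intro x
    rcases lt_trichotomy (pos x) (pos (β x)) with h | h | h
    · exact (zmod_two_add_eq_zero.1 (congrFun (congrArg Prod.fst hv) ⟨x, h⟩)).symm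
    · rw [← hpos h]
    · have := zmod_two_add_eq_zero.1
        (congrFun (congrArg Prod.fst hv) ⟨β x, by rw [hβ]; exact h⟩)
      dsimp only at this
      rw [hβ] at this
      exact this
  have h3 : ∀ x, v (Quotient.mk _ (τ x)) = v (Quotient.mk _ x) := by
    intro x
    have : (Quotient.mk _ (τ x) : Quotient (SameCycle.setoid (τ * β))) = Quotient.mk _ (β x) := by
      refine Quotient.sound (Equiv.Perm.SameCycle.symm (sameCycle_iff_exists_iterate.2 ⟨1, ?_⟩))
      simp [hβ]
    rw [this, h2]
  funext q
  induction q using Quotient.inductionOn with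
  | _ x =>
    obtain ⟨k, rfl⟩ := sameCycle_iff_exists_iterate.1 (hτ r x)
    induction k with
    | zero => exact h1
    | succ k ih => rw [Function.iterate_succ_apply', h3, ih]; rfl

/-- The function `v` on the cycles of `τ * β` vanishes at `r` and separates the two halves of the
edge of `x`, but of no other edge of `β`. -/
structure IsEdgeCut (τ β : Equiv.Perm H) (r x : H) (v : H → ZMod 2) : Prop where
  root : v r = 0
  invariant : ∀ y, v (τ (β y)) = v y
  ne : v (β x) ≠ v x
  eq : ∀ y, y ≠ x → y ≠ β x → v (β y) = v y

/-- A product of a cyclic permutation and an involution has the largest possible number of cycles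
if and only if every edge of the involution can be cut. -/
theorem numCycles_eq_iff_exists_isEdgeCut [Finite H] {τ β : Equiv.Perm H}
    (hτ : ∀ x y, τ.SameCycle x y) (hβ : ∀ x, β (β x) = x) {pos : H → ℕ}
    (hpos : Function.Injective pos) (r : H) :
    numCycles (τ * β) = Nat.card {x // pos x < pos (β x)} + 1 ↔
      ∀ x, pos x < pos (β x) → ∃ v, IsEdgeCut τ β r x v := by
  classical
  have := Fintype.ofFinite (Quotient (SameCycle.setoid (τ * β)))
  have := Fintype.ofFinite {x // pos x < pos (β x)}
  have hinj := cycleDiff_injective hτ hβ hpos r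
  have hd : Module.finrank (ZMod 2) (({x // pos x < pos (β x)} → ZMod 2) × ZMod 2) =
      Nat.card {x // pos x < pos (β x)} + 1 := by
    simp [Module.finrank_prod]
  have hd' : Module.finrank (ZMod 2) (Quotient (SameCycle.setoid (τ * β)) → ZMod 2) =
      numCycles (τ * β) := by
    rw [Module.finrank_fintype_fun_eq_card, numCycles, Nat.card_eq_fintype_card]
  constructor
  · intro h x hx
    -- Equal dimensions make the injective map surjective; the cut of `x` is a preimage of the basis
    -- vector at `x`.
    have hsurj := (LinearMap.injective_iff_surjective_of_finrank_eq_finrank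
      (hd'.trans (h.trans hd.symm))).1 hinj
    obtain ⟨v, hv⟩ := hsurj (fun y => if y = ⟨x, hx⟩ then 1 else 0, 0)
    have h1 : ∀ y (hy : pos y < pos (β y)), v (Quotient.mk _ y) + v (Quotient.mk _ (β y)) =
      if (⟨y, hy⟩ : {x // pos x < pos (β x)}) = ⟨x, hx⟩ then 1 else 0 :=
      fun y hy => congrFun (congrArg Prod.fst hv) ⟨y, hy⟩
    refine ⟨fun y => v (Quotient.mk _ y), congrArg Prod.snd hv, fun y => ?_, ?_, ?_⟩
    · exact congrArg v (Quotient.sound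
        (Equiv.Perm.SameCycle.symm (sameCycle_iff_exists_iterate.2 ⟨1, rfl⟩)))
    · have := h1 x hx
      rw [if_pos rfl, zmod_two_add_eq_one] at this
      exact this.symm
    · intro y hy1 hy2
      rcases lt_trichotomy (pos y) (pos (β y)) with h | h | h
      · have := h1 y h
        rw [if_neg (by simpa using hy1), zmod_two_add_eq_zero] at this
        exact this.symm
      · rw [← hpos h]
      · have := h1 (β y) (by rw [hβ]; exact h)
        rw [if_neg (by
          rw [Subtype.mk.injEq]; rintro rfl; exact hy2 (hβ y).symm), zmod_two_add_eq_zero, hβ] at this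
        exact this
  · intro h
    choose! v hv using h
    have hsurj : Function.Surjective (cycleDiff τ β pos r) := by
      rintro ⟨g, z⟩
      have hinv : ∀ x, pos x < pos (β x) → ∀ a b, (τ * β).SameCycle a b → v x a = v x b := by
        intro x hx a b hab
        obtain ⟨k, rfl⟩ := sameCycle_iff_exists_iterate.1 hab
        clear hab
        induction k with
        | zero => rfl
        | succ k ih =>
          rw [ih, Function.iterate_succ_apply']
          exact ((hv x hx).invariant _).symm
      let w : {x // pos x < pos (β x)} → Quotient (SameCycle.setoid (τ * β)) → ZMod 2 :=
        fun x => Quotient.lift (s := SameCycle.setoid (τ * β)) (v x.1) (hinv x.1 x.2)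
      -- The cuts have independent differences and vanish at `r`; the constant `z` sets the value at
      -- `r` and contributes `z + z = 0` to each difference.
      refine ⟨fun q => z + ∑ x, g x * w x q, Prod.ext (funext fun y => ?_) ?_⟩
      · have : ∀ x : {x // pos x < pos (β x)}, w x (Quotient.mk _ y.1) + w x (Quotient.mk _ (β y.1)) =
            if x = y then 1 else 0 := by
          intro x
          change v x.1 y.1 + v x.1 (β y.1) = _
          split_ifs with hxy
          · rw [zmod_two_add_eq_one, hxy]
            exact (hv y.1 y.2).ne.symm
          · rw [zmod_two_add_eq_zero]
            refine ((hv x.1 x.2).eq _ (fun h => hxy (Subtype.ext h.symm)) fun h => ?_).symm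
            have h3 := y.2
            rw [h, hβ] at h3
            exact absurd h3 x.2.asymm
        change (z + ∑ x, g x * w x (Quotient.mk _ y.1)) + (z + ∑ x, g x * w x (Quotient.mk _ (β y.1))) = g y
        calc _ = (z + z) + ∑ x, g x * (w x (Quotient.mk _ y.1) + w x (Quotient.mk _ (β y.1))) := by
              simp only [mul_add, Finset.sum_add_distrib]; ring
          _ = _ := by
              simp only [this]
              rw [zmod_two_add_eq_zero.2 rfl]
              simp
      · change z + ∑ x, g x * w x (Quotient.mk _ r) = z
        rw [Finset.sum_eq_zero, add_zero]
        intro x _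
        change g x * v x.1 r = 0
        rw [(hv x.1 x.2).root, mul_zero]
    rw [← hd', ← hd]
    exact (LinearEquiv.ofBijective _ ⟨hinj, hsurj⟩).finrank_eq

end Cycles

/-! ### Edge cuts as intervals of a cyclic order -/

section Position

variable {H : Type*}

theorem iterate_eq_of_lt_card [Finite H] {f : Equiv.Perm H} (hf : ∀ x y, f.SameCycle x y) (r : H) :
    Function.minimalPeriod f r = Nat.card H := by
  have hper : 0 < Function.minimalPeriod f r := by
    rw [Function.minimalPeriod_pos_iff_mem_periodicPts]
    exact f.injective.mem_periodicPts r
  have hb : Function.Bijective (fun k : Fin (Function.minimalPeriod f r) => f^[k] r) := by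
    constructor
    · intro a b h
      exact Fin.ext (Function.iterate_injOn_Iio_minimalPeriod a.2 b.2 h)
    · intro y
      obtain ⟨k, rfl⟩ := sameCycle_iff_exists_iterate.1 (hf r y)
      exact ⟨⟨k % _, Nat.mod_lt _ hper⟩, Function.iterate_mod_minimalPeriod_eq⟩
  rw [← Nat.card_eq_of_bijective _ hb, Nat.card_eq_fintype_card, Fintype.card_fin]

/-- The times at which a cyclic permutation reaches the points. -/
theorem exists_position [Finite H] {f : Equiv.Perm H} (hf : ∀ x y, f.SameCycle x y) (r : H) :
    ∃ pos : H → ℕ, (∀ x, pos x < Nat.card H) ∧ (∀ k < Nat.card H, pos (f^[k] r) = k) ∧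
      (∀ x, f^[pos x] r = x) ∧ f^[Nat.card H] r = r := by
  have hm := iterate_eq_of_lt_card hf r
  have : Nonempty H := ⟨r⟩
  have hsurj : ∀ x, ∃ k < Nat.card H, f^[k] r = x := by
    intro x
    obtain ⟨k, rfl⟩ := sameCycle_iff_exists_iterate.1 (hf r x)
    refine ⟨k % Nat.card H, Nat.mod_lt _ Nat.card_pos, ?_⟩
    rw [← hm]
    exact Function.iterate_mod_minimalPeriod_eq
  choose pos h1 h2 using hsurj
  refine ⟨pos, h1, fun k hk => ?_, h2, ?_⟩
  · exact Function.iterate_injOn_Iio_minimalPeriod (f := f) (x := r)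
      (by rw [hm]; exact h1 _) (by rw [hm]; exact hk) (h2 _)
  · rw [← hm]; exact Function.iterate_minimalPeriod

/-- Since `v (τ y) = v (β y)`, the value changes along `τ` exactly on leaving `x` and on leaving `β
x`, and it starts from `0` at `r`. This is why the interval excludes `x` and includes `β x`. -/
theorem IsEdgeCut.eq_indicator {τ β : Equiv.Perm H} {r x : H} {v : H → ZMod 2} {pos : H → ℕ}
    {N : ℕ} (hv : IsEdgeCut τ β r x v) (hβ : ∀ x, β (β x) = x)
    (h1 : ∀ k ≤ N, pos (τ^[k] r) = k) (h2 : ∀ x, τ^[pos x] r = x) (h3 : ∀ x, pos x ≤ N)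
    (hx : pos x < pos (β x)) (y : H) :
    v y = if pos x < pos y ∧ pos y ≤ pos (β x) then 1 else 0 := by
  have hflip : ∀ y, v (τ y) = v (β y) := fun y => by
    conv_lhs => rw [← hβ y]
    exact hv.invariant _
  have hd : ∀ a b c : ZMod 2, a ≠ b → c ≠ b → a = c := by decide
  have key : ∀ k ≤ N, v (τ^[k] r) = if pos x < k ∧ k ≤ pos (β x) then 1 else 0 := by
    intro k
    induction k with
    | zero => intro _; simpa using hv.root
    | succ k ih =>
      intro hk
      have ih := ih (by omega)
      have hpk := h1 k (by omega)
      rw [Function.iterate_succ_apply', hflip]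
      by_cases hkx : τ^[k] r = x
      · rw [hkx] at ih hpk ⊢
        rw [if_neg (by omega)] at ih
        rw [if_pos (by omega)]
        have := hv.ne
        rw [ih] at this
        revert this; generalize v (β x) = a; revert a; decide
      · by_cases hkx' : τ^[k] r = β x
        · rw [hkx'] at ih hpk ⊢
          rw [if_pos (by omega)] at ih
          rw [if_neg (by omega), hβ]
          have := hv.ne
          rw [ih] at this
          revert this; generalize v x = a; revert a; decide
        · rw [hv.eq _ hkx hkx', ih]
          have e1 : k ≠ pos x := fun h => hkx (by rw [h, h2])
          have e2 : k ≠ pos (β x) := fun h => hkx' (by rw [h, h2])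
          congr 1
          rw [eq_iff_iff]
          omega
  have := key (pos y) (h3 y)
  rwa [h2] at this

theorem IsEdgeCut.between_iff {τ β : Equiv.Perm H} {r x : H} {v : H → ZMod 2} {pos : H → ℕ}
    {N : ℕ} (hv : IsEdgeCut τ β r x v) (hβ : ∀ x, β (β x) = x)
    (h1 : ∀ k ≤ N, pos (τ^[k] r) = k) (h2 : ∀ x, τ^[pos x] r = x) (h3 : ∀ x, pos x ≤ N)
    (hx : pos x < pos (β x)) {y z : H} (hyz : v y = v z) :
    (pos x < pos y ∧ pos y ≤ pos (β x)) ↔ (pos x < pos z ∧ pos z ≤ pos (β x)) := by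
  rw [hv.eq_indicator hβ h1 h2 h3 hx, hv.eq_indicator hβ h1 h2 h3 hx] at hyz
  split_ifs at hyz with h h' h' <;> first | simp_all; done | exact iff_of_false h h'

end Position

/-! ### The tour of a spanning tree as a cyclic permutation -/

namespace MapData

variable {H : Type*}

open Classical in
/-- The involution that exchanges the halves of the edges in `S`. -/
noncomputable def edgeOn (M : MapData H) (S : Set H) (hS : ∀ x, M.edge x ∈ S ↔ x ∈ S) :
    Equiv.Perm H :=
  Equiv.Perm.ofSubtype (M.edge.subtypePerm hS)

variable {M : MapData H} {T S : Set H} (hT : ∀ x, M.edge x ∈ T ↔ x ∈ T)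

theorem edgeOn_of_mem {x : H} (hx : x ∈ T) : M.edgeOn T hT x = M.edge x := by
  classical
  rw [edgeOn, ofSubtype_apply_of_mem _ hx]; rfl

theorem edgeOn_of_notMem {x : H} (hx : x ∉ T) : M.edgeOn T hT x = x := by
  classical
  rw [edgeOn, ofSubtype_apply_of_not_mem _ hx]

theorem edgeOn_edgeOn (h : ∀ x, M.edge (M.edge x) = x) (x : H) :
    M.edgeOn T hT (M.edgeOn T hT x) = x := by
  by_cases hx : x ∈ T
  · rw [edgeOn_of_mem hT hx, edgeOn_of_mem hT ((hT x).2 hx), h]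
  · rw [edgeOn_of_notMem hT hx, edgeOn_of_notMem hT hx]

/-- The tour of `T` as a permutation. -/
noncomputable def tourPerm (M : MapData H) (T : Set H) (hT : ∀ x, M.edge x ∈ T ↔ x ∈ T) :
    Equiv.Perm H := M.rot * M.edgeOn T hT

theorem tourPerm_apply (x : H) : M.tourPerm T hT x = M.tourStep T x := by
  rw [tourPerm, Equiv.Perm.mul_apply, tourStep]
  split_ifs with h
  · rw [edgeOn_of_mem hT h]
  · rw [edgeOn_of_notMem hT h]

theorem tour_eq_iterate (k : ℕ) : M.tour T k = (M.tourPerm T hT)^[k] M.root := by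
  rw [tour, show M.tourStep T = M.tourPerm T hT from funext fun x => (tourPerm_apply hT x).symm]

theorem tourPerm_mul_edgeOn (h : ∀ x, M.edge (M.edge x) = x) :
    M.tourPerm T hT * M.edgeOn T hT = M.rot := by
  ext x
  simp [tourPerm, edgeOn_edgeOn hT h]

theorem compl_edge_mem (hT : ∀ x, M.edge x ∈ T ↔ x ∈ T) (x : H) : M.edge x ∈ Tᶜ ↔ x ∈ Tᶜ :=
  not_congr (hT x)

/-- With `tourPerm_mul_edgeOn`, this presents the vertices and the faces of `M` as the cycles of two
products of the same permutation with complementary involutions. -/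
theorem tourPerm_mul_edgeOn_compl :
    M.tourPerm T hT * M.edgeOn Tᶜ (compl_edge_mem hT) = M.rot * M.edge := by
  ext x
  simp only [tourPerm, Equiv.Perm.mul_apply]
  by_cases hx : x ∈ T
  · rw [edgeOn_of_notMem (compl_edge_mem hT) (by simpa using hx), edgeOn_of_mem hT hx]
  · rw [edgeOn_of_mem (compl_edge_mem hT) hx, edgeOn_of_notMem hT (mt (hT x).1 hx)]

section Submap

variable [Finite H] (hroot : M.root ∈ T)

/-- Outside `T` the tour turns like `rot`, so between two visits to `T` it follows an edge only at
its start. Its first return is the face permutation of the submap. -/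
theorem firstReturn_tourPerm {x : H} (hx : x ∈ T) :
    firstReturn (M.tourPerm T hT) (fun x => x ∈ T) x =
      firstReturn M.rot (fun x => x ∈ T) (M.edge x) := by
  have hx' := (hT x).2 hx
  set f := M.rot
  set k := firstReturnTime f (fun x => x ∈ T) (M.edge x) with hk
  obtain ⟨hk0, hk1⟩ := firstReturnTime_spec f (fun x => x ∈ T) (M.edge x)
  rw [← hk] at hk0 hk1
  have hmem : f^[k] (M.edge x) ∈ T := by simpa [hx'] using hk1
  have hnot : ∀ j, 0 < j → j < k → f^[j] (M.edge x) ∉ T := by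
    intro j h1 h2 h3
    have := firstReturnTime_le f (fun x => x ∈ T) (M.edge x) h1 (by simp [h3, hx'])
    omega
  have hit : ∀ j, 0 < j → j ≤ k → (M.tourPerm T hT)^[j] x = f^[j] (M.edge x) := by
    intro j h1 h2
    induction j with
    | zero => omega
    | succ j ih =>
      rcases Nat.eq_zero_or_pos j with rfl | hj
      · simp [tourPerm, edgeOn_of_mem hT hx, f]
      · rw [Function.iterate_succ_apply', ih hj (by omega), Function.iterate_succ_apply',
          tourPerm, Equiv.Perm.mul_apply, edgeOn_of_notMem hT (hnot j hj (by omega))]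
  rw [firstReturn_apply f, ← hk, ← hit k hk0 le_rfl]
  refine firstReturn_eq_iterate _ _ hk0 ?_ ?_
  · rw [hit k hk0 le_rfl]; simp [hmem, hx]
  · intro j h1 h2
    rw [hit j h1 h2.le]
    simp [hnot j h1 h2, hx]

theorem submap_numVertices (hspan : ∀ x, ∃ y ∈ T, M.SameVertex x y) :
    (M.submap T hroot hT).numVertices = M.numVertices := by
  refine numCycles_subtypePerm
    (fun x => iff_of_eq (firstReturn_class M.rot (fun x => x ∈ T) x)) (fun x y hx hy => ?_) hspan
  rw [sameCycle_firstReturn_iff]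
  simp [hx, hy]

/-- An orbit of the tour avoiding `T` would be an orbit of `rot`, that is, a vertex not covered by
`T`. -/
theorem exists_mem_sameCycle_tourPerm (hspan : ∀ x, ∃ y ∈ T, M.SameVertex x y) (x : H) :
    ∃ y ∈ T, (M.tourPerm T hT).SameCycle x y := by
  by_contra! hc
  have : ∀ k, (M.tourPerm T hT)^[k] x = M.rot^[k] x := by
    intro k
    induction k with
    | zero => rfl
    | succ k ih =>
      have h1 : (M.tourPerm T hT)^[k] x ∉ T := fun h =>
        hc _ h (sameCycle_iff_exists_iterate.2 ⟨k, rfl⟩)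
      rw [Function.iterate_succ_apply', Function.iterate_succ_apply', ← ih,
        show ∀ y, M.tourPerm T hT y = M.rot (M.edgeOn T hT y) from fun _ => rfl,
        edgeOn_of_notMem hT h1]
  obtain ⟨y, hy, hxy⟩ := hspan x
  obtain ⟨k, rfl⟩ := sameCycle_iff_exists_iterate.1 hxy
  exact hc _ hy (sameCycle_iff_exists_iterate.2 ⟨k, this k⟩)

theorem submap_numFaces (hspan : ∀ x, ∃ y ∈ T, M.SameVertex x y) :
    (M.submap T hroot hT).numFaces = numCycles (M.tourPerm T hT) := by
  have h1 : (M.submap T hroot hT).rot * (M.submap T hroot hT).edge =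
      (firstReturn (M.tourPerm T hT) fun x => x ∈ T).subtypePerm
        (fun x => iff_of_eq (firstReturn_class (M.tourPerm T hT) (fun x => x ∈ T) x)) := by
    ext ⟨x, hx⟩
    exact (firstReturn_tourPerm hT hx).symm
  rw [numFaces, h1]
  refine numCycles_subtypePerm _ (fun x y hx hy => ?_) (exists_mem_sameCycle_tourPerm hT hspan)
  rw [sameCycle_firstReturn_iff]
  simp [hx, hy]

theorem submap_numEdges (h2 : ∀ x, M.edge (M.edge x) = x) (h3 : ∀ x, M.edge x = x ↔ x = M.root)
    {pos : H → ℕ} (hpos : Function.Injective pos) :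
    (M.submap T hroot hT).numEdges = Nat.card {x // pos x < pos (M.edgeOn T hT x)} := by
  have := card_cycles_ne_eq_card_openers (γ := (M.submap T hroot hT).edge)
    (fun x => Subtype.ext (h2 x.1)) (r := ⟨M.root, hroot⟩)
    (fun x => by rw [Subtype.ext_iff, Subtype.ext_iff]; exact h3 x.1) (pos := fun x => pos x.1)
    (hpos.comp Subtype.val_injective)
  refine this.trans (Nat.card_congr ⟨fun x => ⟨x.1.1, ?_⟩, fun x => ⟨⟨x.1, ?_⟩, ?_⟩, ?_, ?_⟩)
  · rw [edgeOn_of_mem hT x.1.2]; exact x.2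
  · by_contra h
    have := x.2
    rw [edgeOn_of_notMem hT h] at this
    exact lt_irrefl _ this
  · have hx : x.1 ∈ T := by
      by_contra h
      have := x.2
      rw [edgeOn_of_notMem hT h] at this
      exact lt_irrefl _ this
    have := x.2
    rw [edgeOn_of_mem hT hx] at this
    exact this
  · intro x; rfl
  · intro x; rfl

theorem numEdges_eq_add (h2 : ∀ x, M.edge (M.edge x) = x) (h3 : ∀ x, M.edge x = x ↔ x = M.root)
    {pos : H → ℕ} (hpos : Function.Injective pos) :
    M.numEdges = Nat.card {x // pos x < pos (M.edgeOn T hT x)} +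
      Nat.card {x // pos x < pos (M.edgeOn Tᶜ (compl_edge_mem hT) x)} := by
  classical
  rw [numEdges, card_cycles_ne_eq_card_openers h2 h3 hpos, ← Nat.card_sum]
  refine Nat.card_congr ((Equiv.subtypeEquivRight fun x => ?_).trans (subtypeOrEquiv _ _ ?_))
  · by_cases hx : x ∈ T
    · rw [edgeOn_of_mem hT hx, edgeOn_of_notMem (compl_edge_mem hT) (by simpa using hx)]
      simp
    · rw [edgeOn_of_notMem hT hx, edgeOn_of_mem (compl_edge_mem hT) hx]
      simp
  · rw [Pi.disjoint_iff]
    intro x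
    rw [Prop.disjoint_iff]
    by_cases hx : x ∈ T
    · rw [edgeOn_of_notMem (compl_edge_mem hT) (by simpa using hx)]
      simp
    · rw [edgeOn_of_notMem hT hx]
      simp

end Submap

/-- The combinatorial content of the tour of a spanning tree `T` with `N + 1` half-edges: it meets
the half-edge `x` at time `pos x`, and neither the edges in `T` nor the other ones cross. -/
structure IsTreeTour (M : MapData H) (T : Set H) (N : ℕ) (pos : H → ℕ) : Prop where
  edge_edge : ∀ x, M.edge (M.edge x) = x
  edge_eq_self_iff : ∀ x, M.edge x = x ↔ x = M.root
  root_mem : M.root ∈ T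
  edge_mem : ∀ x, M.edge x ∈ T ↔ x ∈ T
  pos_le : ∀ x, pos x ≤ N
  pos_tour : ∀ k ≤ N, pos (M.tour T k) = k
  tour_pos : ∀ x, M.tour T (pos x) = x
  tour_period : M.tour T (N + 1) = M.root
  between_rot : ∀ x ∈ T, pos x < pos (M.edge x) → ∀ y,
    (pos x < pos (M.rot y) ∧ pos (M.rot y) ≤ pos (M.edge x)) ↔
      (pos x < pos y ∧ pos y ≤ pos (M.edge x))
  between_edge : ∀ x, pos x < pos (M.edge x) → ∀ y, (y ∈ T ↔ x ∈ T) → y ≠ x → y ≠ M.edge x →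
    ((pos x < pos (M.edge y) ∧ pos (M.edge y) ≤ pos (M.edge x)) ↔
      (pos x < pos y ∧ pos y ≤ pos (M.edge x)))

/-- Both counts are extremal for a cyclic permutation times an involution. Thus every edge in `T` is
cut by a function constant on the vertices, and every other edge by a function constant on the
faces. -/
theorem exists_isTreeTour_of_numVertices_of_numFaces [Finite H] (h2 : ∀ x, M.edge (M.edge x) = x)
    (h3 : ∀ x, M.edge x = x ↔ x = M.root) (hroot : M.root ∈ T) (hT : ∀ x, M.edge x ∈ T ↔ x ∈ T)
    (hτ : ∀ x y, (M.tourPerm T hT).SameCycle x y)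
    (hV : ∀ pos : H → ℕ, Function.Injective pos →
      M.numVertices = Nat.card {x // pos x < pos (M.edgeOn T hT x)} + 1)
    (hF : ∀ pos : H → ℕ, Function.Injective pos →
      M.numFaces = Nat.card {x // pos x < pos (M.edgeOn Tᶜ (compl_edge_mem hT) x)} + 1) :
    ∃ pos, M.IsTreeTour T (Nat.card H - 1) pos := by
  have : Nonempty H := ⟨M.root⟩
  have hcard : 0 < Nat.card H := Nat.card_pos
  obtain ⟨pos, p1, p2, p3, p4⟩ := exists_position hτ M.root
  have hpos : Function.Injective pos := fun x y h => by rw [← p3 x, h, p3]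
  have p1' : ∀ x, pos x ≤ Nat.card H - 1 := fun x => by have := p1 x; omega
  have p2' : ∀ k ≤ Nat.card H - 1, pos ((M.tourPerm T hT)^[k] M.root) = k :=
    fun k hk => p2 k (by omega)
  have c1 : numCycles (M.tourPerm T hT * M.edgeOn T hT) =
      Nat.card {x // pos x < pos (M.edgeOn T hT x)} + 1 := by
    rw [tourPerm_mul_edgeOn hT h2]
    exact hV pos hpos
  have c2 : numCycles (M.tourPerm T hT * M.edgeOn Tᶜ (compl_edge_mem hT)) =
      Nat.card {x // pos x < pos (M.edgeOn Tᶜ (compl_edge_mem hT) x)} + 1 := by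
    rw [tourPerm_mul_edgeOn_compl hT]
    exact hF pos hpos
  rw [numCycles_eq_iff_exists_isEdgeCut hτ (edgeOn_edgeOn hT h2) hpos M.root] at c1
  rw [numCycles_eq_iff_exists_isEdgeCut hτ (edgeOn_edgeOn _ h2) hpos M.root] at c2
  refine ⟨pos, h2, h3, hroot, hT, p1', ?_, ?_, ?_, ?_, ?_⟩
  · intro k hk
    rw [tour_eq_iterate hT]
    exact p2' k hk
  · intro x
    rw [tour_eq_iterate hT]
    exact p3 x
  · rw [tour_eq_iterate hT, Nat.sub_add_cancel hcard]
    exact p4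
  · intro x hx hxx y
    have hxx' : pos x < pos (M.edgeOn T hT x) := by rwa [edgeOn_of_mem hT hx]
    obtain ⟨v, hv⟩ := c1 x hxx'
    have := hv.between_iff (edgeOn_edgeOn hT h2) p2' p3 p1' hxx' (y := M.rot y) (z := y) (by
      rw [← hv.invariant y, ← Equiv.Perm.mul_apply, tourPerm_mul_edgeOn hT h2])
    rwa [edgeOn_of_mem hT hx] at this
  · intro x hxx y hy hyx hyx'
    by_cases hx : x ∈ T
    · have hxx' : pos x < pos (M.edgeOn T hT x) := by rwa [edgeOn_of_mem hT hx]
      obtain ⟨v, hv⟩ := c1 x hxx'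
      have := hv.between_iff (edgeOn_edgeOn hT h2) p2' p3 p1' hxx' (y := M.edge y) (z := y) (by
        have := hv.eq y hyx (by rwa [edgeOn_of_mem hT hx])
        rwa [edgeOn_of_mem hT (hy.2 hx)] at this)
      rwa [edgeOn_of_mem hT hx] at this
    · have hx' := edgeOn_of_mem (compl_edge_mem hT) (x := x) hx
      have hxx' : pos x < pos (M.edgeOn Tᶜ (compl_edge_mem hT) x) := by rwa [hx']
      obtain ⟨v, hv⟩ := c2 x hxx'
      have := hv.between_iff (edgeOn_edgeOn _ h2) p2' p3 p1' hxx' (y := M.edge y) (z := y) (by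
        have := hv.eq y hyx (by rwa [hx'])
        rwa [edgeOn_of_mem (compl_edge_mem hT) (mt hy.1 hx)] at this)
      rwa [hx'] at this

/-- Euler's formula for the tree makes the vertices one more than the edges in `T`; subtracted from
Euler's formula for `M`, it makes the faces one more than the remaining edges. -/
theorem IsSpanningTree.exists_isTreeTour [Finite H] (hM : M.IsRootedMap)
    (hS : M.IsSpanningTree T) : ∃ pos, M.IsTreeTour T (Nat.card H - 1) pos := by
  obtain ⟨⟨hroot, hT, ⟨-, -, -, he⟩, hF⟩, hspan⟩ := hS
  have : Nonempty H := ⟨M.root⟩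
  have h2 := hM.edge_edge
  have h3 := hM.edge_eq_self_iff
  have hV := submap_numVertices hT hroot hspan
  have hM' := hM.euler
  refine exists_isTreeTour_of_numVertices_of_numFaces h2 h3 hroot hT ?_ ?_ ?_
  · rw [← numCycles_eq_one_iff, ← submap_numFaces hT hroot hspan, hF]
  · intro pos hpos
    have hE := submap_numEdges hT hroot h2 h3 hpos
    omega
  · intro pos hpos
    have hE := submap_numEdges hT hroot h2 h3 hpos
    have hE' := numEdges_eq_add hT h2 h3 hpos
    omega

/-- A plane tree is its own spanning tree: no edge lies outside, which matches its single face. -/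
theorem IsPlaneTree.exists_isTreeTour [Finite H] (hM : M.IsPlaneTree) :
    ∃ pos, M.IsTreeTour Set.univ (Nat.card H - 1) pos := by
  obtain ⟨⟨h2, h3, -, he⟩, hF⟩ := hM
  have : Nonempty H := ⟨M.root⟩
  have hT : ∀ x, M.edge x ∈ Set.univ ↔ x ∈ Set.univ := by simp
  have h0 : ∀ pos : H → ℕ,
      Nat.card {x // pos x < pos (M.edgeOn Set.univᶜ (compl_edge_mem hT) x)} = 0 := by
    intro pos
    have : IsEmpty {x // pos x < pos (M.edgeOn Set.univᶜ (compl_edge_mem hT) x)} :=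
      ⟨fun x => by
        have := x.2
        rw [edgeOn_of_notMem _ (by simp)] at this
        exact lt_irrefl _ this⟩
    exact Nat.card_of_isEmpty
  refine exists_isTreeTour_of_numVertices_of_numFaces h2 h3 trivial hT ?_ ?_ ?_
  · rw [← numCycles_eq_one_iff]
    have : M.tourPerm Set.univ hT = M.rot * M.edge := by
      ext x
      rw [tourPerm, Equiv.Perm.mul_apply, edgeOn_of_mem hT trivial]
      rfl
    rw [this]
    exact hF
  · intro pos hpos
    have hE' := numEdges_eq_add hT h2 h3 hpos
    rw [h0] at hE'
    omega
  · intro pos hpos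
    rw [h0, hF]

end MapData

/-! ### Vertex explosion, and the orientation read from the tour -/

namespace MapData

variable {H : Type*} {M : MapData H}

section Explosion

variable {O : Set H}

theorem sameVertex_iterate [Finite H] (x : H) (k : ℕ) : M.SameVertex x (M.rot^[k] x) :=
  sameCycle_iff_exists_iterate.2 ⟨k, rfl⟩

theorem firstHead_of_mem {x : H} (hx : x ∈ O) : M.firstHead O x = x := by
  classical
  have h : ∃ k : ℕ, M.rot^[k] x ∈ O := ⟨0, hx⟩
  rw [firstHead, dif_pos h, (Nat.find_eq_zero h).2 hx]
  rfl

theorem firstHead_mem (hO : ∀ x, ∃ k : ℕ, M.rot^[k] x ∈ O) (x : H) : M.firstHead O x ∈ O := by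
  classical
  rw [firstHead, dif_pos (hO x)]
  exact Nat.find_spec (hO x)

theorem firstHead_rot (hO : ∀ x, ∃ k : ℕ, M.rot^[k] x ∈ O) {x : H} (hx : x ∉ O) :
    M.firstHead O (M.rot x) = M.firstHead O x := by
  classical
  rw [firstHead, dif_pos (hO _), firstHead, dif_pos (hO x)]
  have : Nat.find (hO x) = Nat.find (hO (M.rot x)) + 1 :=
    Nat.find_comp_succ _ _ hx
  rw [this, Function.iterate_succ_apply]

theorem firstHead_iterate (hO : ∀ x, ∃ k : ℕ, M.rot^[k] x ∈ O) {x : H} {m : ℕ}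
    (hm : ∀ j < m, M.rot^[j] x ∉ O) : M.firstHead O (M.rot^[m] x) = M.firstHead O x := by
  induction m with
  | zero => rfl
  | succ m ih =>
    rw [Function.iterate_succ_apply', firstHead_rot hO (hm m (by omega)),
      ih fun j hj => hm j (by omega)]

theorem sameVertex_firstHead [Finite H] (x : H) : M.SameVertex x (M.firstHead O x) := by
  classical
  rw [firstHead]
  split_ifs
  · exact sameVertex_iterate _ _
  · exact .refl _ _

variable [Finite H]

theorem explosion_sameVertex_iff {x y : H} :
    (M.explosion O).SameVertex x y ↔ M.firstHead O x = M.firstHead O y := by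
  rw [SameVertex, explosion, sameCycle_firstReturn_iff, and_iff_right_iff_imp]
  intro h
  have h1 := sameVertex_firstHead (M := M) (O := O) x
  rw [h] at h1
  exact h1.trans (sameVertex_firstHead y).symm

theorem explosion_rot_of_notMem (hO : ∀ x, ∃ k : ℕ, M.rot^[k] x ∈ O) {x : H} (hx : x ∉ O) :
    (M.explosion O).rot x = M.rot x :=
  firstReturn_eq_of_apply _ _ (firstHead_rot hO hx)

theorem firstHead_explosion_rot (x : H) :
    M.firstHead O ((M.explosion O).rot x) = M.firstHead O x :=
  firstReturn_class M.rot (M.firstHead O) x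

/-- The half-edges after `g` up to the next head form one exploded vertex, closed up by sending that
head back to `M.rot g`. The predecessor of `M.rot g` must be a head: a tail keeps its successor
under `M.rot`, so it would be `g` itself. -/
theorem explosion_rot_of_mem (hO : ∀ x, ∃ k : ℕ, M.rot^[k] x ∈ O) {g : H} (hg : g ∈ O) :
    (M.explosion O).rot (M.firstHead O (M.rot g)) = M.rot g := by
  set z := (M.explosion O).rot.symm (M.rot g) with hz
  have hzg : (M.explosion O).rot z = M.rot g := by simp [hz]
  have hzO : z ∈ O := by
    by_contra hzO
    rw [explosion_rot_of_notMem hO hzO] at hzg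
    exact hzO (M.rot.injective hzg ▸ hg)
  have := firstHead_explosion_rot (M := M) (O := O) z
  rw [hzg, firstHead_of_mem hzO] at this
  rw [this, hzg]

/-- The half-edge `s` follows a head, and no head is met from `s` to `z`, which is excluded. -/
def IsIntervalStart (M : MapData H) (O : Set H) (s z : H) : Prop :=
  ∃ g ∈ O, s = M.rot g ∧ ∃ m, z = M.rot^[m] s ∧ ∀ j < m, M.rot^[j] s ∉ O

omit [Finite H] in
theorem isIntervalStart_rot {g : H} (hg : g ∈ O) : M.IsIntervalStart O (M.rot g) (M.rot g) :=
  ⟨g, hg, rfl, 0, rfl, by simp⟩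

omit [Finite H] in
theorem IsIntervalStart.rot {s z : H} (h : M.IsIntervalStart O s z) (hz : z ∉ O) :
    M.IsIntervalStart O s (M.rot z) := by
  obtain ⟨g, hg, hs, m, rfl, hm⟩ := h
  refine ⟨g, hg, hs, m + 1, by rw [Function.iterate_succ_apply'], fun j hj => ?_⟩
  rcases Nat.lt_succ_iff_lt_or_eq.1 hj with h | rfl
  · exact hm j h
  · exact hz

theorem IsIntervalStart.sameVertex {s z : H} (h : M.IsIntervalStart O s z) :
    M.SameVertex s z := by
  obtain ⟨g, hg, hs, m, rfl, hm⟩ := h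
  exact sameVertex_iterate _ _

theorem IsIntervalStart.explosion_rot (hO : ∀ x, ∃ k : ℕ, M.rot^[k] x ∈ O) {s z : H}
    (h : M.IsIntervalStart O s z) (hz : z ∈ O) : (M.explosion O).rot z = s := by
  obtain ⟨g, hg, rfl, m, rfl, hm⟩ := h
  rw [← firstHead_of_mem hz, firstHead_iterate hO hm, explosion_rot_of_mem hO hg]

end Explosion

namespace IsTreeTour

variable {T : Set H} {N : ℕ} {pos : H → ℕ} (h : M.IsTreeTour T N pos)

include h

theorem pos_injective : Function.Injective pos := fun x y hxy => by
  rw [← h.tour_pos x, hxy, h.tour_pos]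

theorem pos_root : pos M.root = 0 := h.pos_tour 0 (Nat.zero_le _)

theorem pos_pos {x : H} (hx : x ≠ M.root) : 0 < pos x := by
  rw [Nat.pos_iff_ne_zero, ← h.pos_root]
  exact h.pos_injective.ne hx

theorem pos_edge_ne {x : H} (hx : x ≠ M.root) : pos (M.edge x) ≠ pos x :=
  h.pos_injective.ne (mt (h.edge_eq_self_iff x).1 hx)

theorem edge_root : M.edge M.root = M.root := (h.edge_eq_self_iff _).2 rfl

theorem edge_ne_root {x : H} (hx : x ≠ M.root) : M.edge x ≠ M.root := fun hh =>
  hx (by rw [← h.edge_edge x, hh, h.edge_root])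

theorem rot_of_notMem {x : H} (hx : x ∉ T) : M.rot x = M.tour T (pos x + 1) := by
  rw [tour, Function.iterate_succ_apply', ← tour, h.tour_pos, tourStep, if_neg hx]

theorem rot_edge_of_mem {x : H} (hx : x ∈ T) : M.rot (M.edge x) = M.tour T (pos x + 1) := by
  rw [tour, Function.iterate_succ_apply', ← tour, h.tour_pos, tourStep, if_pos hx]

theorem rot_of_mem {x : H} (hx : x ∈ T) : M.rot x = M.tour T (pos (M.edge x) + 1) := by
  rw [← h.rot_edge_of_mem ((h.edge_mem x).2 hx), h.edge_edge]

theorem between_sameVertex [Finite H] {x : H} (hx : x ∈ T) (hxx : pos x < pos (M.edge x)) {y z : H}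
    (hyz : M.SameVertex y z) : (pos x < pos y ∧ pos y ≤ pos (M.edge x)) ↔
      (pos x < pos z ∧ pos z ≤ pos (M.edge x)) := by
  obtain ⟨k, rfl⟩ := sameCycle_iff_exists_iterate.1 hyz
  clear hyz
  induction k with
  | zero => rfl
  | succ k ih => rw [ih, Function.iterate_succ_apply', h.between_rot x hx hxx]

theorem precedes_edge_iff {x : H} :
    M.Precedes T x (M.edge x) ↔ pos x < pos (M.edge x) := by
  constructor
  · rintro ⟨k, rfl, hk⟩
    by_contra hlt
    have h1 := hk (pos (M.edge (M.tour T k)))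
    rw [h.tour_pos] at h1
    have h2 : k < pos (M.edge (M.tour T k)) := by
      by_contra hh; exact h1 (by omega) rfl
    have h3 := h.pos_le (M.edge (M.tour T k))
    rw [h.pos_tour k (by omega)] at hlt
    omega
  · intro hlt
    refine ⟨pos x, h.tour_pos x, fun j hj hh => ?_⟩
    have := h.pos_le x
    rw [← hh, h.pos_tour j (by omega)] at hlt
    omega

/-- If the mate of `x` comes first, the interval of times between them is closed under `rot` and
under the other edges of `T`; it contains `x` but not the root. Otherwise the tour up to `x` is
itself a path that does not use the edge of `x`. -/
theorem joined_iff {x : H} (hx : x ∈ T) (hxr : x ≠ M.root) :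
    M.Joined (T \ {x, M.edge x}) M.root x ↔ pos x < pos (M.edge x) := by
  constructor
  · intro hj
    by_contra hlt
    have hlt' : pos (M.edge x) < pos (M.edge (M.edge x)) := by
      rw [h.edge_edge]; have := h.pos_edge_ne hxr; omega
    have key : ∀ y z, M.Joined (T \ {x, M.edge x}) y z →
        ((pos (M.edge x) < pos y ∧ pos y ≤ pos x) ↔ (pos (M.edge x) < pos z ∧ pos z ≤ pos x)) := by
      intro y z hyz
      induction hyz with
      | rel y z hyz =>
        rcases hyz with rfl | ⟨⟨hy, hy'⟩, rfl⟩
        · have := h.between_rot _ ((h.edge_mem x).2 hx) hlt' y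
          rw [h.edge_edge] at this
          exact this.symm
        · have := h.between_edge _ hlt' y (by simp [hy, h.edge_mem, hx])
            (fun hh => hy' (by simp [hh])) (fun hh => hy' (by simp [hh, h.edge_edge]))
          rw [h.edge_edge] at this
          exact this.symm
      | refl => rfl
      | symm _ _ _ ih => exact ih.symm
      | trans _ _ _ _ _ ih1 ih2 => exact ih1.trans ih2
    have := (key _ _ hj).2 ⟨by rw [h.edge_edge] at hlt'; exact hlt', le_rfl⟩
    rw [h.pos_root] at this
    omega
  · intro hlt
    have hle := h.pos_le x
    have key : ∀ k ≤ pos x, M.Joined (T \ {x, M.edge x}) M.root (M.tour T k) := by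
      intro k
      induction k with
      | zero => intro _; exact .refl _
      | succ k ih =>
        intro hk
        refine (ih (by omega)).trans _ _ _ ?_
        have hp := h.pos_tour k (by omega)
        set y := M.tour T k with hy
        have hs : M.tour T (k + 1) = M.tour T (pos y + 1) := by rw [hp]
        by_cases hyT : y ∈ T
        · rw [hs, ← h.rot_edge_of_mem hyT]
          refine .trans _ (M.edge y) _ (.rel _ _ (.inr ⟨⟨hyT, ?_⟩, rfl⟩)) (.rel _ _ (.inl rfl))
          rintro (hh | hh)
          · rw [hh] at hp; omega
          · rw [hh] at hp; omega
        · rw [hs, ← h.rot_of_notMem hyT]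
          exact .rel _ _ (.inl rfl)
    have := key _ le_rfl
    rwa [h.tour_pos] at this

theorem mem_treeHeads_iff {x : H} : x ∈ M.treeHeads T ↔
    x = M.root ∨ (x ∈ T ∧ pos (M.edge x) < pos x) ∨ (x ∉ T ∧ pos x < pos (M.edge x)) := by
  rw [treeHeads, Set.mem_ofPred_eq, h.precedes_edge_iff]
  by_cases hx : x = M.root
  · simp [hx]
  · have := h.pos_edge_ne hx
    refine or_congr_right (or_congr_left (and_congr_right fun hxT => ?_))
    rw [h.joined_iff hxT hx]
    omega

omit h in
theorem _root_.MapData.root_mem_treeHeads : M.root ∈ M.treeHeads T := .inl rfl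

theorem edge_mem_treeHeads_iff {x : H} (hx : x ≠ M.root) :
    M.edge x ∈ M.treeHeads T ↔ x ∉ M.treeHeads T := by
  rw [h.mem_treeHeads_iff, h.mem_treeHeads_iff, h.edge_edge, h.edge_mem]
  have := h.pos_edge_ne hx
  have := h.edge_ne_root hx
  by_cases hT : x ∈ T <;> simp [*] <;> omega

/-- Turning past a tail always advances the tour, at least to the next time, so turning must meet a
head, at the latest the root, which is met again at time `N + 1`. -/
theorem exists_iterate_mem_treeHeads (x : H) : ∃ k : ℕ, M.rot^[k] x ∈ M.treeHeads T := by
  induction hd : N - pos x using Nat.strong_induction_on generalizing x with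
  | _ d ih =>
    by_cases hx : x ∈ M.treeHeads T
    · exact ⟨0, hx⟩
    suffices ∃ j, pos x ≤ j ∧ j ≤ N ∧ M.rot x = M.tour T (j + 1) by
      obtain ⟨j, hj, hjN, hr⟩ := this
      rcases Nat.eq_or_lt_of_le hjN with rfl | hjN
      · exact ⟨1, by rw [Function.iterate_one, hr, h.tour_period]; exact root_mem_treeHeads⟩
      · have hp := h.pos_tour (j + 1) hjN
        obtain ⟨k, hk⟩ := ih (N - pos (M.rot x)) (by rw [hr, hp]; omega) (M.rot x) rfl
        exact ⟨k + 1, hk⟩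
    rw [h.mem_treeHeads_iff] at hx
    push Not at hx
    have := h.pos_edge_ne hx.1
    by_cases hT : x ∈ T
    · exact ⟨_, by have := hx.2.1 hT; omega, h.pos_le _, h.rot_of_mem hT⟩
    · exact ⟨_, le_rfl, h.pos_le _, h.rot_of_notMem hT⟩

end IsTreeTour

end MapData

/-! ### Non-crossing words and walks -/

section Lists

variable {α : Type*}

/-- A word without equal neighbours can use only one of two adjacent copies. -/
theorem List.Sublist.of_duplicate {v : α} {l₂ s : List α} (hs : s.IsChain (· ≠ ·)) {l₁ : List α}
    (h : s.Sublist (l₁ ++ v :: v :: l₂)) : s.Sublist (l₁ ++ v :: l₂) := by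
  induction l₁ generalizing s with
  | nil =>
    rcases List.sublist_cons_iff.1 h with h₁ | ⟨s', rfl, h₁⟩
    · exact h₁
    · rcases List.sublist_cons_iff.1 h₁ with h₂ | ⟨s'', rfl, h₂⟩
      · exact h₂.cons_cons v
      · exact absurd rfl (List.isChain_cons_cons.1 hs).1
  | cons a l₁ ih =>
    rcases List.sublist_cons_iff.1 h with h₁ | ⟨s', rfl, h₁⟩
    · exact (ih hs h₁).cons a
    · exact (ih hs.tail h₁).cons_cons a

theorem List.Sublist.of_notMem {v : α} {l₁ l₂ s : List α} (hv : v ∉ s)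
    (h : s.Sublist (l₁ ++ v :: l₂)) : s.Sublist (l₁ ++ l₂) := by
  induction l₁ generalizing s with
  | nil =>
    rcases List.sublist_cons_iff.1 h with h₁ | ⟨s', rfl, h₁⟩
    · exact h₁
    · simp at hv
  | cons a l₁ ih =>
    rcases List.sublist_cons_iff.1 h with h₁ | ⟨s', rfl, h₁⟩
    · exact (ih hv h₁).cons a
    · exact (ih (fun hh => hv (List.mem_cons_of_mem _ hh)) h₁).cons_cons a

/-- The labels in the list define a non-crossing partition. -/
def IsNonCrossingList (l : List α) : Prop := ∀ x y, [x, y, x, y].Sublist l → x = y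

theorem IsNonCrossingList.duplicate {v : α} {l₁ l₂ : List α}
    (h : IsNonCrossingList (l₁ ++ v :: l₂)) : IsNonCrossingList (l₁ ++ v :: v :: l₂) := by
  intro x y hs
  by_contra hne
  exact hne (h x y (hs.of_duplicate (by simp [hne, Ne.symm hne])))

/-- Both letters of a crossing `x y x y` occur twice, whereas the fresh letter occurs once. -/
theorem IsNonCrossingList.insert_of_notMem {v : α} {l₁ l₂ : List α} (h₁ : v ∉ l₁) (h₂ : v ∉ l₂)
    (h : IsNonCrossingList (l₁ ++ l₂)) : IsNonCrossingList (l₁ ++ v :: l₂) := by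
  classical
  intro x y hs
  by_contra hne
  have hc : (l₁ ++ v :: l₂).count v = 1 := by
    simp [List.count_append, List.count_eq_zero_of_not_mem h₁, List.count_eq_zero_of_not_mem h₂]
  have hcv := hs.count_le v
  rw [hc] at hcv
  refine hne (h x y (hs.of_notMem ?_))
  intro hv
  simp only [List.mem_cons, List.not_mem_nil, or_false] at hv
  have : v = x ∨ v = y := by tauto
  rcases this with rfl | rfl
  · simp [Ne.symm hne] at hcv
  · simp [hne] at hcv

/-- The list `F` enumerates the iterates of `r` from `s` to `z` (excluded). -/
def IsWalk (r : α → α) : α → List α → α → Prop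
  | s, [], z => s = z
  | s, x :: F, z => s = x ∧ IsWalk r (r x) F z

theorem isWalk_append {r : α → α} {s z : α} {F G : List α} :
    IsWalk r s (F ++ G) z ↔ ∃ m, IsWalk r s F m ∧ IsWalk r m G z := by
  induction F generalizing s with
  | nil => simp [IsWalk]
  | cons x F ih => simp [IsWalk, ih, and_assoc]

theorem IsWalk.getElem_eq {r : α → α} {s z : α} {F : List α} (h : IsWalk r s F z) (i : ℕ)
    (hi : i < F.length) : F[i] = r^[i] s := by
  induction F generalizing s i with
  | nil => simp at hi
  | cons x F ih =>
    obtain ⟨rfl, h⟩ := h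
    cases i with
    | zero => rfl
    | succ i => simpa using ih h i (by simpa using hi)

end Lists

/-! ### Building the contour of the exploded map along the tour -/

namespace MapData

variable {H : Type*} {M : MapData H}

/-- The part of the tour of the exploded map that is before the current position: `A` is the stack
of the vertices of `T` that have not been left, each with its entrance and a list of half-edges. -/
def leftTour : List (H × List H) → List H
  | [] => []
  | (a, F) :: A => leftTour A ++ a :: F

/-- The part of the tour of the exploded map that is after the current position. -/
def rightTour : List (List H × H) → List H
  | [] => []
  | (G, b) :: B => G ++ b :: rightTour B

open Classical in
/-- The heads reached from the half-edges in a list, in order. -/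
noncomputable def reached (M : MapData H) (O : Set H) (l : List H) : List H :=
  (l.map M.edge).filter (· ∈ O)

/-- The heads of the vertices that are discovered after the current position. -/
noncomputable def rightHeads (M : MapData H) (O : Set H) : List (List H × H) → List H
  | [] => []
  | (G, b) :: B => b :: M.reached O G ++ rightHeads M O B

/-- The heads of the vertices, in the order of their discovery. -/
noncomputable def discovered (M : MapData H) (O : Set H) (A : List (H × List H))
    (B : List (List H × H)) : List H :=
  M.reached O (leftTour A) ++ M.rightHeads O B

theorem reached_append (O : Set H) (l l' : List H) :
    M.reached O (l ++ l') = M.reached O l ++ M.reached O l' := by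
  simp [reached]

theorem reached_nil (O : Set H) : M.reached O [] = [] := rfl

theorem reached_cons_of_mem {O : Set H} {x : H} (hx : M.edge x ∈ O) (l : List H) :
    M.reached O (x :: l) = M.edge x :: M.reached O l := by
  simp [reached, hx]

theorem reached_cons_of_notMem {O : Set H} {x : H} (hx : M.edge x ∉ O) (l : List H) :
    M.reached O (x :: l) = M.reached O l := by
  simp [reached, hx]

/-- The construction of the tour of the exploded map along the tour of `T`. -/
inductive Run (M : MapData H) (T : Set H) (N : ℕ) :
    ℕ → List (H × List H) → List (List H × H) → Prop
  | init : Run M T N 0 [(M.root, [])] []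
  | down {k a F A B p} : Run M T N k ((a, F) :: A) B → k < N → M.tour T (k + 1) = p → p ∈ T →
      p ∉ M.treeHeads T → Run M T N (k + 1) ((p, []) :: (a, F) :: A) B
  | up {k a F a' F' A B p} : Run M T N k ((a, F) :: (a', F') :: A) B → k < N →
      M.tour T (k + 1) = p → p ∈ T → p ∈ M.treeHeads T → M.edge p = a →
      Run M T N (k + 1) ((a', F' ++ a :: F ++ [p]) :: A) B
  | push {k a F A B p} : Run M T N k ((a, F) :: A) B → k < N → M.tour T (k + 1) = p → p ∉ T →
      p ∈ M.treeHeads T → Run M T N (k + 1) ((a, []) :: A) ((F, p) :: B)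
  | pop {k a F A G b B p} : Run M T N k ((a, F) :: A) ((G, b) :: B) → k < N →
      M.tour T (k + 1) = p → p ∉ T → p ∉ M.treeHeads T → M.edge p = b →
      Run M T N (k + 1) ((a, F ++ p :: G ++ [b]) :: A) B

/-- At time `k` of the tour, the edge of `x` in `T` has been met once (the root counts). -/
def IsOpenIn (M : MapData H) (T : Set H) (pos : H → ℕ) (k : ℕ) (x : H) : Prop :=
  x ∈ T ∧ pos x ≤ k ∧ (x = M.root ∨ k < pos (M.edge x))

/-- At time `k` of the tour, the edge of `x` not in `T` has been met once. -/
def IsOpenOut (M : MapData H) (T : Set H) (pos : H → ℕ) (k : ℕ) (x : H) : Prop :=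
  x ∉ T ∧ pos x ≤ k ∧ k < pos (M.edge x)

/-- Every entry of the stack is a part of the tour of the exploded map. -/
def StackWalk [Finite H] (M : MapData H) (O : Set H) : List (H × List H) → H → Prop
  | [], z => z = M.root
  | (a, F) :: A, z => StackWalk M O A a ∧ ∃ s, M.IsIntervalStart O s z ∧
      M.SameVertex (M.edge a) s ∧ IsWalk (fun x => (M.explosion O).rot (M.edge x)) s F z

namespace IsTreeTour

variable {T : Set H} {N : ℕ} {pos : H → ℕ} (h : M.IsTreeTour T N pos)

include h

theorem pos_eq_iff {k : ℕ} (hk : k ≤ N) {x : H} : pos x = k ↔ x = M.tour T k := by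
  constructor
  · rintro rfl; exact (h.tour_pos x).symm
  · rintro rfl; exact h.pos_tour k hk

theorem isOpenIn_succ {k : ℕ} (hk : k < N) {p : H} (hp : M.tour T (k + 1) = p) {x : H} :
    M.IsOpenIn T pos (k + 1) x ↔
      (M.IsOpenIn T pos k x ∧ M.edge x ≠ p) ∨ (x = p ∧ p ∈ T ∧ p ∉ M.treeHeads T) := by
  have e1 := h.pos_eq_iff hk (x := x)
  have e2 := h.pos_eq_iff hk (x := M.edge x)
  rw [hp] at e1 e2
  have e3 := h.mem_treeHeads_iff (x := p)
  have e4 : p ≠ M.root := by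
    rintro rfl
    have := h.pos_tour (k + 1) hk
    rw [hp, h.pos_root] at this; omega
  have e5 := h.edge_root
  have e6 := h.pos_root
  have e7 := h.pos_edge_ne (x := x)
  unfold IsOpenIn
  grind

theorem isOpenOut_succ {k : ℕ} (hk : k < N) {p : H} (hp : M.tour T (k + 1) = p) {x : H} :
    M.IsOpenOut T pos (k + 1) x ↔
      (M.IsOpenOut T pos k x ∧ M.edge x ≠ p) ∨ (x = p ∧ p ∉ T ∧ p ∈ M.treeHeads T) := by
  have e1 := h.pos_eq_iff hk (x := x)
  have e2 := h.pos_eq_iff hk (x := M.edge x)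
  rw [hp] at e1 e2
  have e3 := h.mem_treeHeads_iff (x := p)
  have e4 : p ≠ M.root := by
    rintro rfl
    have := h.pos_tour (k + 1) hk
    rw [hp, h.pos_root] at this; omega
  have e7 := h.pos_edge_ne (x := x)
  have e8 := h.root_mem
  unfold IsOpenOut
  grind

/-- Every constructor of `Run` inserts `p` at the cursor between `leftTour` and `rightTour`. For
edges in `T` the cursor then sits just after `p`; `push` moves it back to just after the entrance
`a`, and `pop` moves it forward past the matching head `b`. -/
theorem run_tour {k : ℕ} {A B} (hr : M.Run T N k A B) : k ≤ N ∧
    (leftTour A ++ rightTour B).Nodup ∧ ∀ x, x ∈ leftTour A ++ rightTour B ↔ pos x ≤ k := by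
  have step : ∀ {k : ℕ} {X Y : List H} {p : H}, k < N → M.tour T (k + 1) = p →
      ((X ++ Y).Nodup ∧ ∀ x, x ∈ X ++ Y ↔ pos x ≤ k) →
      ((X ++ p :: Y).Nodup ∧ ∀ x, x ∈ X ++ p :: Y ↔ pos x ≤ k + 1) := by
    intro k X Y p hk hp ⟨h1, h2⟩
    have hpos := h.pos_tour (k + 1) hk
    rw [hp] at hpos
    constructor
    · rw [List.nodup_middle, List.nodup_cons]
      refine ⟨fun hh => ?_, h1⟩
      have := (h2 p).1 hh
      omega
    · intro x
      have e1 := h.pos_eq_iff hk (x := x)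
      rw [hp] at e1
      have := h2 x
      simp only [List.mem_append, List.mem_cons] at this ⊢
      rw [Nat.le_succ_iff, ← this, e1]
      tauto
  induction hr with
  | init =>
    refine ⟨Nat.zero_le _, by simp [leftTour, rightTour], fun x => ?_⟩
    simp only [leftTour, rightTour, List.nil_append, List.append_nil, List.mem_singleton]
    rw [Nat.le_zero, h.pos_eq_iff (Nat.zero_le _)]
    rfl
  | down _ hk hp _ _ ih =>
    refine ⟨hk, ?_⟩
    simpa [leftTour, rightTour] using step hk hp ih.2
  | up _ hk hp _ _ _ ih =>
    refine ⟨hk, ?_⟩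
    simpa [leftTour, rightTour] using step hk hp ih.2
  | push _ hk hp _ _ ih =>
    refine ⟨hk, ?_⟩
    simpa [leftTour, rightTour] using step hk hp ih.2
  | pop _ hk hp _ _ _ ih =>
    refine ⟨hk, ?_⟩
    simpa [leftTour, rightTour] using step hk hp ih.2

/-- This identifies the top of each stack as the most recently opened edge of its kind, which is
what decides whether `up` and `pop` can be applied. -/
theorem run_open {k : ℕ} {A B} (hr : M.Run T N k A B) :
    (∀ x, x ∈ A.map Prod.fst ↔ M.IsOpenIn T pos k x) ∧
    (A.map Prod.fst).Pairwise (fun x y => pos y < pos x) ∧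
    (∀ x, x ∈ B.map Prod.snd ↔ M.IsOpenOut T pos k x) ∧
    (B.map Prod.snd).Pairwise (fun x y => pos y < pos x) := by
  have hpos : ∀ {k p}, k < N → M.tour T (k + 1) = p → pos p = k + 1 := fun hk hp => by
    rw [← hp]; exact h.pos_tour _ hk
  have hee := h.edge_edge
  have hem := h.edge_mem
  induction hr with
  | init =>
    refine ⟨fun x => ?_, by simp, fun x => ?_, by simp⟩
    · have := h.pos_eq_iff (Nat.zero_le _) (x := x)
      simp only [List.map_cons, List.map_nil, List.mem_singleton, IsOpenIn, Nat.le_zero, this]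
      constructor
      · rintro rfl; exact ⟨h.root_mem, rfl, .inl rfl⟩
      · exact fun hh => hh.2.1
    · simp only [List.map_nil, List.not_mem_nil, false_iff]
      rintro ⟨h1, h2, h3⟩
      rw [Nat.le_zero, h.pos_eq_iff (Nat.zero_le _)] at h2
      exact h1 (h2 ▸ h.root_mem)
  | @down k a F A B p hr hk hp hT hO ih =>
    obtain ⟨i1, i2, i3, i4⟩ := ih
    have hpp := hpos hk hp
    refine ⟨fun x => ?_, ?_, fun x => ?_, i4⟩
    · rw [h.isOpenIn_succ hk hp, ← i1 x, List.map_cons, List.mem_cons]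
      have : x ∈ ((a, F) :: A).map Prod.fst → M.edge x ≠ p := by
        rintro hx rfl
        have := (i1 x).1 hx
        rw [h.mem_treeHeads_iff, hee] at hO
        unfold IsOpenIn at this
        grind
      clear * - this hT hO
      tauto
    · rw [List.map_cons, List.pairwise_cons]
      refine ⟨fun x hx => ?_, i2⟩
      have := ((i1 x).1 hx).2.1
      change pos x < pos p
      omega
    · rw [i3, h.isOpenOut_succ hk hp]
      have : M.IsOpenOut T pos k x → M.edge x ≠ p := by
        rintro ⟨h1, -⟩ rfl
        exact h1 ((hem x).1 hT)
      clear * - this hT hO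
      tauto
  | @up k a F a' F' A B p hr hk hp hT hO hpa ih =>
    obtain ⟨i1, i2, i3, i4⟩ := ih
    have hpp := hpos hk hp
    refine ⟨fun x => ?_, ?_, fun x => ?_, i4⟩
    · rw [h.isOpenIn_succ hk hp, ← i1 x]
      simp only [List.map_cons, List.mem_cons, List.pairwise_cons] at i2 ⊢
      have hxe : M.edge x = p ↔ x = a := by
        rw [← hpa]
        constructor
        · rintro rfl; exact (hee x).symm
        · rintro rfl; exact hee p
      rw [ne_eq, hxe]
      have : x = a → ¬ (x = a' ∨ x ∈ A.map Prod.fst) := by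
        rintro rfl hx
        exact lt_irrefl _ (i2.1 x hx)
      clear * - this hT hO
      tauto
    · exact i2.tail
    · rw [i3, h.isOpenOut_succ hk hp]
      have : M.IsOpenOut T pos k x → M.edge x ≠ p := by
        rintro ⟨h1, -⟩ rfl
        exact h1 ((hem x).1 hT)
      clear * - this hT hO
      tauto
  | @push k a F A B p hr hk hp hT hO ih =>
    obtain ⟨i1, i2, i3, i4⟩ := ih
    have hpp := hpos hk hp
    refine ⟨fun x => ?_, i2, fun x => ?_, ?_⟩
    · have : M.IsOpenIn T pos k x → M.edge x ≠ p := by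
        rintro ⟨h1, -⟩ rfl
        exact hT ((hem x).2 h1)
      refine (i1 x).trans ?_
      rw [h.isOpenIn_succ hk hp]
      clear * - this hT hO
      tauto
    · rw [h.isOpenOut_succ hk hp, ← i3 x, List.map_cons, List.mem_cons]
      have : x ∈ B.map Prod.snd → M.edge x ≠ p := by
        rintro hx rfl
        have := (i3 x).1 hx
        rw [h.mem_treeHeads_iff, hee] at hO
        have e5 := h.edge_root
        have e6 := h.root_mem
        unfold IsOpenOut at this
        grind
      clear * - this hT hO
      tauto
    · rw [List.map_cons, List.pairwise_cons]
      refine ⟨fun x hx => ?_, i4⟩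
      have := ((i3 x).1 hx).2.1
      change pos x < pos p
      omega
  | @pop k a F A G b B p hr hk hp hT hO hpa ih =>
    obtain ⟨i1, i2, i3, i4⟩ := ih
    have hpp := hpos hk hp
    refine ⟨fun x => ?_, i2, fun x => ?_, i4.tail⟩
    · have : M.IsOpenIn T pos k x → M.edge x ≠ p := by
        rintro ⟨h1, -⟩ rfl
        exact hT ((hem x).2 h1)
      refine (i1 x).trans ?_
      rw [h.isOpenIn_succ hk hp]
      clear * - this hT hO
      tauto
    · rw [h.isOpenOut_succ hk hp, ← i3 x]
      simp only [List.map_cons, List.mem_cons, List.pairwise_cons] at i4 ⊢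
      have hxe : M.edge x = p ↔ x = b := by
        rw [← hpa]
        constructor
        · rintro rfl; exact (hee x).symm
        · rintro rfl; exact hee p
      rw [ne_eq, hxe]
      have : x = b → ¬ (x ∈ B.map Prod.snd) := by
        rintro rfl hx
        exact lt_irrefl _ (i4.1 x hx)
      clear * - this hT hO
      tauto

/-- Two edges on the same side of the tour, met once at time `k`, are nested. -/
theorem eq_of_edge_eq_tour {k : ℕ} (hk : k < N) {a p : H} (hp : M.tour T (k + 1) = p)
    (hpa : pos (M.edge p) < pos p) (ha : pos (M.edge p) ≤ pos a) (hak : pos a ≤ k)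
    (hka : k < pos (M.edge a)) (hT : a ∈ T ↔ p ∈ T) : a = M.edge p := by
  have hpp : pos p = k + 1 := by rw [← hp]; exact h.pos_tour _ hk
  by_contra hne
  have h1 := h.between_edge (M.edge p) (by rwa [h.edge_edge]) a (by rw [h.edge_mem, hT]) hne
    (by rw [h.edge_edge]; rintro rfl; omega)
  rw [h.edge_edge] at h1
  have h2 : pos (M.edge p) ≠ pos a := fun hh => hne (h.pos_injective hh).symm
  have h3 := (h1.2 (by omega)).2
  have h4 : M.edge a = p := h.pos_injective (by omega)
  exact hne (by rw [← h4, h.edge_edge])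

/-- Edges on the same side of the tour are nested, so the edge closed at time `k + 1` is the last
one opened on its side, the top of its stack. -/
theorem run_progress {k : ℕ} {A B} (hr : M.Run T N k A B) (hk : k < N) :
    ∃ A' B', M.Run T N (k + 1) A' B' := by
  obtain ⟨i1, i2, i3, i4⟩ := h.run_open hr
  obtain ⟨p, hp⟩ : ∃ p, M.tour T (k + 1) = p := ⟨_, rfl⟩
  have hpp : pos p = k + 1 := by rw [← hp]; exact h.pos_tour _ hk
  have hroot : M.root ∈ A.map Prod.fst :=
    (i1 _).2 ⟨h.root_mem, by rw [h.pos_root]; omega, .inl rfl⟩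
  have hpr : p ≠ M.root := by rintro rfl; rw [h.pos_root] at hpp; omega
  obtain _ | ⟨⟨a, F⟩, A⟩ := A
  · simp at hroot
  have hmem := h.mem_treeHeads_iff (x := p)
  have hne := h.pos_edge_ne hpr
  by_cases hT : p ∈ T
  · by_cases hO : p ∈ M.treeHeads T
    · have hlt : pos (M.edge p) < pos p := by simpa [hpr, hT, hO] using hmem
      have hin : M.IsOpenIn T pos k (M.edge p) :=
        ⟨(h.edge_mem p).2 hT, by omega, .inr (by rw [h.edge_edge]; omega)⟩
      have hle : pos (M.edge p) ≤ pos a := by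
        have := (i1 _).2 hin
        simp only [List.map_cons, List.mem_cons, List.pairwise_cons] at this i2
        rcases this with rfl | this
        · rfl
        · exact (i2.1 _ this).le
      have hae : a = M.edge p := by
        have ha := (i1 a).1 (by simp)
        have hpos := h.pos_pos (h.edge_ne_root hpr)
        refine h.eq_of_edge_eq_tour hk hp hlt hle ha.2.1 ?_ (iff_of_true ha.1 hT)
        rcases ha.2.2 with rfl | ha
        · rw [h.pos_root] at hle; omega
        · exact ha
      obtain _ | ⟨⟨a', F'⟩, A⟩ := A
      · simp only [List.map_cons, List.map_nil, List.mem_singleton] at hroot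
        exact absurd (hae.symm.trans hroot.symm) (h.edge_ne_root hpr)
      · exact ⟨_, _, .up hr hk hp hT hO hae.symm⟩
    · exact ⟨_, _, .down hr hk hp hT hO⟩
  · by_cases hO : p ∈ M.treeHeads T
    · exact ⟨_, _, .push hr hk hp hT hO⟩
    · have hlt : pos (M.edge p) < pos p := by
        have : ¬ pos p < pos (M.edge p) := by simpa [hpr, hT, hO] using hmem
        omega
      have hin : M.IsOpenOut T pos k (M.edge p) :=
        ⟨mt (h.edge_mem p).1 hT, by omega, by rw [h.edge_edge]; omega⟩
      have hB := (i3 _).2 hin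
      obtain _ | ⟨⟨G, b⟩, B⟩ := B
      · simp at hB
      have hle : pos (M.edge p) ≤ pos b := by
        simp only [List.map_cons, List.mem_cons, List.pairwise_cons] at hB i4
        rcases hB with rfl | this
        · rfl
        · exact (i4.1 _ this).le
      have hb := (i3 b).1 (by simp)
      have := h.eq_of_edge_eq_tour hk hp hlt hle hb.2.1 hb.2.2 (iff_of_false hb.1 hT)
      exact ⟨_, _, .pop hr hk hp hT hO this.symm⟩

theorem exists_run (k : ℕ) (hk : k ≤ N) : ∃ A B, M.Run T N k A B := by
  induction k with
  | zero => exact ⟨_, _, .init⟩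
  | succ k ih =>
    obtain ⟨A, B, hr⟩ := ih (by omega)
    exact h.run_progress hr hk

/-- At time `N` every edge has been met twice; only the root, which has no second half, remains on a
stack. -/
theorem exists_run_last : ∃ F, M.Run T N N [(M.root, F)] [] := by
  obtain ⟨A, B, hr⟩ := h.exists_run N le_rfl
  obtain ⟨i1, i2, i3, i4⟩ := h.run_open hr
  have hA : ∀ x ∈ A.map Prod.fst, x = M.root := by
    intro x hx
    rcases ((i1 x).1 hx).2.2 with h1 | h1
    · exact h1
    · exact absurd (h.pos_le (M.edge x)) (by omega)
  have hroot : M.root ∈ A.map Prod.fst :=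
    (i1 _).2 ⟨h.root_mem, by rw [h.pos_root]; omega, .inl rfl⟩
  obtain _ | ⟨⟨b, c⟩, B⟩ := B
  · obtain _ | ⟨⟨a, F⟩, _ | ⟨⟨a', F'⟩, A⟩⟩ := A
    · simp at hroot
    · obtain rfl : a = M.root := hA a (by simp)
      exact ⟨F, hr⟩
    · have e1 := hA a (by simp)
      have e2 := hA a' (by simp)
      simp [e1, e2] at i2
  · have := ((i3 c).1 (by simp)).2.2
    exact absurd (h.pos_le (M.edge c)) (by omega)

/-- When a head `p` is met, the interval of tails begun at `s` closes up and `p` is followed by `s`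
in the exploded map. The list walked from `s` to `p` is then a complete excursion. For an edge of
`T` it is spliced at once into the entry below; for another edge it is stored with `p` until the
tail of `p` is met. -/
theorem run_walk [Finite H] {k : ℕ} {A B} (hr : M.Run T N k A B) :
    M.StackWalk (M.treeHeads T) A (M.tour T (k + 1)) ∧ ∀ G b, (G, b) ∈ B →
      IsWalk (fun x => (M.explosion (M.treeHeads T)).rot (M.edge x))
        ((M.explosion (M.treeHeads T)).rot b) G b := by
  set O := M.treeHeads T with hO
  have hfh := h.exists_iterate_mem_treeHeads
  rw [← hO] at hfh
  have hroot : M.root ∈ M.treeHeads T := root_mem_treeHeads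
  have hpos : ∀ {k p}, k < N → M.tour T (k + 1) = p → pos p = k + 1 := fun hk hp => by
    rw [← hp]; exact h.pos_tour _ hk
  have hpr : ∀ {k p}, k < N → M.tour T (k + 1) = p → p ≠ M.root := fun hk hp => by
    rintro rfl
    have := hpos hk hp
    rw [h.pos_root] at this; omega
  induction hr with
  | init =>
    have : M.tour T (0 + 1) = M.rot M.root := by
      rw [← h.pos_root, ← h.rot_edge_of_mem h.root_mem, h.edge_root]
    rw [this]
    refine ⟨⟨rfl, _, isIntervalStart_rot hroot, ?_, rfl⟩, by simp⟩
    rw [h.edge_root]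
    exact sameVertex_iterate _ 1
  | @down k a F A B p hr hk hp hT hpO ih =>
    have hs : M.tour T (k + 1 + 1) = M.rot (M.edge p) := by
      rw [h.rot_edge_of_mem hT, hpos hk hp]
    rw [hp] at ih
    have hpe : M.edge p ∈ O := (h.edge_mem_treeHeads_iff (hpr hk hp)).2 hpO
    rw [hs]
    exact ⟨⟨ih.1, _, isIntervalStart_rot hpe, sameVertex_iterate _ 1, rfl⟩, ih.2⟩
  | @up k a F a' F' A B p hr hk hp hT hpO hpa ih =>
    have hs : M.tour T (k + 1 + 1) = M.rot a := by
      rw [← hpa, h.rot_edge_of_mem hT, hpos hk hp]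
    have haO : a ∉ O := by
      have := (h.edge_mem_treeHeads_iff (hpr hk hp))
      rw [hpa] at this
      exact fun hh => this.1 hh hpO
    rw [hp] at ih
    obtain ⟨⟨⟨i1, s', i2, i3, i4⟩, s, i5, i6, i7⟩, i8⟩ := ih
    -- The head `p` completes the exploded vertex entered through `a`, so crossing `a` leads to `s`,
    -- where the excursion `F` starts.
    have hrot := i5.explosion_rot hfh hpO
    have hap : M.edge a = p := by rw [← hpa, h.edge_edge]
    refine ⟨⟨i1, s', ?_, i3, ?_⟩, i8⟩
    · rw [hs]; exact i2.rot haO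
    · rw [List.append_assoc, List.cons_append, isWalk_append]
      refine ⟨a, i4, rfl, ?_⟩
      rw [isWalk_append]
      refine ⟨p, ?_, rfl, ?_⟩
      · change IsWalk _ ((M.explosion O).rot (M.edge a)) _ _
        rw [hap, hrot]
        exact i7
      · change (M.explosion O).rot (M.edge p) = _
        rw [hpa, explosion_rot_of_notMem hfh haO, hs]
  | @push k a F A B p hr hk hp hT hpO ih =>
    have hs : M.tour T (k + 1 + 1) = M.rot p := by
      rw [h.rot_of_notMem hT, hpos hk hp]
    rw [hp] at ih
    obtain ⟨⟨i1, s, i5, i6, i7⟩, i8⟩ := ih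
    refine ⟨⟨i1, M.rot p, ?_, ?_, hs.symm⟩, ?_⟩
    · rw [hs]; exact isIntervalStart_rot hpO
    · exact (i6.trans i5.sameVertex).trans (sameVertex_iterate _ 1)
    · intro G b hGb
      rcases List.mem_cons.1 hGb with hGb | hGb
      · obtain ⟨rfl, rfl⟩ := Prod.mk.inj hGb
        rw [i5.explosion_rot hfh hpO]
        exact i7
      · exact i8 G b hGb
  | @pop k a F A G b B p hr hk hp hT hpO hpa ih =>
    have hs : M.tour T (k + 1 + 1) = M.rot p := by
      rw [h.rot_of_notMem hT, hpos hk hp]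
    rw [hp] at ih
    obtain ⟨⟨i1, s, i5, i6, i7⟩, i8⟩ := ih
    refine ⟨⟨i1, s, ?_, i6, ?_⟩, fun G b hGb => i8 G b (List.mem_cons_of_mem _ hGb)⟩
    · rw [hs]; exact i5.rot hpO
    · rw [List.append_assoc, List.cons_append, isWalk_append]
      refine ⟨p, i7, rfl, ?_⟩
      rw [isWalk_append]
      refine ⟨b, ?_, rfl, ?_⟩
      · change IsWalk _ ((M.explosion O).rot (M.edge p)) _ _
        rw [hpa]
        exact i8 G b (by simp)
      · change (M.explosion O).rot (M.edge b) = _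
        rw [← hpa, h.edge_edge, explosion_rot_of_notMem hfh hpO, hs]

/-- Insertions preserve the order of what is already there, so only the place of `p` relative to its
mate matters. When `p` closes an edge, it is a head inserted to the right of its mate (`up`) or a
tail inserted to the left of its mate (`pop`). Thus every tail precedes its head in the contour. -/
theorem run_pairwise {k : ℕ} {A B} (hr : M.Run T N k A B) :
    (leftTour A ++ rightTour B).Pairwise (fun x y => x ∈ M.treeHeads T → M.edge x ≠ y) := by
  have step : ∀ {k : ℕ} {X Y : List H} {p : H}, k < N → M.tour T (k + 1) = p →
      (X ++ Y).Nodup → (∀ x, x ∈ X ++ Y ↔ pos x ≤ k) →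
      (p ∈ T → p ∈ M.treeHeads T → M.edge p ∈ X) →
      (p ∉ T → p ∉ M.treeHeads T → M.edge p ∈ Y) →
      (X ++ Y).Pairwise (fun x y => x ∈ M.treeHeads T → M.edge x ≠ y) →
      (X ++ p :: Y).Pairwise (fun x y => x ∈ M.treeHeads T → M.edge x ≠ y) := by
    intro k X Y p hk hp hnd hmem h1 h2 hpw
    have hpos := h.pos_tour (k + 1) hk
    rw [hp] at hpos
    have hpr : p ≠ M.root := by rintro rfl; rw [h.pos_root] at hpos; omega
    have hO := h.mem_treeHeads_iff (x := p)
    rw [List.pairwise_append] at hpw ⊢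
    rw [List.nodup_append] at hnd
    obtain ⟨p1, p2, p3⟩ := hpw
    obtain ⟨n1, n2, n3⟩ := hnd
    refine ⟨p1, List.pairwise_cons.2 ⟨fun y hy hpO hpy => ?_, p2⟩, fun x hx y hy => ?_⟩
    · by_cases hT : p ∈ T
      · exact n3 _ (h1 hT hpO) _ hy hpy
      · have := (hmem y).1 (List.mem_append_right _ hy)
        rw [← hpy] at this
        have := hO.1 hpO
        simp only [hpr, hT, false_and, false_or, not_false_iff, true_and] at this
        omega
    · rcases List.mem_cons.1 hy with rfl | hy
      · intro hxO hxy
        have hx' : x = M.edge y := by rw [← hxy, h.edge_edge]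
        have hyO : y ∉ M.treeHeads T := by
          have := h.edge_mem_treeHeads_iff hpr
          rw [← hx'] at this
          exact this.1 hxO
        by_cases hT : y ∈ T
        · have h3 := (hmem x).1 (List.mem_append_left _ hx)
          rw [hx'] at h3
          rw [hO] at hyO
          simp only [hpr, hT, true_and, false_or, not_true, false_and, or_false] at hyO
          omega
        · exact n3 _ hx _ (h2 hT hyO) hx'
      · exact p3 x hx y hy
  induction hr with
  | init => simp [leftTour, rightTour]
  | down hr hk hp hT hO ih =>
    obtain ⟨-, t1, t2⟩ := h.run_tour hr
    simpa [leftTour, rightTour] using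
      step hk hp t1 t2 (fun _ h1 => absurd h1 hO) (fun h1 => absurd hT h1) ih
  | up hr hk hp hT hO hpa ih =>
    obtain ⟨-, t1, t2⟩ := h.run_tour hr
    simpa [leftTour, rightTour] using
      step hk hp t1 t2 (fun _ _ => by simp [leftTour, hpa]) (fun h1 => absurd hT h1) ih
  | push hr hk hp hT hO ih =>
    obtain ⟨-, t1, t2⟩ := h.run_tour hr
    simpa [leftTour, rightTour] using
      step hk hp t1 t2 (fun h1 => absurd h1 hT) (fun _ h1 => absurd hO h1) ih
  | pop hr hk hp hT hO hpa ih =>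
    obtain ⟨-, t1, t2⟩ := h.run_tour hr
    simpa [leftTour, rightTour] using
      step hk hp t1 t2 (fun h1 => absurd h1 hT) (fun _ _ => by simp [rightTour, hpa]) ih

end IsTreeTour

end MapData

/-! ### The discovery order of the heads -/

namespace MapData

variable {H : Type*} {M : MapData H}

/-- The vertex of a half-edge. -/
def vertex (M : MapData H) (x : H) : Quotient (SameCycle.setoid M.rot) := Quotient.mk _ x

theorem vertex_eq_iff {x y : H} : M.vertex x = M.vertex y ↔ M.SameVertex x y := Quotient.eq

open Classical in
/-- The order in which the heads are completed: the root comes last. -/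
noncomputable def headRank (M : MapData H) (N : ℕ) (pos : H → ℕ) (x : H) : ℕ :=
  if x = M.root then N + 1 else pos x

theorem headRank_root (N : ℕ) (pos : H → ℕ) : M.headRank N pos M.root = N + 1 := if_pos rfl

theorem headRank_of_ne {N : ℕ} {pos : H → ℕ} {x : H} (hx : x ≠ M.root) :
    M.headRank N pos x = pos x := if_neg hx

theorem tourStep_univ (M : MapData H) : M.tourStep Set.univ = fun x => M.rot (M.edge x) := by
  funext x
  simp [tourStep]

theorem tour_univ_succ (M : MapData H) (k : ℕ) :
    M.tour Set.univ (k + 1) = M.rot (M.edge (M.tour Set.univ k)) := by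
  rw [tour, Function.iterate_succ_apply', tourStep_univ]
  simp only [tour, tourStep_univ]

/-- The content of the tour of the exploded map. -/
structure IsExplodedTour [Finite H] (M : MapData H) (T : Set H) (N : ℕ) (pos : H → ℕ)
    (t : ℕ → H) : Prop where
  eq_tour : ∀ i, t i = (M.explosion (M.treeHeads T)).tour Set.univ i
  injective : ∀ i ≤ N, ∀ j ≤ N, t i = t j → i = j
  surjective : ∀ x, ∃ i ≤ N, t i = x
  edge_ne : ∀ i j, i < j → j ≤ N → t i ∈ M.treeHeads T → M.edge (t i) ≠ t j
  nonCrossing : ∀ i j k l, i < j → j < k → k < l → l ≤ N → M.edge (t i) ∈ M.treeHeads T →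
    M.edge (t j) ∈ M.treeHeads T → M.edge (t k) ∈ M.treeHeads T → M.edge (t l) ∈ M.treeHeads T →
    M.SameVertex (M.edge (t i)) (M.edge (t k)) → M.SameVertex (M.edge (t j)) (M.edge (t l)) →
    M.SameVertex (M.edge (t i)) (M.edge (t j))
  headRank_lt : ∀ i j, i < j → j ≤ N → M.edge (t i) ∈ M.treeHeads T →
    M.edge (t j) ∈ M.treeHeads T → M.SameVertex (M.edge (t i)) (M.edge (t j)) →
    M.headRank N pos (M.edge (t j)) < M.headRank N pos (M.edge (t i))

namespace IsTreeTour

variable {T : Set H} {N : ℕ} {pos : H → ℕ} (h : M.IsTreeTour T N pos)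

include h

theorem headRank_le (x : H) : M.headRank N pos x ≤ N + 1 := by
  rw [headRank]
  split_ifs
  · rfl
  · exact (h.pos_le x).trans (Nat.le_succ _)

theorem headRank_injective : Function.Injective (M.headRank N pos) := by
  intro x y hxy
  have := h.pos_le x
  have := h.pos_le y
  rw [headRank, headRank] at hxy
  split_ifs at hxy with h1 h2 h2
  · rw [h1, h2]
  · omega
  · omega
  · exact h.pos_injective hxy

/-- Say `b` opened after `a`. The mate of `b` lies in the interval of the edge of `b`, the mate of
`a` does not, and no vertex of `M` has half-edges on both sides of that interval. -/
theorem not_sameVertex_of_isOpenIn [Finite H] {k : ℕ} {a b : H} (ha : M.IsOpenIn T pos k a)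
    (hb : M.IsOpenIn T pos k b) (hab : a ≠ b) : ¬ M.SameVertex (M.edge a) (M.edge b) := by
  wlog hlt : pos a < pos b generalizing a b
  · have hne := h.pos_injective.ne hab
    exact fun hs => this hb ha hab.symm (by omega) hs.symm
  have hbr : b ≠ M.root := by rintro rfl; rw [h.pos_root] at hlt; omega
  have hbk : k < pos (M.edge b) := hb.2.2.resolve_left hbr
  have hb' : pos b < pos (M.edge b) := lt_of_le_of_lt hb.2.1 hbk
  intro hs
  have h1 := h.between_sameVertex hb.1 hb' hs
  have hk := ha.2.1
  have h2 := h.between_edge b hb' a (iff_of_true ha.1 hb.1) hab (by rintro rfl; omega)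
  omega

/-- Only `down` and `push` change the list of heads: `down` inserts a head of a vertex of `M` absent
from the list, `push` inserts `p` just after the head `M.edge a` of the same vertex. In the second
case the rank `k + 1` of `p` is below that of `M.edge a`, which is still to come, and above those of
the later heads at this vertex, which have been met already. -/
theorem run_discovered [Finite H] {k : ℕ} {A B} (hr : M.Run T N k A B) :
    (∀ x ∈ M.discovered (M.treeHeads T) A B, pos x ≤ k ∨ M.IsOpenIn T pos k (M.edge x)) ∧
    IsNonCrossingList ((M.discovered (M.treeHeads T) A B).map M.vertex) ∧
    (M.discovered (M.treeHeads T) A B).Pairwise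
      (fun x y => M.vertex x = M.vertex y → M.headRank N pos y < M.headRank N pos x) := by
  have hroot : M.root ∈ M.treeHeads T := root_mem_treeHeads
  set O := M.treeHeads T with hO
  have hpos : ∀ {k p}, k < N → M.tour T (k + 1) = p → pos p = k + 1 := fun hk hp => by
    rw [← hp]; exact h.pos_tour _ hk
  have hpr : ∀ {k p}, k < N → M.tour T (k + 1) = p → p ≠ M.root := fun hk hp => by
    rintro rfl
    have := hpos hk hp
    rw [h.pos_root] at this; omega
  have hopen : ∀ {k p x}, k < N → M.tour T (k + 1) = p →
      (pos x ≤ k ∨ M.IsOpenIn T pos k (M.edge x)) →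
      (pos x ≤ k + 1 ∨ M.IsOpenIn T pos (k + 1) (M.edge x)) := by
    rintro k p x hk hp (hx | hx)
    · exact .inl (by omega)
    · by_cases hxp : M.edge (M.edge x) = p
      · rw [h.edge_edge] at hxp
        exact .inl (by rw [hxp, hpos hk hp])
      · exact .inr ((h.isOpenIn_succ hk hp).2 (.inl ⟨hx, hxp⟩))
  induction hr with
  | init =>
    have : M.discovered O [(M.root, [])] [] = [M.root] := by
      simp [discovered, leftTour, rightHeads, reached, h.edge_root, hroot]
    rw [this]
    refine ⟨fun x hx => .inl ?_, fun x y hs => ?_, by simp⟩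
    · rw [List.mem_singleton.1 hx, h.pos_root]
    · simpa using hs.length_le
  | @down k a F A B p hr hk hp hT hpO ih =>
    obtain ⟨i1, i2, i3⟩ := ih
    have hpp := hpos hk hp
    have hpe : M.edge p ∈ O := (h.edge_mem_treeHeads_iff (hpr hk hp)).2 hpO
    have hop : M.IsOpenIn T pos (k + 1) p := (h.isOpenIn_succ hk hp).2 (.inr ⟨rfl, hT, hpO⟩)
    have hlt : k + 1 < pos (M.edge p) := hop.2.2.resolve_left (hpr hk hp)
    have hX : M.discovered O ((a, F) :: A) B =
      M.reached O (leftTour ((a, F) :: A)) ++ M.rightHeads O B := rfl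
    have hX' : M.discovered O ((p, []) :: (a, F) :: A) B =
        M.reached O (leftTour ((a, F) :: A)) ++ M.edge p :: M.rightHeads O B := by
      rw [discovered, leftTour, reached_append, reached_cons_of_mem hpe, reached_nil]
      simp
    rw [hX] at i1 i2 i3
    rw [hX']
    set X := M.reached O (leftTour ((a, F) :: A))
    set Y := M.rightHeads O B
    -- All half-edges at the far end of the edge of `p` are met after time `k + 1`; a listed head
    -- not met yet faces another open edge of `T`, whose far end is a different vertex.
    have hfresh : ∀ x ∈ X ++ Y, ¬ M.SameVertex x (M.edge p) := by
      intro x hx hs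
      rcases i1 x hx with h1 | h1
      · have := (h.between_sameVertex hT (by omega) hs).2 ⟨by omega, le_rfl⟩
        omega
      · have hne : M.edge (M.edge x) ≠ p := by
          rw [h.edge_edge]
          rintro rfl
          have := h1.2.1
          omega
        refine h.not_sameVertex_of_isOpenIn ((h.isOpenIn_succ hk hp).2 (.inl ⟨h1, hne⟩)) hop ?_ ?_
        · rintro hxp
          have := h1.2.1
          rw [hxp] at this
          omega
        · rwa [h.edge_edge]
    refine ⟨fun x hx => ?_, ?_, ?_⟩
    · simp only [List.mem_append, List.mem_cons] at hx
      have : x ∈ X ++ Y ∨ x = M.edge p := by rw [List.mem_append]; tauto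
      rcases this with hx | rfl
      · exact hopen hk hp (i1 x hx)
      · right; rwa [h.edge_edge]
    · rw [List.map_append, List.map_cons]
      rw [List.map_append] at i2
      refine i2.insert_of_notMem ?_ ?_
      · intro hm
        obtain ⟨x, hx, hxe⟩ := List.mem_map.1 hm
        exact hfresh x (List.mem_append_left _ hx) (vertex_eq_iff.1 hxe)
      · intro hm
        obtain ⟨x, hx, hxe⟩ := List.mem_map.1 hm
        exact hfresh x (List.mem_append_right _ hx) (vertex_eq_iff.1 hxe)
    · rw [List.pairwise_append] at i3 ⊢
      refine ⟨i3.1, List.pairwise_cons.2 ⟨fun y hy hv => ?_, i3.2.1⟩, fun x hx y hy => ?_⟩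
      · exact absurd (vertex_eq_iff.1 hv).symm (hfresh y (List.mem_append_right _ hy))
      · rcases List.mem_cons.1 hy with rfl | hy
        · exact fun hv => absurd (vertex_eq_iff.1 hv) (hfresh x (List.mem_append_left _ hx))
        · exact i3.2.2 x hx y hy
  | @up k a F a' F' A B p hr hk hp hT hpO hpa ih =>
    have haO : M.edge p ∉ O := fun hh => (h.edge_mem_treeHeads_iff (hpr hk hp)).1 hh hpO
    have hX : M.discovered O ((a', F' ++ a :: F ++ [p]) :: A) B =
        M.discovered O ((a, F) :: (a', F') :: A) B := by
      have : leftTour ((a', F' ++ a :: F ++ [p]) :: A) =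
        leftTour ((a, F) :: (a', F') :: A) ++ [p] := by simp [leftTour]
      rw [discovered, this, reached_append, reached_cons_of_notMem haO, reached_nil,
        List.append_nil]
      rfl
    rw [hX]
    exact ⟨fun x hx => hopen hk hp (ih.1 x hx), ih.2⟩
  | @push k a F A B p hr hk hp hT hpO ih =>
    obtain ⟨i1, i2, i3⟩ := ih
    have hpp := hpos hk hp
    have hao : M.IsOpenIn T pos k a := ((h.run_open hr).1 a).1 (by simp)
    have haO : M.edge a ∈ O := by
      by_cases har : a = M.root
      · rw [har, h.edge_root]; exact hroot
      · have := hao.2.1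
        have := hao.2.2.resolve_left har
        rw [h.edge_mem_treeHeads_iff har, h.mem_treeHeads_iff]
        simp only [har, hao.1, not_true, false_and, or_false, false_or, true_and]
        omega
    have hX : M.discovered O ((a, F) :: A) B =
        M.reached O (leftTour A) ++ M.edge a :: (M.reached O F ++ M.rightHeads O B) := by
      rw [discovered, leftTour, reached_append, reached_cons_of_mem haO]
      simp
    have hX' : M.discovered O ((a, []) :: A) ((F, p) :: B) =
        M.reached O (leftTour A) ++ M.edge a :: p :: (M.reached O F ++ M.rightHeads O B) := by
      rw [discovered, leftTour, reached_append, reached_cons_of_mem haO, reached_nil, rightHeads]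
      simp
    have hs : M.vertex (M.edge a) = M.vertex p := by
      obtain ⟨⟨-, s, h1, h2, -⟩, -⟩ := h.run_walk hr
      rw [hp] at h1
      exact vertex_eq_iff.2 (h2.trans h1.sameVertex)
    have hap : M.edge a ≠ p := by
      rintro rfl
      exact hT ((h.edge_mem a).2 hao.1)
    have hrp : M.headRank N pos p = k + 1 := by rw [headRank_of_ne (hpr hk hp), hpp]
    have hra : k + 1 < M.headRank N pos (M.edge a) := by
      rcases hao.2.2 with har | hka
      · rw [har, h.edge_root, headRank_root]; omega
      · have h1 : M.edge a ≠ M.root := fun hh => by rw [hh, h.pos_root] at hka; omega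
        have h2 : pos (M.edge a) ≠ pos p := h.pos_injective.ne hap
        rw [headRank_of_ne h1]; omega
    rw [hX] at i1 i2 i3
    rw [hX']
    set X := M.reached O (leftTour A)
    set Y := M.reached O F ++ M.rightHeads O B
    rw [List.pairwise_append, List.pairwise_cons] at i3
    refine ⟨fun x hx => ?_, ?_, ?_⟩
    · have : x ∈ X ++ M.edge a :: Y ∨ x = p := by
        simp only [List.mem_append, List.mem_cons] at hx ⊢; tauto
      rcases this with hx | rfl
      · exact hopen hk hp (i1 x hx)
      · exact .inl hpp.le
    · rw [List.map_append, List.map_cons, List.map_cons, ← hs]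
      rw [List.map_append, List.map_cons] at i2
      exact i2.duplicate
    · rw [List.pairwise_append, List.pairwise_cons, List.pairwise_cons]
      refine ⟨i3.1, ⟨fun y hy => ?_, fun y hy hv => ?_, i3.2.1.2⟩, fun x hx y hy => ?_⟩
      · rcases List.mem_cons.1 hy with rfl | hy
        · intro _; omega
        · exact i3.2.1.1 y hy
      · have hlt := i3.2.1.1 y hy (hs.trans hv)
        have hyr : y ≠ M.root := by
          rintro rfl
          rw [headRank_root] at hlt
          have := h.headRank_le (M.edge a)
          omega
        -- A head at this vertex not met yet would face another open edge of `T` with the same far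
        -- end as `a`, which is impossible.
        rcases i1 y (by simp [hy]) with h1 | h1
        · rw [headRank_of_ne hyr]; omega
        · refine absurd ?_ (h.not_sameVertex_of_isOpenIn hao h1 ?_)
          · rw [h.edge_edge]; exact vertex_eq_iff.1 (hs.trans hv)
          · rintro rfl
            rw [h.edge_edge] at hlt
            exact lt_irrefl _ hlt
      · rcases List.mem_cons.1 hy with rfl | hy
        · exact i3.2.2 x hx _ (by simp)
        · rcases List.mem_cons.1 hy with rfl | hy
          · intro hv
            have := i3.2.2 x hx (M.edge a) (by simp) (hv.trans hs.symm)
            omega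
          · exact i3.2.2 x hx y (by simp [hy])
  | @pop k a F A G b B p hr hk hp hT hpO hpa ih =>
    have hpe : M.edge p ∈ O := (h.edge_mem_treeHeads_iff (hpr hk hp)).2 hpO
    have hbe : M.edge b ∉ O := by rw [← hpa, h.edge_edge]; exact hpO
    have hX : M.discovered O ((a, F ++ p :: G ++ [b]) :: A) B =
        M.discovered O ((a, F) :: A) ((G, b) :: B) := by
      have : leftTour ((a, F ++ p :: G ++ [b]) :: A) =
        leftTour ((a, F) :: A) ++ p :: (G ++ [b]) := by simp [leftTour]
      rw [discovered, this, reached_append, reached_cons_of_mem hpe, reached_append,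
        reached_cons_of_notMem hbe, reached_nil, List.append_nil, discovered, rightHeads, hpa]
      simp
    rw [hX]
    exact ⟨fun x hx => hopen hk hp (ih.1 x hx), ih.2⟩

/-- At time `N` the list `M.root :: F` contains every half-edge once and is a closed walk, so it is
a full turn of the contour; the invariants of `Run` are then read off by index. -/
theorem isExplodedTour [Finite H] :
    M.IsExplodedTour T N pos ((M.explosion (M.treeHeads T)).tour Set.univ) := by
  classical
  obtain ⟨F, hr⟩ := h.exists_run_last
  obtain ⟨-, hnd, hmem⟩ := h.run_tour hr
  have hpw := h.run_pairwise hr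
  obtain ⟨⟨-, s, hs, hs', hw⟩, -⟩ := h.run_walk hr
  obtain ⟨-, hnc, hrk⟩ := h.run_discovered hr
  have hdisc : M.discovered (M.treeHeads T) [(M.root, F)] [] =
      M.reached (M.treeHeads T) (M.root :: F) := by
    simp [discovered, leftTour, rightHeads]
  rw [hdisc] at hnc hrk
  simp only [leftTour, rightTour, List.append_nil, List.nil_append] at hnd hmem hpw
  rw [h.tour_period] at hs hw
  set M' := M.explosion (M.treeHeads T)
  set C := M.root :: F with hC
  have hall : ∀ x, x ∈ C := fun x => (hmem x).2 (h.pos_le x)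
  have hlen : C.length = N + 1 := by
    have : (C.map pos).Perm (List.range (N + 1)) := by
      rw [List.perm_ext_iff_of_nodup (hnd.map h.pos_injective) List.nodup_range]
      intro k
      rw [List.mem_map, List.mem_range]
      constructor
      · rintro ⟨x, -, rfl⟩
        exact Nat.lt_succ_of_le (h.pos_le x)
      · intro hk
        exact ⟨_, hall _, h.pos_tour k (by omega)⟩
    simpa using this.length_eq
  have hwalk : IsWalk (fun x => M'.rot (M.edge x)) M.root C M.root := by
    refine ⟨rfl, ?_⟩
    change IsWalk _ (M'.rot (M.edge M.root)) F M.root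
    rw [h.edge_root, hs.explosion_rot h.exists_iterate_mem_treeHeads root_mem_treeHeads]
    exact hw
  have htour : ∀ i, M'.tour Set.univ i = (fun x => M'.rot (M.edge x))^[i] M.root := by
    intro i
    rw [tour, tourStep_univ]
    rfl
  have hget : ∀ i (hi : i < C.length), M'.tour Set.univ i = C[i] := fun i hi => by
    rw [htour, hwalk.getElem_eq i hi]
  have hget' : ∀ i (hi : i ≤ N), M'.tour Set.univ i = C[i]'(by omega) := fun i hi => hget i _
  refine ⟨fun _ => rfl, ?_, ?_, ?_, ?_, ?_⟩
  · intro i hi j hj hij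
    rw [hget' i hi, hget' j hj] at hij
    exact (hnd.getElem_inj_iff).1 hij
  · intro x
    obtain ⟨i, hi, hix⟩ := List.mem_iff_getElem.1 (hall x)
    exact ⟨i, by omega, by rw [hget i hi, hix]⟩
  · intro i j hij hj
    rw [hget' i (by omega), hget' j hj]
    exact List.pairwise_iff_getElem.1 hpw i j _ _ hij
  · intro i j k l hij hjk hkl hl h1 h2 h3 h4 h5 h6
    rw [← vertex_eq_iff] at h5 h6 ⊢
    refine hnc _ _ ?_
    have hsub : [M'.tour Set.univ i, M'.tour Set.univ j, M'.tour Set.univ k,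
        M'.tour Set.univ l].Sublist C := by
      rw [List.sublist_iff_exists_fin_orderEmbedding_get_eq]
      let f : Fin 4 → Fin C.length := ![⟨i, by omega⟩, ⟨j, by omega⟩, ⟨k, by omega⟩, ⟨l, by omega⟩]
      have hf : StrictMono f := by
        rw [Fin.strictMono_iff_lt_succ]
        intro a
        fin_cases a
        · exact hij
        · exact hjk
        · exact hkl
      refine ⟨OrderEmbedding.ofStrictMono f hf, fun a => ?_⟩
      fin_cases a
      · exact hget' i (by omega)
      · exact hget' j (by omega)
      · exact hget' k (by omega)
      · exact hget' l (by omega)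
    have := (((hsub.map M.edge).filter (fun x => decide (x ∈ M.treeHeads T))).map M.vertex)
    simpa [h1, h2, h3, h4, ← h5, ← h6, reached] using this
  · intro i j hij hj h1 h2 h3
    have hsub : [M'.tour Set.univ i, M'.tour Set.univ j].Sublist C := by
      rw [List.sublist_iff_exists_fin_orderEmbedding_get_eq]
      let f : Fin 2 → Fin C.length := ![⟨i, by omega⟩, ⟨j, by omega⟩]
      have hf : StrictMono f := by
        rw [Fin.strictMono_iff_lt_succ]
        intro a
        fin_cases a
        exact hij
      refine ⟨OrderEmbedding.ofStrictMono f hf, fun a => ?_⟩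
      fin_cases a
      · exact hget' i (by omega)
      · exact hget' j (by omega)
    have := hrk.sublist (((hsub.map M.edge).filter (fun x => decide (x ∈ M.treeHeads T))))
    simp only [List.map_cons, List.map_nil, h1, h2, decide_true, List.filter_cons_of_pos,
      List.filter_nil, List.pairwise_cons, List.mem_singleton, forall_eq, vertex_eq_iff] at this
    exact this.1 h3

end IsTreeTour

end MapData

/-! ### The exploded map is a plane tree and the partition is non-crossing -/

namespace MapData

variable {H : Type*} {M : MapData H}

theorem joined_univ_of_numFaces_eq_one [Finite H] (hF : M.numFaces = 1) (x y : H) :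
    M.Joined Set.univ x y := by
  have : Nonempty H := ⟨x⟩
  obtain ⟨k, rfl⟩ := sameCycle_iff_exists_iterate.1 (numCycles_eq_one_iff.1 hF x y)
  induction k with
  | zero => exact .refl _
  | succ k ih =>
    rw [Function.iterate_succ_apply']
    exact ih.trans _ _ _ (.trans _ (M.edge _) _ (.rel _ _ (.inr ⟨trivial, rfl⟩))
      (.rel _ _ (.inl rfl)))

namespace IsExplodedTour

variable [Finite H] {T : Set H} {N : ℕ} {pos : H → ℕ} {t : ℕ → H}
  (hE : M.IsExplodedTour T N pos t) (h : M.IsTreeTour T N pos)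

/-- The time at which the tour of the exploded map meets a half-edge. -/
noncomputable def index (hE : M.IsExplodedTour T N pos t) (x : H) : ℕ := (hE.surjective x).choose

theorem index_le (x : H) : hE.index x ≤ N := (hE.surjective x).choose_spec.1

theorem apply_index (x : H) : t (hE.index x) = x := (hE.surjective x).choose_spec.2

theorem index_apply {i : ℕ} (hi : i ≤ N) : hE.index (t i) = i :=
  hE.injective _ (hE.index_le _) _ hi (hE.apply_index _)

theorem index_injective : Function.Injective hE.index := fun x y hxy => by
  rw [← hE.apply_index x, hxy, hE.apply_index]

include hE in
theorem zero : t 0 = M.root := hE.eq_tour 0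

theorem index_root : hE.index M.root = 0 := by
  rw [← hE.zero, hE.index_apply (Nat.zero_le _)]

include hE in
theorem succ (i : ℕ) : t (i + 1) = (M.explosion (M.treeHeads T)).rot (M.edge (t i)) := by
  rw [hE.eq_tour, hE.eq_tour, tour_univ_succ]
  rfl

include hE h

theorem index_edge_lt {x : H} (hx : x ∈ M.treeHeads T) (hxr : x ≠ M.root) :
    hE.index (M.edge x) < hE.index x := by
  by_contra hlt
  have h1 := hE.index_injective.ne (mt (h.edge_eq_self_iff x).1 hxr)
  have h2 := hE.edge_ne (hE.index x) (hE.index (M.edge x)) (by omega) (hE.index_le _)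
  rw [hE.apply_index, hE.apply_index] at h2
  exact h2 hx rfl

theorem mem_treeHeads_iff_index {x : H} :
    x ∈ M.treeHeads T ↔ hE.index (M.edge x) ≤ hE.index x := by
  by_cases hxr : x = M.root
  · rw [hxr, h.edge_root]; exact iff_of_true root_mem_treeHeads le_rfl
  · constructor
    · exact fun hx => (hE.index_edge_lt h hx hxr).le
    · intro hle
      by_contra hx
      have := hE.index_edge_lt h ((h.edge_mem_treeHeads_iff hxr).2 hx) (h.edge_ne_root hxr)
      rw [h.edge_edge] at this
      omega

omit h in
theorem numFaces_explosion : (M.explosion (M.treeHeads T)).numFaces = 1 := by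
  have : Nonempty H := ⟨M.root⟩
  refine numCycles_eq_one_iff.2 ?_
  have key : ∀ x, ((M.explosion (M.treeHeads T)).rot * (M.explosion (M.treeHeads T)).edge).SameCycle
      M.root x := by
    intro x
    rw [← hE.apply_index x]
    induction hE.index x with
    | zero => rw [hE.zero]
    | succ i ih =>
      refine ih.trans (sameCycle_iff_exists_iterate.2 ⟨1, ?_⟩)
      rw [hE.succ]
      rfl
  exact fun x y => (key x).symm.trans (key y)

omit hE in
theorem numVertices_explosion :
    (M.explosion (M.treeHeads T)).numVertices = Nat.card {x // x ∈ M.treeHeads T} := by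
  symm
  refine Nat.card_congr (Equiv.ofBijective (fun x => Quotient.mk _ x.1) ⟨?_, ?_⟩)
  · intro x y hxy
    have := explosion_sameVertex_iff.1 (Quotient.exact hxy)
    rw [firstHead_of_mem x.2, firstHead_of_mem y.2] at this
    exact Subtype.ext this
  · intro q
    induction q using Quotient.inductionOn with
    | _ x =>
      have hx := firstHead_mem h.exists_iterate_mem_treeHeads x
      exact ⟨⟨_, hx⟩, Quotient.sound (explosion_sameVertex_iff.2 (firstHead_of_mem hx))⟩

/-- The tails are the openers of the contour, one for each edge, and `edge` matches them with the
heads other than the root. -/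
theorem card_treeHeads : Nat.card {x // x ∈ M.treeHeads T} = M.numEdges + 1 := by
  have h1 : M.numEdges = Nat.card {x // x ∉ M.treeHeads T} := by
    rw [numEdges, card_cycles_ne_eq_card_openers h.edge_edge h.edge_eq_self_iff hE.index_injective]
    refine Nat.card_congr (Equiv.subtypeEquivRight fun x => ?_)
    rw [hE.mem_treeHeads_iff_index h, not_le]
  rw [h1, ← Nat.card_eq_of_bijective (α := Option {x // x ∉ M.treeHeads T}) (fun o => o.elim
    ⟨M.root, root_mem_treeHeads⟩ fun x => ⟨M.edge x.1, (h.edge_mem_treeHeads_iff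
      (x := x.1) (fun hx => x.2 (by rw [hx]; exact root_mem_treeHeads))).2 x.2⟩), Finite.card_option]
  have hne : ∀ x : {x // x ∉ M.treeHeads T}, x.1 ≠ M.root :=
    fun x hx => x.2 (by rw [hx]; exact root_mem_treeHeads)
  constructor
  · rintro (_ | x) (_ | y) hxy
    · rfl
    · exact absurd (congrArg Subtype.val hxy).symm (h.edge_ne_root (hne y))
    · exact absurd (congrArg Subtype.val hxy) (h.edge_ne_root (hne x))
    · exact congrArg some (Subtype.ext (M.edge.injective (congrArg Subtype.val hxy)))
  · rintro ⟨x, hx⟩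
    by_cases hxr : x = M.root
    · exact ⟨none, Subtype.ext hxr.symm⟩
    · refine ⟨some ⟨M.edge x, fun hh => (h.edge_mem_treeHeads_iff hxr).1 hh hx⟩, Subtype.ext ?_⟩
      exact h.edge_edge x

theorem isPlaneTree_explosion : (M.explosion (M.treeHeads T)).IsPlaneTree := by
  have hF := hE.numFaces_explosion
  refine ⟨⟨h.edge_edge, h.edge_eq_self_iff, joined_univ_of_numFaces_eq_one hF, ?_⟩, hF⟩
  rw [hF, numVertices_explosion h, hE.card_treeHeads h]
  rfl

omit h in
theorem firstHead_succ (i : ℕ) : M.firstHead (M.treeHeads T) (t (i + 1)) =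
    M.firstHead (M.treeHeads T) (M.edge (t i)) := by
  rw [hE.succ, firstHead_explosion_rot]

/-- Look at the previous half-edge `t j`, whose mate lies at the vertex reached. Either this mate is
the head of the vertex, and its tail was met at time `j`; or it is a tail, met before its head `t j`
and at the same vertex, and the induction applies to it. -/
theorem index_edge_firstHead_lt {j : ℕ} (hj : j ≤ N)
    (hr : M.firstHead (M.treeHeads T) (t j) ≠ M.root) :
    hE.index (M.edge (M.firstHead (M.treeHeads T) (t j))) < j := by
  induction j using Nat.strong_induction_on with
  | _ j ih =>
    rcases j with _ | j
    · rw [hE.zero, firstHead_of_mem root_mem_treeHeads] at hr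
      exact absurd rfl hr
    · rw [hE.firstHead_succ] at hr ⊢
      by_cases hO : M.edge (t j) ∈ M.treeHeads T
      · rw [firstHead_of_mem hO, h.edge_edge, hE.index_apply (by omega)]
        omega
      · have hjr : t j ≠ M.root := by
          intro hjr
          rw [hjr, h.edge_root] at hO
          exact hO root_mem_treeHeads
        have hjO : t j ∈ M.treeHeads T := by
          by_contra hh
          exact hO ((h.edge_mem_treeHeads_iff hjr).2 hh)
        have h1 := hE.index_edge_lt h hjO hjr
        rw [hE.index_apply (by omega)] at h1
        have h2 := ih (hE.index (M.edge (t j))) (by omega) (hE.index_le _)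
          (by rwa [hE.apply_index])
        rw [hE.apply_index] at h2
        omega

/-- The contour reaches a new vertex exactly when it crosses an edge from tail to head. Crossing
from head to tail returns to the vertex of a tail met earlier. -/
theorem isDiscoveryTime_iff {k : ℕ} : (M.explosion (M.treeHeads T)).IsDiscoveryTime k ↔
    ∃ x ∈ M.treeHeads T, (x = M.root ∧ k = 0) ∨ (x ≠ M.root ∧ k = hE.index (M.edge x) + 1) := by
  simp only [IsDiscoveryTime, ← hE.eq_tour, explosion_sameVertex_iff]
  constructor
  · intro hk
    rcases k with _ | i
    · exact ⟨M.root, root_mem_treeHeads, .inl ⟨rfl, rfl⟩⟩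
    -- Discovery times are not bounded by definition; after a full turn every exploded vertex has
    -- been seen.
    · by_cases hiN : N ≤ i
      · have h1 := hE.index_le (M.firstHead (M.treeHeads T) (t (i + 1)))
        refine absurd ?_ (hk _ (Nat.lt_succ_of_le (h1.trans hiN)))
        rw [hE.apply_index, firstHead_of_mem (firstHead_mem h.exists_iterate_mem_treeHeads _)]
      · by_cases hO : t i ∈ M.treeHeads T
        · have h1 := (hE.mem_treeHeads_iff_index h).1 hO
          rw [hE.index_apply (by omega)] at h1
          refine absurd ?_ (hk _ (Nat.lt_succ_of_le h1))
          rw [hE.apply_index, hE.firstHead_succ]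
        · have hir : t i ≠ M.root := fun hh => hO (hh ▸ root_mem_treeHeads)
          refine ⟨M.edge (t i), (h.edge_mem_treeHeads_iff hir).2 hO, .inr
            ⟨h.edge_ne_root hir, ?_⟩⟩
          rw [h.edge_edge, hE.index_apply (by omega)]
  · rintro ⟨x, hx, ⟨-, rfl⟩ | ⟨hxr, rfl⟩⟩
    · intro j hj; omega
    · intro j hj hj'
      have hle := hE.index_le (M.edge x)
      rw [hE.firstHead_succ, hE.apply_index, h.edge_edge, firstHead_of_mem hx] at hj'
      have := hE.index_edge_firstHead_lt h (j := j) (by omega) (by rwa [hj'])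
      rw [hj'] at this
      omega

/-- The vertices of the exploded map in the order of their discovery, represented by their heads. -/
theorem exists_orderly_heads : ∃ f : Fin (M.numEdges + 1) → H,
    (∀ i, f i ∈ M.treeHeads T) ∧ (∀ x ∈ M.treeHeads T, ∃ i, f i = x) ∧
    (∀ i j, i < j → hE.index (M.edge (f i)) < hE.index (M.edge (f j))) ∧
    (∀ i : Fin (M.numEdges + 1), M.firstHead (M.treeHeads T)
      ((M.explosion (M.treeHeads T)).nthVertex i) = f i) ∧
    ∀ i j, M.explosionRel (M.treeHeads T) (M.numEdges + 1) i j ↔ M.SameVertex (f i) (f j) := by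
  classical
  set D := (M.explosion (M.treeHeads T)).IsDiscoveryTime with hD
  -- The discovery time of the vertex with head `x`: one step after its tail is met, or `0` for the
  -- root-vertex.
  let d : {x // x ∈ M.treeHeads T} → ℕ :=
    fun x => if x.1 = M.root then 0 else hE.index (M.edge x.1) + 1
  have hd : Function.Injective d := by
    rintro ⟨x, hx⟩ ⟨y, hy⟩ hxy
    simp only [d] at hxy
    split_ifs at hxy with h1 h2 h2
    · exact Subtype.ext (h1.trans h2.symm)
    · exact Subtype.ext (M.edge.injective (hE.index_injective (by simpa using hxy)))
  have hdD : Set.range d = {k | D k} := by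
    ext k
    rw [Set.mem_range, Set.mem_ofPred_eq, hD, hE.isDiscoveryTime_iff h]
    constructor
    · rintro ⟨⟨x, hx⟩, rfl⟩
      refine ⟨x, hx, ?_⟩
      by_cases hxr : x = M.root
      · exact .inl ⟨hxr, if_pos hxr⟩
      · exact .inr ⟨hxr, if_neg hxr⟩
    · rintro ⟨x, hx, ⟨hxr, rfl⟩ | ⟨hxr, rfl⟩⟩
      · exact ⟨⟨x, hx⟩, if_pos hxr⟩
      · exact ⟨⟨x, hx⟩, if_neg hxr⟩
  have hfin : {k | D k}.Finite := hdD ▸ Set.finite_range d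
  have hcard : hfin.toFinset.card = M.numEdges + 1 := by
    rw [← Set.ncard_eq_toFinset_card _ hfin, ← hdD, ← Set.image_univ,
      Set.ncard_image_of_injective _ hd, Set.ncard_univ, hE.card_treeHeads h]
  have hdf : ∀ x, M.firstHead (M.treeHeads T) (t (d x)) = x.1 := by
    rintro ⟨x, hx⟩
    simp only [d]
    split_ifs with hxr
    · rw [hE.zero, hxr, firstHead_of_mem root_mem_treeHeads]
    · rw [hE.firstHead_succ, hE.apply_index, h.edge_edge, firstHead_of_mem hx]
  have hdlt : ∀ x y, d x < d y → hE.index (M.edge x.1) < hE.index (M.edge y.1) := by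
    rintro ⟨x, hx⟩ ⟨y, hy⟩ hxy
    simp only [d] at hxy
    change hE.index (M.edge x) < hE.index (M.edge y)
    split_ifs at hxy with h1 h2 h2
    · omega
    · rw [h1, h.edge_root, hE.index_root, Nat.pos_iff_ne_zero, ← hE.index_root]
      exact hE.index_injective.ne (h.edge_ne_root h2)
    · omega
    · omega
  have hnth : ∀ i < M.numEdges + 1, ∃ x, d x = Nat.nth D i := by
    intro i hi
    have : Nat.nth D i ∈ {k | D k} := Nat.nth_mem_of_lt_card hfin (by rwa [hcard])
    rwa [← hdD] at this
  choose g hg using fun i : Fin (M.numEdges + 1) => hnth i i.2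
  have hfirst : ∀ i : Fin (M.numEdges + 1), M.firstHead (M.treeHeads T)
      ((M.explosion (M.treeHeads T)).nthVertex i) = (g i).1 := by
    intro i
    rw [nthVertex, ← hE.eq_tour, ← hD, ← hg, hdf]
  refine ⟨fun i => (g i).1, fun i => (g i).2, fun x hx => ?_, fun i j hij => ?_, hfirst,
    fun i j => ?_⟩
  · have hm : D (d ⟨x, hx⟩) := by
      have : d ⟨x, hx⟩ ∈ Set.range d := ⟨_, rfl⟩
      rwa [hdD] at this
    obtain ⟨i, hi, hix⟩ := Nat.exists_lt_card_finite_nth_eq hfin hm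
    refine ⟨⟨i, by rwa [hcard] at hi⟩, ?_⟩
    have := hg ⟨i, by rwa [hcard] at hi⟩
    rw [hix] at this
    exact congrArg Subtype.val (hd this)
  · refine hdlt _ _ ?_
    rw [hg, hg]
    exact Nat.nth_strictMonoOn hfin (by rw [hcard]; exact i.2) (by rw [hcard]; exact j.2) hij
  · have key : ∀ i : Fin (M.numEdges + 1),
        M.SameVertex ((M.explosion (M.treeHeads T)).nthVertex i) (g i).1 := by
      intro i
      rw [← hfirst]
      exact sameVertex_firstHead _
    change M.SameVertex _ _ ↔ _
    constructor
    · exact fun hh => ((key i).symm.trans hh).trans (key j)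
    · exact fun hh => ((key i).trans hh).trans (key j).symm

theorem isNonCrossing_explosionRel :
    IsNonCrossing (M.explosionRel (M.treeHeads T) (M.numEdges + 1)) := by
  obtain ⟨f, f1, -, f3, -, hrel⟩ := hE.exists_orderly_heads h
  intro a b c d hab hbc hcd hac hbd
  rw [hrel] at hac hbd ⊢
  have := hE.nonCrossing _ _ _ _ (f3 _ _ hab) (f3 _ _ hbc) (f3 _ _ hcd) (hE.index_le _)
  simp only [hE.apply_index, h.edge_edge] at this
  exact this (f1 _) (f1 _) (f1 _) (f1 _) hac hbd

end IsExplodedTour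

end MapData

/-! ### Invariance under isomorphism -/

theorem firstReturnTime_conj {H H' ι ι' : Type*} [Finite H] [Finite H'] {f : Equiv.Perm H}
    {g : Equiv.Perm H'} {p : H → ι} {q : H' → ι'} {e : H ≃ H'} (hfg : ∀ x, e (f x) = g (e x))
    (hpq : ∀ x y, q (e x) = q (e y) ↔ p x = p y) (x : H) :
    firstReturnTime g q (e x) = firstReturnTime f p x := by
  have hit : ∀ k, e (f^[k] x) = g^[k] (e x) := fun k =>
    (Function.Semiconj.iterate_right (f := e) hfg k) x
  have h1 := firstReturnTime_spec f p x
  have h2 := firstReturnTime_spec g q (e x)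
  refine le_antisymm (firstReturnTime_le _ _ _ h1.1 ?_) (firstReturnTime_le _ _ _ h2.1 ?_)
  · rw [← hit, hpq]; exact h1.2
  · rw [← hpq, hit]; exact h2.2

theorem firstReturn_conj {H H' ι ι' : Type*} [Finite H] [Finite H'] {f : Equiv.Perm H}
    {g : Equiv.Perm H'} {p : H → ι} {q : H' → ι'} {e : H ≃ H'} (hfg : ∀ x, e (f x) = g (e x))
    (hpq : ∀ x y, q (e x) = q (e y) ↔ p x = p y) (x : H) :
    e (firstReturn f p x) = firstReturn g q (e x) := by
  rw [firstReturn_apply, firstReturn_apply, firstReturnTime_conj hfg hpq]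
  exact (Function.Semiconj.iterate_right (f := e) hfg _) x

namespace MapData

variable {H H' : Type*} {M : MapData H} {N : MapData H'} {e : H ≃ H'}

namespace IsIso

variable (h : M.IsIso N e)

include h

theorem iterate_rot (k : ℕ) (x : H) : e (M.rot^[k] x) = N.rot^[k] (e x) :=
  (Function.Semiconj.iterate_right (f := e) h.rot k) x

theorem sameVertex_iff [Finite H] [Finite H'] {x y : H} :
    N.SameVertex (e x) (e y) ↔ M.SameVertex x y := by
  rw [SameVertex, SameVertex, sameCycle_iff_exists_iterate, sameCycle_iff_exists_iterate]
  simp only [← h.iterate_rot, e.injective.eq_iff]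

variable {T : Set H} {T' : Set H'} (hT : ∀ x, e x ∈ T' ↔ x ∈ T)

include hT

theorem tourStep (x : H) : e (M.tourStep T x) = N.tourStep T' (e x) := by
  by_cases hx : x ∈ T
  · simp [MapData.tourStep, hx, hT, h.rot, h.edge]
  · simp [MapData.tourStep, hx, hT, h.rot]

theorem tour (k : ℕ) : e (M.tour T k) = N.tour T' k := by
  rw [MapData.tour, MapData.tour, ← h.root]
  exact (Function.Semiconj.iterate_right (f := e) (h.tourStep hT) k) _

theorem precedes_iff {x y : H} : N.Precedes T' (e x) (e y) ↔ M.Precedes T x y := by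
  simp only [Precedes, ← h.tour hT, ne_eq, e.injective.eq_iff]

omit hT in
theorem joined {S : Set H} {S' : Set H'} (hS : ∀ x, x ∈ S → e x ∈ S') {x y : H}
    (hxy : M.Joined S x y) : N.Joined S' (e x) (e y) := by
  induction hxy with
  | rel x y hxy =>
    rcases hxy with rfl | ⟨hx, rfl⟩
    · exact .rel _ _ (.inl (h.rot x))
    · exact .rel _ _ (.inr ⟨hS x hx, h.edge x⟩)
  | refl => exact .refl _
  | symm _ _ _ ih => exact ih.symm
  | trans _ _ _ _ _ ih1 ih2 => exact ih1.trans _ _ _ ih2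

omit hT in
theorem joined_iff {S : Set H} {S' : Set H'} (hS : ∀ x, e x ∈ S' ↔ x ∈ S) {x y : H} :
    N.Joined S' (e x) (e y) ↔ M.Joined S x y := by
  refine ⟨fun hj => ?_, h.joined fun x hx => (hS x).2 hx⟩
  have := h.symm.joined (S' := S) (fun x hx => by rw [← hS, e.apply_symm_apply]; exact hx) hj
  simpa using this

theorem mem_treeHeads_iff (x : H) : e x ∈ N.treeHeads T' ↔ x ∈ M.treeHeads T := by
  simp only [treeHeads, Set.mem_ofPred_eq, ← h.root, e.injective.eq_iff, hT, ← h.edge,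
    h.precedes_iff hT]
  rw [h.joined_iff (S := T \ {x, M.edge x})]
  intro y
  simp [hT]

theorem firstHead (x : H) : e (M.firstHead T x) = N.firstHead T' (e x) := by
  classical
  have hiff : ∀ k, N.rot^[k] (e x) ∈ T' ↔ M.rot^[k] x ∈ T := fun k => by
    rw [← h.iterate_rot, hT]
  by_cases hk : ∃ k : ℕ, M.rot^[k] x ∈ T
  · have hk' : ∃ k : ℕ, N.rot^[k] (e x) ∈ T' := by simpa only [hiff] using hk
    rw [MapData.firstHead, MapData.firstHead, dif_pos hk, dif_pos hk', h.iterate_rot]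
    have : Nat.find hk = Nat.find hk' := Nat.find_congr' (fun {n} => (hiff n).symm)
    rw [this]
  · have hk' : ¬ ∃ k : ℕ, N.rot^[k] (e x) ∈ T' := by simpa only [hiff] using hk
    rw [MapData.firstHead, MapData.firstHead, dif_neg hk, dif_neg hk']

theorem explosion [Finite H] [Finite H'] : (M.explosion T).IsIso (N.explosion T') e where
  rot x := by
    refine firstReturn_conj h.rot (fun x y => ?_) x
    rw [← h.firstHead hT, ← h.firstHead hT, e.injective.eq_iff]
  edge := h.edge
  root := h.root

omit hT in
theorem nthVertex [Finite H] [Finite H'] (i : ℕ) : e (M.nthVertex i) = N.nthVertex i := by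
  have hu : ∀ x, e x ∈ (Set.univ : Set H') ↔ x ∈ (Set.univ : Set H) := by simp
  have hD : N.IsDiscoveryTime = M.IsDiscoveryTime := by
    funext k
    simp only [IsDiscoveryTime, ← h.tour hu, h.sameVertex_iff]
  rw [MapData.nthVertex, MapData.nthVertex, h.tour hu, hD]

theorem explosionRel_eq [Finite H] [Finite H'] (m : ℕ) :
    N.explosionRel T' m = M.explosionRel T m := by
  ext i j
  change N.SameVertex _ _ ↔ M.SameVertex _ _
  rw [← h.sameVertex_iff, (h.explosion hT).nthVertex, (h.explosion hT).nthVertex]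

end IsIso

/-! ### The cyclic order of the heads around a vertex -/

theorem exists_iterate_eq_firstHead {O : Set H} (hO : ∀ x, ∃ k : ℕ, M.rot^[k] x ∈ O) (x : H) :
    ∃ m, M.firstHead O x = M.rot^[m] x ∧ ∀ j < m, M.rot^[j] x ∉ O := by
  classical
  refine ⟨Nat.find (hO x), ?_, fun j hj => Nat.find_min (hO x) hj⟩
  rw [firstHead, dif_pos (hO x)]

namespace IsTreeTour

variable {T : Set H} {n : ℕ} {pos : H → ℕ} (h : M.IsTreeTour T n pos)

include h

theorem headRank_tour_succ {k : ℕ} (hk : k ≤ n) :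
    M.headRank n pos (M.tour T (k + 1)) = k + 1 := by
  rcases Nat.eq_or_lt_of_le hk with rfl | hk
  · rw [h.tour_period, headRank_root]
  · have hp := h.pos_tour (k + 1) hk
    rw [headRank_of_ne, hp]
    intro hr
    rw [hr, h.pos_root] at hp
    omega

variable [Finite H]

/-- Between `x` and the next half-edge at its vertex, the tour makes at most an excursion across the
tree edge of `x`, and this excursion contains no half-edge of that vertex. -/
theorem headRank_lt_rot {x : H} (hx : x ≠ M.root) (hT : x ∈ T → x ∉ M.treeHeads T) :
    M.headRank n pos x < M.headRank n pos (M.rot x) ∧ ∀ z, M.SameVertex x z →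
      M.headRank n pos x < M.headRank n pos z →
        M.headRank n pos (M.rot x) ≤ M.headRank n pos z := by
  rw [headRank_of_ne hx]
  by_cases hxT : x ∈ T
  · have hO := hT hxT
    rw [h.mem_treeHeads_iff] at hO
    have hne := h.pos_edge_ne hx
    have hlt : pos x < pos (M.edge x) := by
      simp only [hx, hxT, true_and, false_or, not_true, false_and, or_false] at hO
      omega
    rw [h.rot_of_mem hxT, h.headRank_tour_succ (h.pos_le _)]
    refine ⟨by omega, fun z hz hlt' => ?_⟩
    have := h.between_sameVertex hxT hlt hz
    by_cases hzr : z = M.root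
    · rw [hzr, headRank_root]
      have := h.pos_le (M.edge x)
      omega
    · rw [headRank_of_ne hzr] at hlt' ⊢
      omega
  · rw [h.rot_of_notMem hxT, h.headRank_tour_succ (h.pos_le _)]
    exact ⟨by omega, fun z _ hlt' => hlt'⟩

/-- All half-edges of a vertex are met between the two halves of the tree edge leading to it, so the
head of that edge comes last and its successor first. At the root-vertex the rank `N + 1` gives the
root this role. -/
theorem headRank_le_of_last {x : H} (hx : x = M.root ∨ x ∈ T ∧ x ∈ M.treeHeads T) {z : H}
    (hz : M.SameVertex x z) : M.headRank n pos (M.rot x) ≤ M.headRank n pos z ∧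
      M.headRank n pos z ≤ M.headRank n pos x := by
  by_cases hxr : x = M.root
  · rw [hxr, headRank_root]
    refine ⟨?_, h.headRank_le z⟩
    have h1 : M.rot M.root = M.tour T (0 + 1) := by
      rw [h.rot_of_mem h.root_mem, h.edge_root, h.pos_root]
    rw [h1, h.headRank_tour_succ (Nat.zero_le _)]
    by_cases hzr : z = M.root
    · rw [hzr, headRank_root]; omega
    · rw [headRank_of_ne hzr]
      exact h.pos_pos hzr
  · obtain ⟨hxT, hxO⟩ := hx.resolve_left hxr
    have hlt : pos (M.edge x) < pos x := by
      rw [h.mem_treeHeads_iff] at hxO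
      simpa [hxr, hxT] using hxO
    have := h.between_sameVertex ((h.edge_mem x).2 hxT) (by rwa [h.edge_edge]) hz
    rw [h.edge_edge] at this
    have hz' := this.1 ⟨hlt, le_rfl⟩
    have hzr : z ≠ M.root := by
      rintro rfl
      rw [h.pos_root] at hz'
      omega
    rw [h.rot_of_mem hxT, h.headRank_tour_succ (h.pos_le _), headRank_of_ne hxr,
      headRank_of_ne hzr]
    omega

/-- The head that follows `x` around its vertex is the next one for `headRank`, cyclically. -/
theorem nextHead_spec (x : H) :
    (M.headRank n pos x < M.headRank n pos (M.firstHead (M.treeHeads T) (M.rot x)) ∧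
      ∀ z ∈ M.treeHeads T, M.SameVertex x z → M.headRank n pos x < M.headRank n pos z →
        M.headRank n pos (M.firstHead (M.treeHeads T) (M.rot x)) ≤ M.headRank n pos z) ∨
    ∀ z ∈ M.treeHeads T, M.SameVertex x z →
      M.headRank n pos (M.firstHead (M.treeHeads T) (M.rot x)) ≤ M.headRank n pos z ∧
        M.headRank n pos z ≤ M.headRank n pos x := by
  obtain ⟨m, hm, hm'⟩ := exists_iterate_eq_firstHead h.exists_iterate_mem_treeHeads (M.rot x)
  have hxr : M.SameVertex x (M.rot x) := sameVertex_iterate x 1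
  have key : ∀ j ≤ m, M.headRank n pos (M.rot x) ≤ M.headRank n pos (M.rot^[j] (M.rot x)) ∧
      ∀ z ∈ M.treeHeads T, M.SameVertex x z → M.headRank n pos (M.rot x) ≤ M.headRank n pos z →
        M.headRank n pos (M.rot^[j] (M.rot x)) ≤ M.headRank n pos z := by
    intro j
    induction j with
    | zero => intro _; exact ⟨le_rfl, fun z _ _ hz => hz⟩
    | succ j ih =>
      intro hj
      obtain ⟨i1, i2⟩ := ih (by omega)
      have hO := hm' j (by omega)
      have hs : M.SameVertex x (M.rot^[j] (M.rot x)) := hxr.trans (sameVertex_iterate _ _)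
      rw [Function.iterate_succ_apply']
      set w := M.rot^[j] (M.rot x)
      have hwr : w ≠ M.root := fun hh => hO (hh ▸ root_mem_treeHeads)
      obtain ⟨r1, r2⟩ := h.headRank_lt_rot hwr (fun _ => hO)
      refine ⟨by omega, fun z hz hxz hlt => r2 z (hs.symm.trans hxz) ?_⟩
      refine lt_of_le_of_ne (i2 z hz hxz hlt) (h.headRank_injective.ne ?_)
      rintro rfl
      exact hO hz
  obtain ⟨k1, k2⟩ := key m le_rfl
  rw [hm]
  by_cases hlast : x = M.root ∨ x ∈ T ∧ x ∈ M.treeHeads T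
  · right
    intro z hz hxz
    obtain ⟨l1, l2⟩ := h.headRank_le_of_last hlast hxz
    exact ⟨k2 z hz hxz l1, l2⟩
  · left
    rw [not_or] at hlast
    obtain ⟨r1, r2⟩ := h.headRank_lt_rot hlast.1 fun h1 h2 => hlast.2 ⟨h1, h2⟩
    exact ⟨by omega, fun z hz hxz hlt => k2 z hz hxz (r2 z hxz hlt)⟩

end IsTreeTour

/-! ### Recovering the map from the tree and the partition -/

section Injectivity

variable [Finite H] [Finite H'] {T : Set H} {T' : Set H'} {n : ℕ} {pos : H → ℕ} {pos' : H' → ℕ}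
  {t : ℕ → H} {t' : ℕ → H'}

/-- At one vertex of `M` the rank order is the reverse of the discovery order, hence it is visible
in the exploded map. -/
theorem IsExplodedTour.headRank_lt_iff (hE : M.IsExplodedTour T n pos t)
    (h : M.IsTreeTour T n pos) {x y : H} (hx : x ∈ M.treeHeads T) (hy : y ∈ M.treeHeads T)
    (hxy : M.SameVertex x y) : M.headRank n pos x < M.headRank n pos y ↔
      hE.index (M.edge y) < hE.index (M.edge x) := by
  have key : ∀ x y, x ∈ M.treeHeads T → y ∈ M.treeHeads T → M.SameVertex x y →
      hE.index (M.edge y) < hE.index (M.edge x) →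
      M.headRank n pos x < M.headRank n pos y := by
    intro x y hx hy hxy hlt
    have := hE.headRank_lt _ _ hlt (hE.index_le _)
    simp only [hE.apply_index, h.edge_edge] at this
    exact this hy hx hxy.symm
  refine ⟨fun hlt => ?_, key x y hx hy hxy⟩
  by_contra hc
  rcases Nat.eq_or_lt_of_le (not_lt.1 hc) with heq | hlt'
  · have := M.edge.injective (hE.index_injective heq)
    subst this
    exact lt_irrefl _ hlt
  · exact absurd (key y x hy hx hxy.symm hlt') hlt.asymm

/-- At a tail the rotation is that of the exploded map. At a head `g` it is the exploded rotation
applied to the next head around the vertex of `M`, and that head is determined by the partition and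
the discovery order. -/
theorem isIso_of_explosion (h : M.IsTreeTour T n pos) (hE : M.IsExplodedTour T n pos t)
    (h' : N.IsTreeTour T' n pos') (hE' : N.IsExplodedTour T' n pos' t')
    (he : (M.explosion (M.treeHeads T)).IsIso (N.explosion (N.treeHeads T')) e)
    (hnum : M.numEdges = N.numEdges)
    (hrel : N.explosionRel (N.treeHeads T') (M.numEdges + 1) =
      M.explosionRel (M.treeHeads T) (M.numEdges + 1)) :
    M.IsIso N e ∧ ∀ x, e x ∈ T' ↔ x ∈ T := by
  have hu : ∀ x, e x ∈ (Set.univ : Set H') ↔ x ∈ (Set.univ : Set H) := by simp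
  have hedge : ∀ x, e (M.edge x) = N.edge (e x) := he.edge
  have hroot : e M.root = N.root := he.root
  have ht : ∀ i, e (t i) = t' i := fun i => by rw [hE.eq_tour, hE'.eq_tour, he.tour hu]
  have hidx : ∀ x, hE'.index (e x) = hE.index x := by
    intro x
    conv_lhs => rw [← hE.apply_index x, ht]
    exact hE'.index_apply (hE.index_le _)
  have hO : ∀ x, e x ∈ N.treeHeads T' ↔ x ∈ M.treeHeads T := by
    intro x
    rw [hE.mem_treeHeads_iff_index h, hE'.mem_treeHeads_iff_index h', ← hedge, hidx, hidx]
  have hfh : ∀ x, e (M.firstHead (M.treeHeads T) x) = N.firstHead (N.treeHeads T') (e x) := by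
    intro x
    have hx := firstHead_mem h.exists_iterate_mem_treeHeads x
    have h1 : (M.explosion (M.treeHeads T)).SameVertex (M.firstHead (M.treeHeads T) x) x :=
      explosion_sameVertex_iff.2 (firstHead_of_mem hx)
    rw [← he.sameVertex_iff, explosion_sameVertex_iff, firstHead_of_mem ((hO _).2 hx)] at h1
    exact h1
  have hsv : ∀ x ∈ M.treeHeads T, ∀ y ∈ M.treeHeads T,
      (N.SameVertex (e x) (e y) ↔ M.SameVertex x y) := by
    obtain ⟨f, f1, f2, -, f4, f5⟩ := hE.exists_orderly_heads h
    have hf' := hE'.exists_orderly_heads h'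
    rw [← hnum] at hf'
    obtain ⟨f', -, -, -, f4', f5'⟩ := hf'
    have hf : ∀ i, f' i = e (f i) := by
      intro i
      rw [← f4', ← he.nthVertex, ← hfh, f4]
    intro x hx y hy
    obtain ⟨i, rfl⟩ := f2 x hx
    obtain ⟨j, rfl⟩ := f2 y hy
    rw [← hf, ← hf, ← f5, ← f5', hrel]
  have hrank : ∀ x ∈ M.treeHeads T, ∀ y ∈ M.treeHeads T, M.SameVertex x y →
      (N.headRank n pos' (e x) < N.headRank n pos' (e y) ↔
        M.headRank n pos x < M.headRank n pos y) := by
    intro x hx y hy hxy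
    rw [hE.headRank_lt_iff h hx hy hxy, hE'.headRank_lt_iff h' ((hO x).2 hx) ((hO y).2 hy)
      ((hsv x hx y hy).2 hxy), ← hedge, ← hedge, hidx, hidx]
  -- Both sides are the cyclic successor of the same head for the same order; injectivity of the
  -- rank identifies them.
  have hnext : ∀ x ∈ M.treeHeads T, e (M.firstHead (M.treeHeads T) (M.rot x)) =
      N.firstHead (N.treeHeads T') (N.rot (e x)) := by
    intro x hx
    have s1 := h.nextHead_spec x
    have s2 := h'.nextHead_spec (e x)
    have v1 : M.SameVertex x (M.firstHead (M.treeHeads T) (M.rot x)) :=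
      (sameVertex_iterate x 1).trans (sameVertex_firstHead _)
    have v2 : N.SameVertex (e x) (N.firstHead (N.treeHeads T') (N.rot (e x))) :=
      (sameVertex_iterate (e x) 1).trans (sameVertex_firstHead _)
    have m1 := firstHead_mem h.exists_iterate_mem_treeHeads (M.rot x)
    have m2 := firstHead_mem h'.exists_iterate_mem_treeHeads (N.rot (e x))
    set g := M.firstHead (M.treeHeads T) (M.rot x)
    obtain ⟨g', hg'⟩ := e.surjective (N.firstHead (N.treeHeads T') (N.rot (e x)))
    rw [← hg'] at s2 v2 m2 ⊢
    rw [hO] at m2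
    rw [hsv x hx g' m2] at v2
    have r1 := hrank x hx g' m2 v2
    have r3 := hrank g m1 g' m2 (v1.symm.trans v2)
    have r4 := hrank g' m2 g m1 (v2.symm.trans v1)
    have r5 := hrank x hx g m1 v1
    have a1 : ∀ s : H' → Prop, (∀ z ∈ N.treeHeads T', N.SameVertex (e x) z → s z) → s (e g) :=
      fun s hs => hs (e g) ((hO g).2 m1) ((hsv x hx g m1).2 v1)
    refine congrArg e (h.headRank_injective ?_)
    rcases s1 with ⟨s11, s12⟩ | s1
    · have s12 := s12 g' m2 v2
      rcases s2 with ⟨s21, s22⟩ | s2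
      · have s22 := a1 _ s22
        omega
      · have s2 := a1 _ s2
        omega
    · have s1' := s1 g' m2 v2
      rcases s2 with ⟨s21, s22⟩ | s2
      · omega
      · have s2 := a1 _ s2
        omega
  have hrot : ∀ x, e (M.rot x) = N.rot (e x) := by
    intro x
    by_cases hx : x ∈ M.treeHeads T
    · rw [← explosion_rot_of_mem h.exists_iterate_mem_treeHeads hx, he.rot, hnext x hx,
        explosion_rot_of_mem h'.exists_iterate_mem_treeHeads ((hO x).2 hx)]
    · rw [← explosion_rot_of_notMem h.exists_iterate_mem_treeHeads hx, he.rot,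
        explosion_rot_of_notMem h'.exists_iterate_mem_treeHeads (mt (hO x).1 hx)]
  refine ⟨⟨hrot, hedge, hroot⟩, ?_⟩
  -- The next step of the tour needs only membership in `T` of the current half-edge. At a second
  -- visit it is inherited from the mate; at a first visit, away from the root, membership means
  -- being a tail.
  have key : ∀ k ≤ n, e (M.tour T k) = N.tour T' k ∧
      (N.tour T' k ∈ T' ↔ M.tour T k ∈ T) := by
    intro k
    induction k using Nat.strong_induction_on with
    | _ k ih =>
      intro hk
      have h1 : e (M.tour T k) = N.tour T' k := by
        rcases k with _ | k
        · exact hroot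
        · obtain ⟨i1, i2⟩ := ih k (by omega) (by omega)
          rw [tour, tour, Function.iterate_succ_apply', Function.iterate_succ_apply']
          change e (M.tourStep T (M.tour T k)) = N.tourStep T' (N.tour T' k)
          by_cases hm : M.tour T k ∈ T
          · rw [tourStep, tourStep, if_pos hm, if_pos (i2.2 hm), hrot, hedge, i1]
          · rw [tourStep, tourStep, if_neg hm, if_neg (mt i2.1 hm), hrot, i1]
      refine ⟨h1, ?_⟩
      rw [← h1]
      have hp := h.pos_tour k hk
      have hp' := h'.pos_tour k hk
      rw [← h1] at hp'
      set x := M.tour T k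
      by_cases hxr : x = M.root
      · rw [hxr, hroot]
        exact iff_of_true h'.root_mem h.root_mem
      have hxr' : e x ≠ N.root := by rw [← hroot]; exact e.injective.ne hxr
      rcases Nat.lt_or_gt_of_ne (h.pos_edge_ne hxr) with hlt | hlt
      · obtain ⟨i1, i2⟩ := ih (pos (M.edge x)) (by omega) (h.pos_le _)
        rw [← i1, h.tour_pos, hedge, h'.edge_mem, h.edge_mem] at i2
        exact i2
      · have hlt' : pos' (e x) < pos' (N.edge (e x)) := by
          by_contra hc
          have hne := h'.pos_edge_ne hxr'
          obtain ⟨i1, -⟩ := ih (pos' (N.edge (e x))) (by omega) (h'.pos_le _)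
          rw [h'.tour_pos, ← hedge] at i1
          have := h.pos_tour (pos' (e (M.edge x))) (h'.pos_le _)
          rw [e.injective i1, hedge] at this
          omega
        have c1 := h.mem_treeHeads_iff (x := x)
        have c2 := h'.mem_treeHeads_iff (x := e x)
        rw [hO] at c2
        simp only [hxr, false_or] at c1
        simp only [hxr', false_or] at c2
        have c3 : ¬ pos (M.edge x) < pos x := by omega
        have c4 : ¬ pos' (N.edge (e x)) < pos' (e x) := by omega
        simp only [c3, hlt, and_false, and_true, false_or] at c1
        simp only [c4, hlt', and_false, and_true, false_or] at c2
        rw [c1] at c2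
        exact (not_iff_not.1 c2).symm
  intro x
  have := key (pos x) (h.pos_le x)
  rw [← this.1, h.tour_pos] at this
  exact this.2

end Injectivity

end MapData

/-! ### Non-crossing matchings and their Dyck words -/

/-- `f` is a non-crossing perfect matching of `{0, …, m - 1}`. -/
structure IsNonCrossingMatching (m : ℕ) (f : ℕ → ℕ) : Prop where
  lt : ∀ i < m, f i < m
  apply_apply : ∀ i < m, f (f i) = i
  ne : ∀ i < m, f i ≠ i
  nested : ∀ i j, i < m → i < j → j < f i → i < f j ∧ f j < f i

/-- The sequence of openers and closers of `f`. -/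
def matchingWord (m : ℕ) (f : ℕ → ℕ) : List DyckStep :=
  (List.range m).map fun i => if i < f i then .U else .D

namespace IsNonCrossingMatching

variable {m : ℕ} {f g : ℕ → ℕ}

theorem count_U (m : ℕ) (f : ℕ → ℕ) :
    (matchingWord m f).count .U = ((Finset.range m).filter fun i => i < f i).card := by
  induction m with
  | zero => simp [matchingWord]
  | succ m ih =>
    rw [Finset.range_add_one, Finset.filter_insert]
    simp only [matchingWord] at ih
    simp only [matchingWord, List.range_succ, List.map_append, List.count_append, ih, List.map_cons,
      List.map_nil]
    split_ifs with h <;> simp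

theorem count_D (m : ℕ) (f : ℕ → ℕ) :
    (matchingWord m f).count .D = ((Finset.range m).filter fun i => ¬ i < f i).card := by
  induction m with
  | zero => simp [matchingWord]
  | succ m ih =>
    rw [Finset.range_add_one, Finset.filter_insert]
    simp only [matchingWord] at ih
    simp only [matchingWord, List.range_succ, List.map_append, List.count_append, ih, List.map_cons,
      List.map_nil]
    split_ifs with h <;> simp

variable (hf : IsNonCrossingMatching m f)

include hf

/-- The partner of a closer below `k` is an opener below `k`, so `f` injects closers into openers on
every prefix. -/
theorem card_closers_le {k : ℕ} (hk : k ≤ m) :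
    ((Finset.range k).filter fun i => ¬ i < f i).card ≤
      ((Finset.range k).filter fun i => i < f i).card := by
  refine Finset.card_le_card_of_injOn f ?_ ?_
  · intro i hi
    simp only [Finset.coe_filter, Finset.mem_range, Set.mem_ofPred_eq] at hi ⊢
    have h1 := hf.apply_apply i (by omega)
    have h2 := hf.ne i (by omega)
    omega
  · intro i hi j hj hij
    simp only [Finset.coe_filter, Finset.mem_range, Set.mem_ofPred_eq] at hi hj
    rw [← hf.apply_apply i (by omega), hij, hf.apply_apply j (by omega)]

theorem card_openers_le :
    ((Finset.range m).filter fun i => i < f i).card ≤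
      ((Finset.range m).filter fun i => ¬ i < f i).card := by
  refine Finset.card_le_card_of_injOn f ?_ ?_
  · intro i hi
    simp only [Finset.coe_filter, Finset.mem_range, Set.mem_ofPred_eq] at hi ⊢
    have h1 := hf.apply_apply i (by omega)
    have h2 := hf.lt i (by omega)
    omega
  · intro i hi j hj hij
    simp only [Finset.coe_filter, Finset.mem_range, Set.mem_ofPred_eq] at hi hj
    rw [← hf.apply_apply i (by omega), hij, hf.apply_apply j (by omega)]

/-- The Dyck word of a non-crossing matching. -/
def dyckWord : DyckWord where
  toList := matchingWord m f
  count_U_eq_count_D := by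
    rw [count_U, count_D]
    exact le_antisymm hf.card_openers_le (hf.card_closers_le le_rfl)
  count_D_le_count_U i := by
    have : (matchingWord m f).take i = matchingWord (min i m) f := by
      rw [matchingWord, ← List.map_take, List.take_range, matchingWord]
    rw [this, count_U, count_D]
    exact hf.card_closers_le (min_le_right _ _)

theorem two_mul_semilength_dyckWord : 2 * hf.dyckWord.semilength = m := by
  rw [DyckWord.two_mul_semilength_eq_length]
  simp [dyckWord, matchingWord]

/-- Take the first closer `j` where the matchings differ, with `f j < g j`. The opener `g j` is
nested under `f` in the pair of `j`, so its `f`-partner is a closer before `j`. There `f` and `g`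
agree, so this closer is also the `g`-partner of `g j`, which is `j`: a contradiction. -/
theorem apply_eq_of_openers (hg : IsNonCrossingMatching m g) (h : ∀ i < m, i < f i ↔ i < g i) :
    ∀ i < m, f i = g i := by
  have key : ∀ {f g : ℕ → ℕ}, IsNonCrossingMatching m f → IsNonCrossingMatching m g →
      (∀ i < m, i < f i ↔ i < g i) → ∀ j < m, ¬ j < f j → (∀ i < j, ¬ i < f i → f i = g i) →
      ¬ f j < g j := by
    intro f g hf hg h j hj hjf ih hlt
    have hjg : ¬ j < g j := mt (h j hj).2 hjf
    have n1 := hf.ne j hj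
    have n2 := hg.ne j hj
    have hi := hg.lt j hj
    have hop : g j < f (g j) := by
      rw [h _ hi, hg.apply_apply j hj]
      omega
    have h1 := hf.nested (f j) (g j) (by omega) hlt (by rw [hf.apply_apply j hj]; omega)
    rw [hf.apply_apply j hj] at h1
    have hff := hf.apply_apply (g j) hi
    have h2 := ih (f (g j)) h1.2 (by omega)
    rw [hff] at h2
    have h3 := hg.apply_apply (f (g j)) (by omega)
    rw [← h2, hg.apply_apply j hj] at h3
    omega
  have closers : ∀ j, j < m → ¬ j < f j → f j = g j := by
    intro j
    induction j using Nat.strong_induction_on with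
    | _ j ih =>
      intro hj hjf
      have h1 := key hf hg h j hj hjf (fun i hij hif => ih i hij (by omega) hif)
      have h2 := key hg hf (fun i hi => (h i hi).symm) j hj (mt (h j hj).2 hjf)
        (fun i hij hif => (ih i hij (by omega) (mt (h i (by omega)).1 hif)).symm)
      omega
  intro i hi
  by_cases hif : i < f i
  · have h1 := closers (f i) (hf.lt i hi) (by rw [hf.apply_apply i hi]; omega)
    rw [hf.apply_apply i hi] at h1
    have h2 := hg.apply_apply (f i) (hf.lt i hi)
    rw [← h1] at h2
    exact h2.symm
  · exact closers i hi hif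

theorem apply_eq_of_dyckWord_eq (hg : IsNonCrossingMatching m g)
    (h : hf.dyckWord = hg.dyckWord) : ∀ i < m, f i = g i := by
  refine hf.apply_eq_of_openers hg fun i hi => ?_
  have h1 : matchingWord m f = matchingWord m g := congrArg DyckWord.toList h
  have h2 := congrArg (fun l => l[i]?) h1
  simp only [matchingWord, List.getElem?_map, List.getElem?_range hi, Option.map_some,
    Option.some.injEq] at h2
  split_ifs at h2 with h3 h4 h4
  · exact iff_of_true h3 h4
  · exact iff_of_false h3 h4

end IsNonCrossingMatching

/-! ### Plane trees are encoded by Dyck words -/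

namespace MapData

variable {H H' : Type*} {M : MapData H} {N : MapData H'}

/-- The root occupies time `0` and is unmatched, whence the shift by one. -/
theorem IsTreeTour.isNonCrossingMatching {n : ℕ} {pos : H → ℕ}
    (h : M.IsTreeTour Set.univ n pos) :
    IsNonCrossingMatching n fun i => pos (M.edge (M.tour Set.univ (i + 1))) - 1 := by
  have hne : ∀ i < n, M.tour Set.univ (i + 1) ≠ M.root := by
    intro i hi hr
    have := h.pos_tour (i + 1) hi
    rw [hr, h.pos_root] at this
    omega
  have hpos : ∀ i < n, 0 < pos (M.edge (M.tour Set.univ (i + 1))) :=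
    fun i hi => h.pos_pos (h.edge_ne_root (hne i hi))
  have hle : ∀ i, pos (M.edge (M.tour Set.univ (i + 1))) ≤ n := fun i => h.pos_le _
  have htour : ∀ i < n, M.tour Set.univ (pos (M.edge (M.tour Set.univ (i + 1))) - 1 + 1) =
      M.edge (M.tour Set.univ (i + 1)) := by
    intro i hi
    rw [Nat.sub_add_cancel (hpos i hi), h.tour_pos]
  refine ⟨fun i hi => ?_, fun i hi => ?_, fun i hi => ?_, fun i j hi hij hji => ?_⟩
  · have := hpos i hi
    have := hle i
    omega
  · rw [htour i hi, h.edge_edge, h.pos_tour (i + 1) hi]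
    rfl
  · have := hpos i hi
    have h1 := h.pos_edge_ne (hne i hi)
    rw [h.pos_tour (i + 1) hi] at h1
    omega
  · have hj : j < n := by have := hle i; omega
    have p1 := h.pos_tour (i + 1) hi
    have p2 := h.pos_tour (j + 1) hj
    have h1 := h.between_edge (M.tour Set.univ (i + 1)) (by omega) (M.tour Set.univ (j + 1))
      (by simp) (by intro hh; rw [hh] at p2; omega) (by intro hh; rw [← hh] at hji; omega)
    have h2 : pos (M.edge (M.tour Set.univ (j + 1))) ≠ pos (M.edge (M.tour Set.univ (i + 1))) := by
      intro hh
      have := M.edge.injective (h.pos_injective hh)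
      rw [this] at p2
      omega
    have := hpos j hj
    omega

theorem IsTreeTour.exists_isIso {n : ℕ} {pos : H → ℕ} {pos' : H' → ℕ}
    (h : M.IsTreeTour Set.univ n pos) (h' : N.IsTreeTour Set.univ n pos')
    (heq : ∀ k ≤ n, pos (M.edge (M.tour Set.univ k)) = pos' (N.edge (N.tour Set.univ k))) :
    ∃ e, M.IsIso N e := by
  let e : H ≃ H' :=
    { toFun := fun x => N.tour Set.univ (pos x)
      invFun := fun x => M.tour Set.univ (pos' x)
      left_inv := fun x => by dsimp only; rw [h'.pos_tour _ (h.pos_le x), h.tour_pos]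
      right_inv := fun x => by dsimp only; rw [h.pos_tour _ (h'.pos_le x), h'.tour_pos] }
  have he : ∀ x, e x = N.tour Set.univ (pos x) := fun _ => rfl
  have hedge : ∀ x, e (M.edge x) = N.edge (e x) := by
    intro x
    have := heq (pos x) (h.pos_le x)
    rw [h.tour_pos] at this
    rw [he, he, this, h'.tour_pos]
  have hpos : ∀ x, pos' (e x) = pos x := fun x => h'.pos_tour _ (h.pos_le x)
  have hroot : e M.root = N.root := by rw [he, h.pos_root]; rfl
  refine ⟨e, fun x => ?_, hedge, hroot⟩
  rw [h.rot_of_mem (Set.mem_univ x), h'.rot_of_mem (Set.mem_univ _), ← hedge, hpos]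
  rcases Nat.eq_or_lt_of_le (h.pos_le (M.edge x)) with heq | hlt
  · rw [heq, h.tour_period, h'.tour_period, hroot]
  · rw [he, h.pos_tour _ hlt]

end MapData

/-- The Dyck word of a plane tree. -/
theorem exists_planeTree_injective (n : ℕ) :
    ∃ f : PlaneTree n → {p : DyckWord // p.semilength = n}, Function.Injective f := by
  have hpos : ∀ M : LabelledPlaneTree n, ∃ pos, M.1.IsTreeTour Set.univ (2 * n) pos := by
    intro M
    have := M.2.exists_isTreeTour
    simpa using this
  choose pos hpos using hpos
  have hw := fun M => (hpos M).isNonCrossingMatching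
  -- Only injectivity is needed, so arbitrary representatives are enough.
  refine ⟨fun q => ⟨(hw q.out).dyckWord, ?_⟩, fun q q' hq => ?_⟩
  · have := (hw q.out).two_mul_semilength_dyckWord
    omega
  · rw [← Quotient.out_eq q, ← Quotient.out_eq q']
    refine Quotient.sound ?_
    have h1 := (hw q.out).apply_eq_of_dyckWord_eq (hw q'.out) (congrArg Subtype.val hq)
    refine (hpos q.out).exists_isIso (hpos q'.out) fun k hk => ?_
    rcases k with _ | k
    · change pos q.out (q.out.1.edge q.out.1.root) = pos q'.out (q'.out.1.edge q'.out.1.root)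
      rw [(hpos _).edge_root, (hpos _).edge_root, (hpos _).pos_root, (hpos _).pos_root]
    · have h2 := h1 k (by omega)
      have hp : ∀ M : LabelledPlaneTree n, 0 < pos M (M.1.edge (M.1.tour Set.univ (k + 1))) := by
        intro M
        refine (hpos M).pos_pos ((hpos M).edge_ne_root fun hh => ?_)
        have := (hpos M).pos_tour (k + 1) hk
        rw [hh, (hpos M).pos_root] at this
        omega
      have := hp q.out
      have := hp q'.out
      omega

theorem planeTree_finite (n : ℕ) : Finite (PlaneTree n) := by
  obtain ⟨f, hf⟩ := exists_planeTree_injective n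
  exact Finite.of_injective f hf

theorem card_planeTree_le (n : ℕ) : Nat.card (PlaneTree n) ≤ catalan n := by
  obtain ⟨f, hf⟩ := exists_planeTree_injective n
  rw [← DyckWord.card_dyckWord_semilength_eq_catalan, ← Nat.card_eq_fintype_card]
  exact Nat.card_le_card_of_injective f hf

/-! ### Non-crossing partitions and the Catalan recurrence -/

theorem nonCrossingPartition_finite (m : ℕ) : Finite (NonCrossingPartition m) := by
  refine Finite.of_injective (fun r : NonCrossingPartition m => fun a b => r.1 a b) ?_
  intro r r' h
  exact Subtype.ext (Setoid.ext fun a b => iff_of_eq (congrFun (congrFun h a) b))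

/-- The restriction of a non-crossing partition to the image of an increasing map. -/
def NonCrossingPartition.comap {l m : ℕ} (f : Fin l → Fin m) (hf : StrictMono f)
    (r : NonCrossingPartition m) : NonCrossingPartition l :=
  ⟨r.1.comap f, fun a b c d hab hbc hcd hac hbd =>
    r.2 (f a) (f b) (f c) (f d) (hf hab) (hf hbc) (hf hcd) hac hbd⟩

/-- Let `j` be the last element of the block of `0`. The partition is determined by its restrictions
to `1, …, j` and to the elements after `j`: the block of `0` is read from that of `j`, and no block
joins the two ranges. The sizes `j` and `m - j` give the recurrence of `catalan`. -/
theorem card_nonCrossingPartition_le (m : ℕ) : Nat.card (NonCrossingPartition m) ≤ catalan m := by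
  classical
  induction m using Nat.strong_induction_on with
  | _ m ih =>
  have hfin := nonCrossingPartition_finite
  rcases m with _ | m
  · rw [catalan_zero, Finite.card_le_one_iff_subsingleton]
    exact ⟨fun r r' => Subtype.ext (Setoid.ext fun a => a.elim0)⟩
  have hlast : ∀ r : NonCrossingPartition (m + 1), ∃ j, r.1 0 j ∧ ∀ y, r.1 0 y → y ≤ j := by
    intro r
    obtain ⟨j, hj, hj'⟩ := Finset.exists_max_image (Finset.univ.filter fun y => r.1 0 y) id
      ⟨0, by simp⟩
    exact ⟨j, by simpa using hj, fun y hy => hj' y (by simpa using hy)⟩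
  choose J hJ hJ' using hlast
  let a : ∀ j : Fin (m + 1), Fin j → Fin (m + 1) := fun j x => ⟨x + 1, by omega⟩
  let b : ∀ j : Fin (m + 1), Fin (m - j) → Fin (m + 1) := fun j x => ⟨j + 1 + x, by omega⟩
  have ha : ∀ j, StrictMono (a j) := fun j x y hxy => Nat.add_lt_add_right hxy 1
  have hb : ∀ j, StrictMono (b j) := fun j x y hxy => Nat.add_lt_add_left hxy _
  let g : NonCrossingPartition (m + 1) →
      Σ j : Fin (m + 1), NonCrossingPartition j × NonCrossingPartition (m - j) :=
    fun r => ⟨J r, r.comap (a _) (ha _), r.comap (b _) (hb _)⟩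
  have hg : Function.Injective g := by
    intro r r' h
    have h1 : J r = J r' := congrArg Sigma.fst h
    have hr' := hJ r'
    have hr'' := hJ' r'
    have hr := hJ r
    have hr1 := hJ' r
    simp only [g] at h
    rw [← h1] at h hr' hr''
    generalize J r = j at *
    rw [Sigma.mk.injEq, heq_eq_eq, Prod.mk.injEq] at h
    obtain ⟨-, h2, h3⟩ := h
    have e2 : ∀ x y : Fin j, r.1 (a j x) (a j y) ↔ r'.1 (a j x) (a j y) := fun x y =>
      iff_of_eq (congrArg (fun s : NonCrossingPartition j => s.1 x y) h2)
    have e3 : ∀ x y : Fin (m - j), r.1 (b j x) (b j y) ↔ r'.1 (b j x) (b j y) := fun x y =>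
      iff_of_eq (congrArg (fun s : NonCrossingPartition (m - j) => s.1 x y) h3)
    have low : ∀ x y : Fin (m + 1), 0 < x → x ≤ j → 0 < y → y ≤ j → (r.1 x y ↔ r'.1 x y) := by
      intro x y hx hxj hy hyj
      have hx' : 0 < x.1 := hx
      have hy' : 0 < y.1 := hy
      have hxj' : x.1 ≤ j.1 := hxj
      have hyj' : y.1 ≤ j.1 := hyj
      have := e2 ⟨x.1 - 1, by omega⟩ ⟨y.1 - 1, by omega⟩
      have hx2 : a j ⟨x.1 - 1, by omega⟩ = x := Fin.ext (by simp only [a]; omega)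
      have hy2 : a j ⟨y.1 - 1, by omega⟩ = y := Fin.ext (by simp only [a]; omega)
      rwa [hx2, hy2] at this
    have high : ∀ x y : Fin (m + 1), j < x → j < y → (r.1 x y ↔ r'.1 x y) := by
      intro x y hx hy
      have hx' : j.1 < x.1 := hx
      have hy' : j.1 < y.1 := hy
      have := e3 ⟨x.1 - (j + 1), by omega⟩ ⟨y.1 - (j + 1), by omega⟩
      have hx2 : b j ⟨x.1 - (j + 1), by omega⟩ = x := Fin.ext (by simp only [b]; omega)
      have hy2 : b j ⟨y.1 - (j + 1), by omega⟩ = y := Fin.ext (by simp only [b]; omega)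
      rwa [hx2, hy2] at this
    have zero : ∀ r : NonCrossingPartition (m + 1), r.1 0 j → (∀ y, r.1 0 y → y ≤ j) →
        ∀ y, r.1 0 y ↔ y ≤ j ∧ r.1 j y := fun r hr hr1 y =>
      ⟨fun hy => ⟨hr1 y hy, r.1.trans (r.1.symm hr) hy⟩, fun hy => r.1.trans hr hy.2⟩
    -- A relation across `j` would cross the pair `0`, `j`, putting an element beyond `j` in the
    -- block of `0`.
    have mid : ∀ r : NonCrossingPartition (m + 1), r.1 0 j → (∀ y, r.1 0 y → y ≤ j) →
        ∀ x y, 0 < x → x ≤ j → j < y → ¬ r.1 x y := by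
      intro r hr hr1 x y hx hxj hjy hxy
      rcases eq_or_lt_of_le hxj with rfl | hxj
      · exact absurd (hr1 y (r.1.trans hr hxy)) (not_le.2 hjy)
      · have := r.2 0 x j y hx hxj hjy hr hxy
        exact absurd (hr1 y (r.1.trans this hxy)) (not_le.2 hjy)
    have key : ∀ x y : Fin (m + 1), x < y → (r.1 x y ↔ r'.1 x y) := by
      intro x y hxy
      rcases eq_or_lt_of_le (Fin.zero_le x) with rfl | hx
      · rw [zero r hr hr1, zero r' hr' hr'']
        refine and_congr_right fun hyj => low j y ?_ le_rfl hxy hyj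
        exact lt_of_lt_of_le hxy hyj
      · rcases lt_or_ge j x with hjx | hjx
        · exact high x y hjx (hjx.trans hxy)
        · rcases lt_or_ge j y with hjy | hjy
          · exact iff_of_false (mid r hr hr1 x y hx hjx hjy) (mid r' hr' hr'' x y hx hjx hjy)
          · exact low x y hx hjx (hx.trans hxy) hjy
    refine Subtype.ext (Setoid.ext fun x y => ?_)
    rcases lt_trichotomy x y with hxy | rfl | hxy
    · exact key x y hxy
    · exact iff_of_true (r.1.refl x) (r'.1.refl x)
    · exact ⟨fun hh => r'.1.symm ((key y x hxy).1 (r.1.symm hh)),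
        fun hh => r.1.symm ((key y x hxy).2 (r'.1.symm hh))⟩
  refine (Nat.card_le_card_of_injective g hg).trans ?_
  rw [Nat.card_sigma, catalan_succ]
  refine Finset.sum_le_sum fun j _ => ?_
  rw [Nat.card_prod]
  exact Nat.mul_le_mul (ih _ (by omega)) (ih _ (by omega))

/-! ### Counting the shuffles of two Dyck words -/

theorem catalan_mul_factorial (k : ℕ) :
    catalan k * ((k + 1).factorial * k.factorial) = (2 * k).factorial := by
  have h1 := succ_mul_catalan_eq_centralBinom k
  have h2 := Nat.choose_mul_factorial_mul_factorial (n := 2 * k) (k := k) (by omega)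
  rw [← Nat.centralBinom_eq_two_mul_choose, ← h1, show 2 * k - k = k by omega] at h2
  rw [← h2, Nat.factorial_succ]
  ring

/-- This is Vandermonde's identity for `n + (n + 2)`, after the symmetry of the second binomial; its
additional term `k = n + 1` vanishes. -/
theorem sum_choose_mul_choose (n : ℕ) :
    ∑ k : Fin (n + 1), n.choose k * (n + 2).choose (k + 1) = (2 * n + 2).choose (n + 1) := by
  rw [show 2 * n + 2 = n + (n + 2) by ring, Nat.add_choose_eq,
    Finset.Nat.sum_antidiagonal_eq_sum_range_succ_mk, Finset.sum_range_succ,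
    Nat.choose_succ_self, zero_mul, add_zero,
    Fin.sum_univ_eq_sum_range (fun k => n.choose k * (n + 2).choose (k + 1)) (n + 1)]
  refine Finset.sum_congr rfl fun k hk => ?_
  have hk : k < n + 1 := Finset.mem_range.1 hk
  congr 1
  exact Nat.choose_symm_of_eq_add (by omega)

/-- The number of shuffles of two Dyck words. -/
theorem sum_choose_mul_catalan_mul_catalan (n : ℕ) :
    ∑ k : Fin (n + 1), (2 * n).choose (2 * k) * (catalan k * catalan (n - k)) =
      catalan n * catalan (n + 1) := by
  -- This factor clears the denominators: each summand becomes `(2 * n).factorial` times a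
  -- Vandermonde term.
  have hpos : 0 < n.factorial * (n + 2).factorial := by positivity
  refine Nat.eq_of_mul_eq_mul_right hpos ?_
  have key : ∀ k : Fin (n + 1), (2 * n).choose (2 * k) * (catalan k * catalan (n - k)) *
      (n.factorial * (n + 2).factorial) =
        (2 * n).factorial * (n.choose k * (n + 2).choose (k + 1)) := by
    rintro ⟨k, hk⟩
    have h1 := catalan_mul_factorial k
    have h2 := catalan_mul_factorial (n - k)
    have h3 := Nat.choose_mul_factorial_mul_factorial (n := 2 * n) (k := 2 * k) (by omega)
    have h4 := Nat.choose_mul_factorial_mul_factorial (n := n) (k := k) (by omega)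
    have h5 := Nat.choose_mul_factorial_mul_factorial (n := n + 2) (k := k + 1) (by omega)
    rw [show 2 * n - 2 * k = 2 * (n - k) by omega, ← h1, ← h2] at h3
    rw [show n + 2 - (k + 1) = n - k + 1 by omega] at h5
    rw [← h3, ← h4, ← h5]
    ring
  rw [Finset.sum_mul, Finset.sum_congr rfl fun k _ => key k, ← Finset.mul_sum,
    sum_choose_mul_choose, ← catalan_mul_factorial n]
  have h6 := succ_mul_catalan_eq_centralBinom (n + 1)
  rw [Nat.centralBinom_eq_two_mul_choose, show 2 * (n + 1) = 2 * n + 2 by ring] at h6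
  rw [← h6, Nat.factorial_succ (n + 1)]
  ring

/-! ### From Dyck words back to matchings -/

namespace IsNonCrossingMatching

variable {m m' : ℕ} {f f' : ℕ → ℕ}

theorem append (hf : IsNonCrossingMatching m f) (hf' : IsNonCrossingMatching m' f') :
    ∃ g, IsNonCrossingMatching (m + m') g ∧
      matchingWord (m + m') g = matchingWord m f ++ matchingWord m' f' := by
  refine ⟨fun i => if i < m then f i else f' (i - m) + m, ⟨fun i hi => ?_, fun i hi => ?_,
    fun i hi => ?_, fun i j hi hij hj => ?_⟩, ?_⟩
  · split_ifs with h
    · have := hf.lt i h; omega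
    · have := hf'.lt (i - m) (by omega); omega
  · by_cases h : i < m
    · simp only [h, hf.lt i h, if_true, hf.apply_apply i h]
    · simp only [h, if_false, show ¬ f' (i - m) + m < m by omega, Nat.add_sub_cancel,
        hf'.apply_apply (i - m) (by omega)]
      omega
  · split_ifs with h
    · exact hf.ne i h
    · have := hf'.ne (i - m) (by omega); omega
  · by_cases h : i < m
    · simp only [h, if_true] at hj ⊢
      have := hf.lt i h
      simp only [show j < m by omega, if_true]
      exact hf.nested i j h hij hj
    · simp only [h, show ¬ j < m by omega, if_false] at hj ⊢
      have := hf'.nested (i - m) (j - m) (by omega) (by omega) (by omega)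
      omega
  · rw [matchingWord, List.range_add, List.map_append, List.map_map]
    congr 1
    · refine List.map_congr_left fun i hi => ?_
      simp [List.mem_range.1 hi]
    · refine List.map_congr_left fun i hi => ?_
      simp [add_comm m]

theorem nest (hf : IsNonCrossingMatching m f) :
    ∃ g, IsNonCrossingMatching (m + 2) g ∧
      matchingWord (m + 2) g = .U :: matchingWord m f ++ [.D] := by
  have hlt := hf.lt
  refine ⟨fun i => if i = 0 then m + 1 else if i = m + 1 then 0 else f (i - 1) + 1,
    ⟨fun i hi => ?_, fun i hi => ?_, fun i hi => ?_, fun i j hi hij hj => ?_⟩, ?_⟩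
  · split_ifs with h1 h2
    · omega
    · omega
    · have := hf.lt (i - 1) (by omega); omega
  · by_cases h1 : i = 0
    · simp [h1]
    · by_cases h2 : i = m + 1
      · simp [h2]
      · have h3 := hf.lt (i - 1) (by omega)
        have h4 := hf.apply_apply (i - 1) (by omega)
        simp only [h1, h2, if_false, show ¬ (f (i - 1) + 1 = 0) by omega,
          show ¬ (f (i - 1) + 1 = m + 1) by omega, Nat.add_sub_cancel, h4]
        omega
  · split_ifs with h1 h2
    · omega
    · omega
    · have := hf.ne (i - 1) (by omega); omega
  · by_cases h1 : i = 0
    · simp only [h1, if_true, show ¬ j = 0 by omega, if_false] at hj ⊢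
      have := hf.lt (j - 1) (by omega)
      simp only [show ¬ j = m + 1 by omega, if_false]
      omega
    · by_cases h2 : i = m + 1
      · simp [h2] at hj
      · simp only [h1, h2, if_false] at hj ⊢
        have h3 := hf.lt (i - 1) (by omega)
        have := hf.nested (i - 1) (j - 1) (by omega) (by omega) (by omega)
        simp only [show ¬ j = 0 by omega, show ¬ j = m + 1 by omega, if_false]
        omega
  · rw [matchingWord, List.range_succ, List.range_succ_eq_map, matchingWord]
    simp only [List.map_append, List.map_cons, List.map_map, List.map_nil]
    congr 1
    congr 1
    refine List.map_congr_left fun i hi => ?_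
    have := List.mem_range.1 hi
    simp [show i ≠ m by omega]

end IsNonCrossingMatching

/-- Induction along the first-return decomposition: `nest` handles the inside part and `append` adds
the outside part. -/
theorem DyckWord.exists_isNonCrossingMatching (p : DyckWord) :
    ∃ f, IsNonCrossingMatching p.toList.length f ∧ matchingWord p.toList.length f = p.toList := by
  induction hp : p.semilength using Nat.strong_induction_on generalizing p with
  | _ d ih =>
    subst hp
    by_cases h : p = 0
    · subst h
      exact ⟨id, ⟨fun i hi => absurd hi (Nat.not_lt_zero i), fun i hi => absurd hi (Nat.not_lt_zero i),
        fun i hi => absurd hi (Nat.not_lt_zero i), fun i j hi => absurd hi (Nat.not_lt_zero i)⟩, rfl⟩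
    · obtain ⟨f, hf, hfw⟩ := ih _ (semilength_insidePart_lt h) _ rfl
      obtain ⟨g, hg, hgw⟩ := ih _ (semilength_outsidePart_lt h) _ rfl
      obtain ⟨f', hf', hfw'⟩ := hf.nest
      obtain ⟨k, hk, hkw⟩ := hf'.append hg
      have hl : p.toList = .U :: p.insidePart.toList ++ [.D] ++ p.outsidePart.toList := by
        conv_lhs => rw [← nest_insidePart_add_outsidePart h]
        rfl
      have hlen : p.toList.length = p.insidePart.toList.length + 2 + p.outsidePart.toList.length := by
        rw [hl]; simp; ring
      rw [hlen]
      exact ⟨k, hk, by rw [hkw, hfw', hfw, hgw, hl]⟩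

section Transport

variable {H : Type*} [LinearOrder H]

/-- The sequence of openers and closers of `a` on the finite set `S`. -/
def openerWord (S : Finset H) (a : H → H) : List DyckStep :=
  List.ofFn fun i : Fin S.card =>
    if S.orderEmbOfFin rfl i < a (S.orderEmbOfFin rfl i) then .U else .D

theorem openerWord_congr {S : Finset H} {a b : H → H} (h : ∀ x ∈ S, a x = b x) :
    openerWord S a = openerWord S b := by
  rw [openerWord, openerWord]
  congr 1
  funext i
  rw [h _ (Finset.orderEmbOfFin_mem S rfl i)]

/-- A Dyck word defines a non-crossing matching of every finite set of the right size. -/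
theorem DyckWord.exists_matching (p : DyckWord) (S : Finset H) (hS : S.card = 2 * p.semilength) :
    ∃ g : H → H, (∀ x ∈ S, g x ∈ S ∧ g (g x) = x ∧ g x ≠ x) ∧
      (∀ x ∈ S, ∀ y ∈ S, x < y → y < g x → x < g y ∧ g y < g x) ∧ openerWord S g = p.toList := by
  classical
  obtain ⟨f, hf, hfw⟩ := p.exists_isNonCrossingMatching
  rw [p.two_mul_semilength_eq_length] at hS
  rw [← hS] at hf hfw
  let e := S.orderIsoOfFin rfl
  let g : H → H := fun x => if hx : x ∈ S then
    S.orderEmbOfFin rfl ⟨f (e.symm ⟨x, hx⟩), hf.lt _ (e.symm ⟨x, hx⟩).2⟩ else x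
  have hg : ∀ i : Fin S.card, g (S.orderEmbOfFin rfl i) =
      S.orderEmbOfFin rfl ⟨f i, hf.lt _ i.2⟩ := by
    intro i
    have hi := Finset.orderEmbOfFin_mem S rfl i
    have : e.symm ⟨_, hi⟩ = i := by
      rw [OrderIso.symm_apply_eq]
      exact Subtype.ext rfl
    simp only [g, dif_pos hi, this]
  have hS' : ∀ x ∈ S, ∃ i : Fin S.card, S.orderEmbOfFin rfl i = x := by
    intro x hx
    have : x ∈ Set.range (S.orderEmbOfFin rfl) := by
      rw [Finset.range_orderEmbOfFin]; exact hx
    exact this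
  refine ⟨g, ?_, ?_, ?_⟩
  · intro x hx
    obtain ⟨i, rfl⟩ := hS' x hx
    rw [hg, hg]
    refine ⟨Finset.orderEmbOfFin_mem S rfl _, ?_, ?_⟩
    · congr 1
      exact Fin.ext (hf.apply_apply i i.2)
    · rw [ne_eq, EmbeddingLike.apply_eq_iff_eq]
      exact fun hh => hf.ne i i.2 (congrArg Fin.val hh)
  · intro x hx y hy
    obtain ⟨i, rfl⟩ := hS' x hx
    obtain ⟨j, rfl⟩ := hS' y hy
    rw [hg, hg]
    simp only [OrderEmbedding.lt_iff_lt]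
    exact hf.nested i j i.2
  · rw [← hfw, openerWord]
    simp only [hg, OrderEmbedding.lt_iff_lt]
    refine List.ext_getElem (by simp [matchingWord]) fun i h1 h2 => ?_
    simp [matchingWord, Fin.lt_def]

end Transport

/-! ### From a non-crossing tour back to a spanning tree -/

namespace MapData

variable {H : Type*} {M : MapData H} {T : Set H} {N : ℕ} {pos : H → ℕ}

/-- `τ` advances the time by one, so it turns the interval open at `x` and closed at `β x` into one
closed at `x` and open at `β x`. Exchanging `x` and `β x` compensates for this, and the other pairs
do not cross the interval. -/
theorem isEdgeCut_indicator {τ β : Equiv.Perm H} {r x : H} (hβ : ∀ x, β (β x) = x)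
    (h1 : ∀ k ≤ N, pos (τ^[k] r) = k) (h2 : ∀ x, τ^[pos x] r = x) (h3 : ∀ x, pos x ≤ N)
    (h4 : τ^[N + 1] r = r) (hx : pos x < pos (β x))
    (hb : ∀ y, y ≠ x → y ≠ β x → ((pos x < pos (β y) ∧ pos (β y) ≤ pos (β x)) ↔
      (pos x < pos y ∧ pos y ≤ pos (β x)))) :
    IsEdgeCut τ β r x fun y => if pos x < pos y ∧ pos y ≤ pos (β x) then 1 else 0 := by
  have hr : pos r = 0 := h1 0 (Nat.zero_le _)
  have hinj : Function.Injective pos := fun x y h => by rw [← h2 x, h, h2]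
  have hτ : ∀ z, (pos x < pos (τ z) ∧ pos (τ z) ≤ pos (β x)) ↔
      (pos x ≤ pos z ∧ pos z < pos (β x)) := by
    intro z
    have hz : τ z = τ^[pos z + 1] r := by rw [Function.iterate_succ_apply', h2]
    have hβx := h3 (β x)
    rcases Nat.eq_or_lt_of_le (h3 z) with heq | hlt
    · rw [hz, heq, h4, hr]
      omega
    · rw [hz, h1 _ hlt]
      omega
  refine ⟨by simp [hr], fun y => ?_, ?_, fun y h5 h6 => ?_⟩
  · simp only [hτ]
    congr 1
    rw [eq_iff_iff]
    by_cases h5 : y = x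
    · rw [h5]; omega
    · by_cases h6 : y = β x
      · rw [h6, hβ]; omega
      · rw [← hb y h5 h6]
        have h7 : pos (β y) ≠ pos x := hinj.ne fun hh => h6 (by rw [← hh, hβ])
        have h8 : pos (β y) ≠ pos (β x) := hinj.ne fun hh => h5 (β.injective hh)
        omega
  · simp [hx]
  · simp only [hb y h5 h6]

/-- The converse of `IsSpanningTree.exists_isTreeTour`. -/
theorem isSpanningTree_of_tour [Finite H] (h2 : ∀ x, M.edge (M.edge x) = x)
    (h3 : ∀ x, M.edge x = x ↔ x = M.root) (hroot : M.root ∈ T) (hT : ∀ x, M.edge x ∈ T ↔ x ∈ T)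
    (p1 : ∀ x, pos x ≤ N) (p2 : ∀ k ≤ N, pos (M.tour T k) = k) (p3 : ∀ x, M.tour T (pos x) = x)
    (p4 : M.tour T (N + 1) = M.root)
    (hb : ∀ x, pos x < pos (M.edge x) → ∀ y, (y ∈ T ↔ x ∈ T) → y ≠ x → y ≠ M.edge x →
      ((pos x < pos (M.edge y) ∧ pos (M.edge y) ≤ pos (M.edge x)) ↔
        (pos x < pos y ∧ pos y ≤ pos (M.edge x)))) :
    M.IsRootedMap ∧ M.IsSpanningTree T := by
  have : Nonempty H := ⟨M.root⟩
  have hpos : Function.Injective pos := fun x y h => by rw [← p3 x, h, p3]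
  simp only [tour_eq_iterate hT] at p2 p3 p4
  have hτ : ∀ x y, (M.tourPerm T hT).SameCycle x y := by
    intro x y
    rw [← p3 x, ← p3 y]
    exact (sameCycle_iff_exists_iterate.2 ⟨_, rfl⟩ :
      (M.tourPerm T hT).SameCycle M.root _).symm.trans (sameCycle_iff_exists_iterate.2 ⟨_, rfl⟩)
  have hV : M.numVertices = Nat.card {x // pos x < pos (M.edgeOn T hT x)} + 1 := by
    have := (numCycles_eq_iff_exists_isEdgeCut hτ (edgeOn_edgeOn hT h2) hpos M.root).2 fun x hx => by
      have hxT : x ∈ T := by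
        by_contra hh
        rw [edgeOn_of_notMem hT hh] at hx
        exact lt_irrefl _ hx
      refine ⟨_, isEdgeCut_indicator (edgeOn_edgeOn hT h2) p2 p3 p1 p4 hx fun y h5 h6 => ?_⟩
      rw [edgeOn_of_mem hT hxT] at hx h6 ⊢
      by_cases hy : y ∈ T
      · rw [edgeOn_of_mem hT hy]
        exact hb x hx y (iff_of_true hy hxT) h5 h6
      · rw [edgeOn_of_notMem hT hy]
    rw [tourPerm_mul_edgeOn hT h2] at this
    exact this
  have hF : M.numFaces =
      Nat.card {x // pos x < pos (M.edgeOn Tᶜ (compl_edge_mem hT) x)} + 1 := by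
    have hT' := compl_edge_mem hT
    have := (numCycles_eq_iff_exists_isEdgeCut hτ (edgeOn_edgeOn hT' h2) hpos M.root).2 fun x hx => by
      have hxT : x ∈ Tᶜ := by
        by_contra hh
        rw [edgeOn_of_notMem hT' hh] at hx
        exact lt_irrefl _ hx
      refine ⟨_, isEdgeCut_indicator (edgeOn_edgeOn hT' h2) p2 p3 p1 p4 hx fun y h5 h6 => ?_⟩
      rw [edgeOn_of_mem hT' hxT] at hx h6 ⊢
      by_cases hy : y ∈ Tᶜ
      · rw [edgeOn_of_mem hT' hy]
        exact hb x hx y (iff_of_false hy hxT) h5 h6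
      · rw [edgeOn_of_notMem hT' hy]
    rw [tourPerm_mul_edgeOn_compl hT] at this
    exact this
  have hE := numEdges_eq_add hT h2 h3 hpos
  -- Outside `T` the tour turns around the vertex, so it meets `T` there, at the latest at the root
  -- after time `N`.
  have hspan : ∀ x, ∃ y ∈ T, M.SameVertex x y := by
    intro x
    induction hd : N - pos x using Nat.strong_induction_on generalizing x with
    | _ d ih =>
      by_cases hx : x ∈ T
      · exact ⟨x, hx, .refl _ _⟩
      have hr : M.rot x = (M.tourPerm T hT)^[pos x + 1] M.root := by
        rw [Function.iterate_succ_apply', p3, tourPerm, Equiv.Perm.mul_apply,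
          edgeOn_of_notMem hT hx]
      have hxr : M.SameVertex x (M.rot x) := sameVertex_iterate x 1
      rcases Nat.eq_or_lt_of_le (p1 x) with heq | hlt
      · rw [hr, heq, p4] at hxr
        exact ⟨_, hroot, hxr⟩
      · obtain ⟨y, hy, hxy⟩ := ih (N - pos (M.rot x)) (by rw [hr, p2 _ hlt]; omega) (M.rot x) rfl
        exact ⟨y, hy, hxr.trans hxy⟩
  have hconn : ∀ x, M.Joined Set.univ M.root x := by
    intro x
    rw [← p3 x]
    induction pos x with
    | zero => exact .refl _
    | succ k ih =>
      refine ih.trans _ _ _ ?_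
      rw [Function.iterate_succ_apply', tourPerm_apply, tourStep]
      split_ifs
      · exact .trans _ (M.edge _) _ (.rel _ _ (.inr ⟨trivial, rfl⟩)) (.rel _ _ (.inl rfl))
      · exact .rel _ _ (.inl rfl)
  have hFs : (M.submap T hroot hT).numFaces = 1 := by
    rw [submap_numFaces hT hroot hspan, numCycles_eq_one_iff]
    exact hτ
  refine ⟨⟨h2, h3, fun x y => (hconn x).symm.trans _ _ _ (hconn y), by omega⟩,
    ⟨hroot, hT, ⟨fun x => Subtype.ext (h2 x.1), fun x => ?_, joined_univ_of_numFaces_eq_one hFs, ?_⟩,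
      hFs⟩, hspan⟩
  · rw [Subtype.ext_iff, Subtype.ext_iff]
    exact h3 x.1
  · rw [hFs, submap_numVertices hT hroot hspan, submap_numEdges hT hroot h2 h3 hpos, hV]

end MapData

theorem between_iff_of_nested {H : Type*} [LinearOrder H] {S : Finset H} {g : H → H}
    (hg : ∀ x ∈ S, g x ∈ S ∧ g (g x) = x ∧ g x ≠ x)
    (hn : ∀ x ∈ S, ∀ y ∈ S, x < y → y < g x → x < g y ∧ g y < g x) {x y : H} (hx : x ∈ S)
    (hy : y ∈ S) (hyx : y ≠ x) (hyg : y ≠ g x) : (x < g y ∧ g y ≤ g x) ↔ (x < y ∧ y ≤ g x) := by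
  constructor
  · rintro ⟨h1, h2⟩
    have h3 : g y ≠ g x := fun h => hyx (by rw [← (hg y hy).2.1, h, (hg x hx).2.1])
    have := hn x hx (g y) (hg y hy).1 h1 (lt_of_le_of_ne h2 h3)
    rw [(hg y hy).2.1] at this
    exact ⟨this.1, this.2.le⟩
  · rintro ⟨h1, h2⟩
    have := hn x hx y hy h1 (lt_of_le_of_ne h2 hyg)
    exact ⟨this.1, this.2.le⟩

theorem val_iterate_finRotate_zero (m k : ℕ) :
    ((finRotate (m + 1))^[k] 0 : ℕ) = k % (m + 1) := by
  induction k with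
  | zero => simp
  | succ k ih =>
    rw [Function.iterate_succ_apply', finRotate_apply, Fin.val_add, ih, Fin.val_one']
    simp

/-! ### Tree-rooted maps from shuffles, and the lower bound -/

namespace LabelledTreeRootedMap

variable {n : ℕ}

/-- A shuffle of two Dyck words is the code of a tree-rooted map: the two words describe
the tour of the tree, and how the edges not in the tree are met. -/
theorem exists_of_shuffle (S : Finset (Fin (2 * n))) (p q : DyckWord)
    (hp : S.card = 2 * p.semilength) (hq : Sᶜ.card = 2 * q.semilength) :
    ∃ M : LabelledTreeRootedMap n, (∀ x : Fin (2 * n + 1), M.map.tour M.tree x = x) ∧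
      (∀ i, Fin.succ i ∈ M.tree ↔ i ∈ S) ∧
      openerWord (S.map (Fin.succEmb (2 * n))) M.map.edge = p.toList ∧
      openerWord (Sᶜ.map (Fin.succEmb (2 * n))) M.map.edge = q.toList := by
  classical
  set S₁ := S.map (Fin.succEmb (2 * n)) with hS₁
  set S₂ := Sᶜ.map (Fin.succEmb (2 * n)) with hS₂
  obtain ⟨g₁, hg₁, hn₁, hw₁⟩ := p.exists_matching S₁ (by rw [hS₁, Finset.card_map, hp])
  obtain ⟨g₂, hg₂, hn₂, hw₂⟩ := q.exists_matching S₂ (by rw [hS₂, Finset.card_map, hq])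
  have hS₁s : ∀ i : Fin (2 * n), i.succ ∈ S₁ ↔ i ∈ S := fun i => by simp [hS₁]
  have hS₂s : ∀ i : Fin (2 * n), i.succ ∈ S₂ ↔ i ∉ S := fun i => by simp [hS₂]
  have h01 : 0 ∉ S₁ := by simp [hS₁, Fin.succ_ne_zero]
  have h02 : 0 ∉ S₂ := by simp [hS₂, Fin.succ_ne_zero]
  have h12 : ∀ x ∈ S₂, x ∉ S₁ := by
    intro x
    refine Fin.cases (fun h => absurd h h02) (fun i hi => ?_) x
    rw [hS₁s]; exact (hS₂s i).1 hi
  have hcov : ∀ x, x = 0 ∨ x ∈ S₁ ∨ x ∈ S₂ := by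
    intro x
    refine Fin.cases (Or.inl rfl) (fun i => Or.inr ?_) x
    rw [hS₁s, hS₂s]; exact em _
  let a : Fin (2 * n + 1) → Fin (2 * n + 1) :=
    fun x => if x ∈ S₁ then g₁ x else if x ∈ S₂ then g₂ x else x
  have ha₁ : ∀ x ∈ S₁, a x = g₁ x := fun x hx => if_pos hx
  have ha₂ : ∀ x ∈ S₂, a x = g₂ x := fun x hx => by
    simp only [a, if_neg (h12 x hx), if_pos hx]
  have ha₀ : a 0 = 0 := by simp only [a, if_neg h01, if_neg h02]
  have haa : Function.Involutive a := by
    intro x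
    rcases hcov x with rfl | hx | hx
    · rw [ha₀, ha₀]
    · rw [ha₁ x hx, ha₁ _ (hg₁ x hx).1, (hg₁ x hx).2.1]
    · rw [ha₂ x hx, ha₂ _ (hg₂ x hx).1, (hg₂ x hx).2.1]
  let T : Set (Fin (2 * n + 1)) := {x | x = 0 ∨ x ∈ S₁}
  have hT₁ : ∀ x ∈ S₁, x ∈ T := fun x hx => Or.inr hx
  have hT₂ : ∀ x ∈ S₂, x ∉ T := by
    rintro x hx (rfl | h)
    · exact h02 hx
    · exact h12 x hx h
  have hT₀ : (0 : Fin (2 * n + 1)) ∈ T := Or.inl rfl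
  have hT : ∀ x, haa.toPerm a x ∈ T ↔ x ∈ T := by
    intro x
    change a x ∈ T ↔ _
    rcases hcov x with rfl | hx | hx
    · rw [ha₀]
    · rw [ha₁ x hx]; exact iff_of_true (hT₁ _ (hg₁ x hx).1) (hT₁ x hx)
    · rw [ha₂ x hx]; exact iff_of_false (hT₂ _ (hg₂ x hx).1) (hT₂ x hx)
  -- `edgeOn` depends only on `edge`; this auxiliary map makes it available before the rotation is
  -- defined.
  let M₀ : MapData (Fin (2 * n + 1)) := ⟨1, haa.toPerm a, 0⟩
  -- Half-edges are numbered by their times in the tour. Requiring the tour to be `finRotate` forces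
  -- this rotation, since `edgeOn` is an involution.
  let M : MapData (Fin (2 * n + 1)) :=
    ⟨finRotate (2 * n + 1) * M₀.edgeOn T hT, haa.toPerm a, 0⟩
  have hTM : ∀ x, M.edge x ∈ T ↔ x ∈ T := hT
  have htour : ∀ k : ℕ, (M.tour T k : ℕ) = k % (2 * n + 1) := by
    intro k
    have hperm : M.tourPerm T hTM = finRotate (2 * n + 1) := by
      ext x
      change ((finRotate (2 * n + 1)) (M₀.edgeOn T hT (M₀.edgeOn T hT x)) : ℕ) = _
      rw [MapData.edgeOn_edgeOn (M := M₀) hT haa]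
    rw [MapData.tour_eq_iterate hTM, hperm]
    exact val_iterate_finRotate_zero _ _
  have htour' : ∀ x : Fin (2 * n + 1), M.tour T x = x := fun x => by
    exact Fin.ext (by rw [htour, Nat.mod_eq_of_lt x.2])
  obtain ⟨h1, h2⟩ := MapData.isSpanningTree_of_tour (M := M) (T := T) (N := 2 * n)
    (pos := Fin.val) haa (fun x => by
      change a x = x ↔ x = 0
      rcases hcov x with rfl | hx | hx
      · exact iff_of_true ha₀ rfl
      · rw [ha₁ x hx]; exact iff_of_false (hg₁ x hx).2.2 fun h => h01 (h ▸ hx)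
      · rw [ha₂ x hx]; exact iff_of_false (hg₂ x hx).2.2 fun h => h02 (h ▸ hx))
    hT₀ hTM (fun x => Nat.le_of_lt_succ x.2)
    (fun k hk => by rw [htour, Nat.mod_eq_of_lt (Nat.lt_succ_of_le hk)]) htour'
    (Fin.ext (by rw [htour, Nat.mod_self]; rfl))
    (fun x hx y hyT hyx hya => by
      change (x < a y ∧ a y ≤ a x) ↔ (x < y ∧ y ≤ a x)
      change y ≠ a x at hya
      rcases hcov y with rfl | hy | hy
      · rw [ha₀]
      · rcases hcov x with rfl | hx' | hx'
        · exact absurd (show (0 : Fin (2 * n + 1)) < a 0 from hx) (by rw [ha₀]; exact lt_irrefl _)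
        · rw [ha₁ x hx'] at hya ⊢
          rw [ha₁ y hy]
          exact between_iff_of_nested hg₁ hn₁ hx' hy hyx hya
        · exact absurd (hyT.1 (hT₁ y hy)) (hT₂ x hx')
      · rcases hcov x with rfl | hx' | hx'
        · exact absurd (show (0 : Fin (2 * n + 1)) < a 0 from hx) (by rw [ha₀]; exact lt_irrefl _)
        · exact absurd (hyT.2 (hT₁ x hx')) (hT₂ y hy)
        · rw [ha₂ x hx'] at hya ⊢
          rw [ha₂ y hy]
          exact between_iff_of_nested hg₂ hn₂ hx' hy hyx hya)
  refine ⟨⟨M, h1, T, h2⟩, htour', fun i => ?_, ?_, ?_⟩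
  · rw [← hS₁s]
    exact or_iff_right (Fin.succ_ne_zero i)
  · rw [← hw₁]
    exact openerWord_congr ha₁
  · rw [← hw₂]
    exact openerWord_congr ha₂

/-- The maps built from shuffles have their half-edges labelled by tour time. An isomorphism
preserves the tour, so between two of them it is the identity, and the set `S` and both words can be
read off. -/
theorem catalan_mul_catalan_le_card [Finite (TreeRootedMap n)] :
    catalan n * catalan (n + 1) ≤ Nat.card (TreeRootedMap n) := by
  classical
  let C := (k : Fin (n + 1)) × {S : Finset (Fin (2 * n)) // S.card = 2 * k} ×
    {p : DyckWord // p.semilength = k} × {q : DyckWord // q.semilength = n - k}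
  have hC : Nat.card C = catalan n * catalan (n + 1) := by
    rw [← sum_choose_mul_catalan_mul_catalan, Nat.card_sigma]
    refine Finset.sum_congr rfl fun k _ => ?_
    rw [Nat.card_prod, Nat.card_prod, Nat.card_eq_fintype_card, Nat.card_eq_fintype_card,
      Nat.card_eq_fintype_card, Fintype.card_finset_len, Fintype.card_fin,
      DyckWord.card_dyckWord_semilength_eq_catalan, DyckWord.card_dyckWord_semilength_eq_catalan]
  have hM : ∀ c : C, ∃ M : LabelledTreeRootedMap n,
      (∀ x : Fin (2 * n + 1), M.map.tour M.tree x = x) ∧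
      (∀ i, Fin.succ i ∈ M.tree ↔ i ∈ c.2.1.1) ∧
      openerWord (c.2.1.1.map (Fin.succEmb (2 * n))) M.map.edge = c.2.2.1.1.toList ∧
      openerWord (c.2.1.1ᶜ.map (Fin.succEmb (2 * n))) M.map.edge = c.2.2.2.1.toList := by
    rintro ⟨k, ⟨S, hS⟩, ⟨p, hp⟩, ⟨q, hq⟩⟩
    refine exists_of_shuffle S p q (by rw [hS, hp]) ?_
    rw [Finset.card_compl, hS, hq, Fintype.card_fin]
    omega
  choose F hF1 hF2 hF3 hF4 using hM
  rw [← hC]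
  refine Nat.card_le_card_of_injective
    (fun c => Quotient.mk (LabelledTreeRootedMap.setoid n) (F c)) fun c c' hcc => ?_
  obtain ⟨e, he, heT⟩ := Quotient.exact hcc
  have hid : ∀ x, e x = x := fun x => by
    conv_lhs => rw [← hF1 c x, he.tour heT, hF1 c' x]
  have hedge : ∀ x, (F c).map.edge x = (F c').map.edge x := fun x => by
    rw [← hid ((F c).map.edge x), he.edge, hid]
  have h2 : c.2.1.1 = c'.2.1.1 := by
    ext i
    rw [← hF2, ← hF2, ← heT, hid]
  have h3 := hF3 c
  have h4 := hF4 c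
  have h3' := hF3 c'
  have h4' := hF4 c'
  rw [h2, openerWord_congr fun x _ => hedge x, h3'] at h3
  rw [h2, openerWord_congr fun x _ => hedge x, h4'] at h4
  obtain ⟨k, ⟨S, hS⟩, ⟨p, hp⟩, ⟨q, hq⟩⟩ := c
  obtain ⟨k', ⟨S', hS'⟩, ⟨p', hp'⟩, ⟨q', hq'⟩⟩ := c'
  obtain rfl : S = S' := h2
  obtain rfl : p' = p := DyckWord.ext h3
  obtain rfl : q' = q := DyckWord.ext h4
  obtain rfl : k = k' := Fin.ext (by rw [← hp, ← hp'])
  rfl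

/-! ### The bijection -/

theorem numEdges_map (M : LabelledTreeRootedMap n) : M.map.numEdges = n := by
  have hpos : Function.Injective (Fin.val : Fin (2 * n + 1) → ℕ) := Fin.val_injective
  have h1 := card_cycles_ne_eq_card_openers M.isRootedMap.edge_edge
    M.isRootedMap.edge_eq_self_iff hpos
  have h2 := two_mul_card_openers M.isRootedMap.edge_edge hpos
  have h3 : Nat.card {x // M.map.edge x ≠ x} = 2 * n := by
    simp only [ne_eq, M.isRootedMap.edge_eq_self_iff]
    rw [Nat.card_eq_fintype_card, Fintype.card_subtype_compl, Fintype.card_subtype_eq,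
      Fintype.card_fin, Nat.add_sub_cancel]
  change M.map.numEdges = _ at h1
  omega

theorem exists_isTreeTour (M : LabelledTreeRootedMap n) :
    ∃ pos, M.map.IsTreeTour M.tree (2 * n) pos := by
  have := MapData.IsSpanningTree.exists_isTreeTour M.isRootedMap M.isSpanningTree
  rwa [Nat.card_eq_fintype_card, Fintype.card_fin, Nat.add_sub_cancel] at this

theorem isPlaneTree_phi0 (M : LabelledTreeRootedMap n) : M.phi0.IsPlaneTree := by
  obtain ⟨pos, h⟩ := M.exists_isTreeTour
  exact h.isExplodedTour.isPlaneTree_explosion h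

theorem isNonCrossing_phi1 (M : LabelledTreeRootedMap n) : IsNonCrossing M.phi1 := by
  obtain ⟨pos, h⟩ := M.exists_isTreeTour
  have := h.isExplodedTour.isNonCrossing_explosionRel h
  rwa [M.numEdges_map] at this

/-- The pair formed by the tree and the partition. -/
noncomputable def phi (M : LabelledTreeRootedMap n) : PlaneTree n × NonCrossingPartition (n + 1) :=
  (Quotient.mk (LabelledPlaneTree.setoid n) ⟨M.phi0, M.isPlaneTree_phi0⟩,
    ⟨M.phi1, M.isNonCrossing_phi1⟩)

theorem phi_eq_iff {M N : LabelledTreeRootedMap n} : M.phi = N.phi ↔ M ≈ N := by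
  constructor
  · intro hMN
    obtain ⟨e, he⟩ := Quotient.exact (congrArg Prod.fst hMN)
    have hrel : M.phi1 = N.phi1 := congrArg (fun p => p.2.1) hMN
    obtain ⟨pos, h⟩ := M.exists_isTreeTour
    obtain ⟨pos', h'⟩ := N.exists_isTreeTour
    refine ⟨e, MapData.isIso_of_explosion h h.isExplodedTour h' h'.isExplodedTour he ?_ ?_⟩
    · rw [M.numEdges_map, N.numEdges_map]
    · rw [M.numEdges_map]; exact hrel.symm
  · rintro ⟨e, he, hT⟩
    have hO := he.mem_treeHeads_iff hT
    refine Prod.ext (Quotient.sound ⟨e, he.explosion hO⟩) (Subtype.ext ?_)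
    exact (he.explosionRel_eq hO (n + 1)).symm

end LabelledTreeRootedMap

theorem mainTheorem1 (n : ℕ) :
    (∃ Φ : TreeRootedMap n → PlaneTree n × NonCrossingPartition (n + 1),
      (∀ M : LabelledTreeRootedMap n,
        ∃ (h₀ : M.phi0.IsPlaneTree) (h₁ : IsNonCrossing M.phi1),
          Φ (Quotient.mk (LabelledTreeRootedMap.setoid n) M) =
            (Quotient.mk (LabelledPlaneTree.setoid n) ⟨M.phi0, h₀⟩, ⟨M.phi1, h₁⟩)) ∧
      Function.Bijective Φ) ∧
    Nat.card (TreeRootedMap n) = catalan n * catalan (n + 1) := by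
  have := planeTree_finite n
  have := nonCrossingPartition_finite (n + 1)
  let Φ : TreeRootedMap n → PlaneTree n × NonCrossingPartition (n + 1) :=
    Quotient.lift LabelledTreeRootedMap.phi fun _ _ => LabelledTreeRootedMap.phi_eq_iff.2
  have hΦ : Function.Injective Φ := fun x y => Quotient.inductionOn₂ x y fun _ _ h =>
    Quotient.sound (LabelledTreeRootedMap.phi_eq_iff.1 h)
  have : Finite (TreeRootedMap n) := Finite.of_injective Φ hΦ
  have hle : Nat.card (PlaneTree n × NonCrossingPartition (n + 1)) ≤
      catalan n * catalan (n + 1) := by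
    rw [Nat.card_prod]
    exact Nat.mul_le_mul (card_planeTree_le n) (card_nonCrossingPartition_le (n + 1))
  have hge := LabelledTreeRootedMap.catalan_mul_catalan_le_card (n := n)
  -- The lower bound for the source reaches the upper bound for the finite target, so the injective
  -- `Φ` is bijective.
  exact ⟨⟨Φ, fun M => ⟨M.isPlaneTree_phi0, M.isNonCrossing_phi1, rfl⟩,
      hΦ.bijective_of_nat_card_le (hle.trans hge)⟩,
    le_antisymm ((Nat.card_le_card_of_injective Φ hΦ).trans hle) hge⟩
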